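/- **Setting.** $G=(V,E)$ is a simple graph on $V=\{1,\dots,n\}$ with $m$ edges, and $\mathcal T$ is the set of its (not necessarily induced) four-cycles. The streaming algorithm is given $n$, an accuracy $\varepsilon\in(0,1]$ and a number $T\ge 2$ with $T\le|\mathcal T|\le\alpha T$, where $\alpha\ge 1$ is a known constant. A further constant $c\ge1$ is fixed. Logarithms are to base 2. Put $\delta=\varepsilon/(2098\log^3T)$, $\mathcal I=\{2^kT^{1/4}: k=0,\dots,\lceil\log (T^{1/4})\rceil\}$ and, for $\kappa\in\mathcal I$, $p_{1,\kappa}=\min\{1,\,c\kappa/(\delta^{3.5}\sqrt T)\}$, $p_{2,\kappa}=\min\{1,\,c/(\delta^{3.5}\kappa)\}$. **Configurations.** A configuration is $(A,\kappa,x,y)$ with $A\in\mathcal T$, $\kappa\in\mathcal I$, $x,y\in V(A)$, $x<y$. Its labeling $\ell_c$ of $V(A)$ is: if $x,y$ are opposite in $A$, then $x,y\mapsto S_1$ and the other two nodes $\mapsto S_2$; if they are adjacent in $A$, then $x\mapsto R_{1a}$, $y\mapsto R_{1b}$, the other neighbour of $y$ in $A$ $\mapsto R_{2a}$, the other neighbour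 of $x$ in $A$ $\mapsto R_{2b}$. Labels $S_1,R_{1a},R_{1b}$ are of type 1, the others of type 2. The substructures of $A$ are its 4 nodes, 4 edges, 4 wedges (paths of two edges) and 2 pairs of opposite nodes; a labeled substructure $(s,\kappa,\ell)$ belongs to $c=(A,\kappa,x,y)$ if $s$ is a substructure of $A$, the values of $\kappa$ agree, and $\ell=\ell_c|_{V(s)}$. The heaviness $t(s)$ is the number of four-cycles of which $s$ is a substructure. The threshold $\theta_{(s,\kappa,\ell)}$ is: - node: $\kappa\sqrt T/\delta^{1.5}$ for type 1, $T/(\kappa\delta^{1.5})$ for type 2; - edge or opposite pair: $\kappa^2/\delta^2$, $\sqrt T/\delta^2$, $T/(\kappa^2\delta^2)$ if it has 2, 1, 0 nodes of type 1; - wedge: $\kappa/\delta$ if it has 2 nodes of type 1, $\sqrt T/(\kappa\delta)$ if it has 1. **Refined heaviness, lightness, validity.** Let $s_1,s_2,s_3\in[1,2)$ (the shifts). A configuration $(A,\kappa,x,y)$ is *invalid* if $e=\{x,y\}$ is an edge of $A$ and $t(e)\le s_2\sqrt T/\delta^2$, and otherwise *valid*. The refined heaviness $t(s,\kappa,\ell)$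 is as follows. For an edge with two labels of type 2, it is the number of configurations $c$ containing $(s,\kappa,\ell)$ such that $t(\wedge)\le s_1\theta$ for every labeled wedge of $c$. For a node, it is the number of valid configurations $c$ containing $(s,\kappa,\ell)$ such that every labeled wedge of $c$ satisfies $t(\wedge)\le s_1\theta$ and every labeled edge of $c$ has refined heaviness at most $s_2\theta$. In all other cases $t(s,\kappa,\ell)=t(s)$. A labeled substructure is *heavy* if its refined heaviness exceeds $s_1\theta$ (wedge), $s_1^2\theta$ (opposite pair), $s_2\theta$ (edge), $s_3\theta$ (node), where $\theta=\theta_{(s,\kappa,\ell)}$. A configuration is heavy if it contains a heavy labeled substructure, and light otherwise. **LLM.** For $j<0$, $(A,2^{j}T^{1/4},x,y)$ denotes the configuration $(A,2^{-j}T^{1/4},x',y')$, where $x'<y'$ are the other two nodes of $A$. A light configuration $c=(A,\kappa,x,y)$ is *locally minimal* if, with $\kappa'$ ranging over the values $2^jT^{1/4}$ ($j\in\mathbb Z$): - in case $\kappa\ge T^{1/4}/\delta^2$: $(A,\kappa',x,y)$ is heavy for all $\delta^2\kappa\le\kappa'\le\kappa/2$; - in case $\kappa=T^{1/4}$: $(x,y)$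 is the lexicographically smallest pair of nodes of $A$; - in case $T^{1/4}<\kappa<T^{1/4}/\delta^2$: $(A,\kappa',x,y)$ is heavy for all $\max\{\delta^2\kappa,2\sqrt T/\kappa\}\le\kappa'\le\kappa/2$, and $(A,\sqrt T/\kappa,x,y)=(A,\kappa,x',y')$ is heavy or else $(x,y)$ is lexicographically smaller than $(x',y')$. A configuration is *LLM* if it is light, locally minimal and valid. **The counting algorithm and its queries.** For every $\kappa\in\mathcal I$ it samples vertex sets $S_{1,\kappa},R_{1a,\kappa},R_{1b,\kappa}$ with probability $p_{1,\kappa}$ per vertex and $S_{2,\kappa},R_{2a,\kappa},R_{2b,\kappa}$ with probability $p_{2,\kappa}$ per vertex, all independently, and independently picks $s_i$ uniformly from $\{(1+\frac1{200L_i})^e: e\in\mathbb Z_{\ge0}\}\cap[1,2)$ for $i=1,2,3$, with parameters $L_i=L_i(n,T,\varepsilon)$. A configuration $c=(A,\kappa,x,y)$ is *realized* if every $v\in V(A)$ lies in the sampled set with index $\kappa$ and name $\ell_c(v)$. The algorithm queries the oracle IsLLM on exactly the realized configurations. **Oracles.** A three-pass oracle is a randomized streaming algorithm whose memory is a bit string,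 updated at each edge of each of three passes over the edge stream, and which after the third pass answers queries about configurations from its memory. It knows $n,T,\varepsilon$, and has free access to the counting algorithm's sampled sets and shifts and to its own independent coins. Its space is the maximum number of bits in memory at any time during the three passes. **Proposition.** For all constants $\alpha,c\ge1$ there is a constant $K$ such that, for all $n\ge 2$, $T\ge2$ and $\varepsilon\in(0,1]$, with $\Lambda=K(\log(n)/\varepsilon)^K$, there are parameters $1\le L_1,L_2,L_3\le\Lambda$ and a three-pass oracle IsLLM with the following property. For every graph $G$ on $\{1,\dots,n\}$ with $m$ edges and $T\le|\mathcal T|\le\alpha T$, and for every ordering of its edges in each of the three passes, with probability at least $2/3$ over the sampled sets, the shifts and the coins, all of the following hold: the counting algorithm makes at most $\Lambda=\widetilde O(1)$ queries; the oracle answers each of them correctly, i.e. it says "yes" on a realized configuration if and only if that configuration is LLM; and the oracle uses at most $\Lambda\, m/\sqrt T=\widetilde O(m/\sqrt T)$ space. -/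

import Mathlib

open Real MeasureTheory ProbabilityTheory
open scoped ENNReal

noncomputable section

namespace FourCycleStream

/-! ### Four-cycles and their substructures

The vertex set is `Fin n` with its natural order.  A four-cycle is identified with its set of
four edges. -/

/-- The set of all (not necessarily induced) four-cycles of `G`. -/
def fourCycles {n : ℕ} (G : SimpleGraph (Fin n)) : Set (Finset (Sym2 (Fin n))) :=
  {A | ∃ a b c d : Fin n, [a, b, c, d].Nodup ∧
    G.Adj a b ∧ G.Adj b c ∧ G.Adj c d ∧ G.Adj d a ∧
    A = {s(a, b), s(b, c), s(c, d), s(d, a)}}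

/-- `v` is a node of the four-cycle with edge set `A`. -/
def IsNodeOf {n : ℕ} (A : Finset (Sym2 (Fin n))) (v : Fin n) : Prop := ∃ e ∈ A, v ∈ e

/-- Substructures: nodes, edges `u - v`, wedges `a - w - b` with centre `w`, and pairs of opposite
nodes.  Edges, wedges and pairs may be listed in either direction. -/
inductive Substructure (n : ℕ) where
  | node (v : Fin n)
  | edge (u v : Fin n)
  | wedge (a w b : Fin n)
  | oppositePair (u v : Fin n)

/-- The list of nodes of a substructure. -/
def Substructure.nodes {n : ℕ} : Substructure n → List (Fin n)
  | .node v => [v]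
  | .edge u v => [u, v]
  | .wedge a w b => [a, w, b]
  | .oppositePair u v => [u, v]

/-- The four-cycle with edge set `A` contains the given substructure. -/
def Substructure.In {n : ℕ} (A : Finset (Sym2 (Fin n))) : Substructure n → Prop
  | .node v => IsNodeOf A v
  | .edge u v => s(u, v) ∈ A
  | .wedge a w b => a ≠ b ∧ s(a, w) ∈ A ∧ s(w, b) ∈ A
  | .oppositePair u v => u ≠ v ∧ IsNodeOf A u ∧ IsNodeOf A v ∧ s(u, v) ∉ A

/-- True heaviness `t(s)`: the number of four-cycles of `G` containing `s`. -/
def heaviness {n : ℕ} (G : SimpleGraph (Fin n)) (s : Substructure n) : ℝ :=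
  ({A ∈ fourCycles G | s.In A}.ncard : ℝ)

/-! ### Parameters of the counting algorithm -/

/-- `T` is the lower bound on the number of four-cycles that the algorithm is given, `ε` the
desired accuracy, `c` the constant in the sampling probabilities. -/
structure Params where
  T : ℝ
  ε : ℝ
  c : ℝ

/-- `δ = ε / (2098 log³ T)`. -/
def Params.δ (P : Params) : ℝ := P.ε / (2098 * logb 2 P.T ^ 3)

/-- The number of values of `κ`, i.e. the cardinality of
`I = {2 ^ k T ^ (1/4) | k = 0, …, ⌈log (T ^ (1/4))⌉}`. -/
def Params.numScales (P : Params) : ℕ := ⌈logb 2 (P.T ^ (1 / 4 : ℝ))⌉₊ + 1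

/-- `κ = 2 ^ j T ^ (1/4)`.  The values of `I` are those with `0 ≤ j < numScales`; negative `j` occur
only in the extended configurations below. -/
def Params.κ (P : Params) (j : ℤ) : ℝ := (2 : ℝ) ^ j * P.T ^ (1 / 4 : ℝ)

/-- Labels: the names of the vertex sets sampled by the algorithm for each `κ`. -/
inductive Label where
  | S1 | S2 | R1a | R1b | R2a | R2b
  deriving DecidableEq

instance : Fintype Label where
  elems := {.S1, .S2, .R1a, .R1b, .R2a, .R2b}
  complete l := by cases l <;> simp

/-- The sets that are sampled with probability `p_{1,κ}`; the others are sampled with `p_{2,κ}`. -/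
def Label.isOne : Label → Bool
  | .S1 | .R1a | .R1b => true
  | .S2 | .R2a | .R2b => false

/-- The sampling probabilities `p_{1,κ} = c κ / (δ^{3.5} √T)` and `p_{2,κ} = c / (δ^{3.5} κ)`, where
a value above `1` means sampling with probability `1`. -/
def Params.prob (P : Params) (j : ℤ) (l : Label) : unitInterval :=
  Set.projIcc (0 : ℝ) 1 zero_le_one
    (if l.isOne then P.c * P.κ j / (P.δ ^ (3.5 : ℝ) * √P.T) else P.c / (P.δ ^ (3.5 : ℝ) * P.κ j))

/-! ### Configurations -/

/-- A tuple `(A, κ, x, y)`, where `κ` is given by its index in `I` (which has `N` elements). -/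
structure Config (n N : ℕ) where
  cycle : Finset (Sym2 (Fin n))
  scale : Fin N
  x : Fin n
  y : Fin n

/-- There are finitely many tuples, so the cardinalities below are honest. -/
instance {n N : ℕ} : Finite (Config n N) :=
  Finite.of_injective (fun c => (c.cycle, c.scale, c.x, c.y)) (by
    rintro ⟨A, k, x, y⟩ ⟨A', k', x', y'⟩ h
    simpa using h)

/-- `(A, κ, x, y)` is a configuration of `G`. -/
def Config.IsConfig {n N : ℕ} (G : SimpleGraph (Fin n)) (c : Config n N) : Prop :=
  c.cycle ∈ fourCycles G ∧ IsNodeOf c.cycle c.x ∧ IsNodeOf c.cycle c.y ∧ c.x < c.y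

/-- The labeling of a configuration (only its values on the nodes of the cycle matter).  If `x`, `y`
are adjacent in `A` then `x ↦ R1a`, `y ↦ R1b`, the other neighbour of `x` gets `R2b`, the other
neighbour of `y` gets `R2a`.  If they are opposite then `x, y ↦ S1` and the other two get `S2`. -/
def Config.label {n N : ℕ} (c : Config n N) (v : Fin n) : Label :=
  if s(c.x, c.y) ∈ c.cycle then
    if v = c.x then .R1a
    else if v = c.y then .R1b
    else if s(c.x, v) ∈ c.cycle then .R2b
    else .R2a
  else if v = c.x ∨ v = c.y then .S1 else .S2

/-- The labeled substructure `(s, κ, ℓ)` belongs to the configuration `c`.  Here and below a labeling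
`ℓ` is a function on all vertices of which only the values on the nodes of `s` are used. -/
def Config.Has {n N : ℕ} (c : Config n N) (s : Substructure n) (k : Fin N) (ℓ : Fin n → Label) :
    Prop :=
  c.scale = k ∧ s.In c.cycle ∧ ∀ v ∈ s.nodes, ℓ v = c.label v

/-! ### Thresholds and refined heaviness -/

/-- The number of nodes of `s` whose label is a set sampled with probability `p_{1,κ}`. -/
def numOnes {n : ℕ} (s : Substructure n) (ℓ : Fin n → Label) : ℕ :=
  s.nodes.countP fun v => (ℓ v).isOne

/-- The heaviness threshold `θ_{(s,κ,ℓ)}`. -/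
def threshold (P : Params) {n N : ℕ} (s : Substructure n) (k : Fin N) (ℓ : Fin n → Label) : ℝ :=
  let κ := P.κ (k : ℕ)
  match s with
  | .node _ =>
      if numOnes s ℓ = 1 then κ * √P.T / P.δ ^ (1.5 : ℝ) else P.T / (κ * P.δ ^ (1.5 : ℝ))
  | .edge _ _ | .oppositePair _ _ =>
      if numOnes s ℓ = 2 then κ ^ 2 / P.δ ^ 2
      else if numOnes s ℓ = 1 then √P.T / P.δ ^ 2
      else P.T / (κ ^ 2 * P.δ ^ 2)
  | .wedge _ _ _ =>
      if numOnes s ℓ = 2 then κ / P.δ else √P.T / (κ * P.δ)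

/-- All labeled wedges of the configuration are at most their threshold shifted by `s₁`. -/
def WedgesLight (P : Params) (s₁ : ℝ) {n N : ℕ} (G : SimpleGraph (Fin n)) (c : Config n N) : Prop :=
  ∀ a w b, (Substructure.wedge a w b).In c.cycle →
    heaviness G (.wedge a w b) ≤ s₁ * threshold P (.wedge a w b) c.scale c.label

/-- Refined heaviness of a labeled edge: for an edge both of whose labels belong to sets sampled with
probability `p_{2,κ}` it is the number of configurations containing the labeled edge all of whose
wedges are light, and for the other edges it is the true heaviness. -/
def refinedEdge (P : Params) (s₁ : ℝ) {n N : ℕ} (G : SimpleGraph (Fin n))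
    (u v : Fin n) (k : Fin N) (ℓ : Fin n → Label) : ℝ :=
  if numOnes (.edge u v) ℓ = 0 then
    ({c : Config n N | c.IsConfig G ∧ c.Has (.edge u v) k ℓ ∧ WedgesLight P s₁ G c}.ncard : ℝ)
  else heaviness G (.edge u v)

/-- All labeled edges of the configuration are at most their threshold shifted by `s₂`. -/
def EdgesLight (P : Params) (s₁ s₂ : ℝ) {n N : ℕ} (G : SimpleGraph (Fin n)) (c : Config n N) :
    Prop :=
  ∀ u v, (Substructure.edge u v).In c.cycle →
    refinedEdge P s₁ G u v c.scale c.label ≤ s₂ * threshold P (.edge u v) c.scale c.label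

/-- A configuration is invalid if `x`, `y` are adjacent in `A` and the edge between them has
heaviness at most the shifted threshold `s₂ √T / δ²`; otherwise it is valid. -/
def IsValid (P : Params) (s₂ : ℝ) {n N : ℕ} (G : SimpleGraph (Fin n)) (c : Config n N) : Prop :=
  ¬ (s(c.x, c.y) ∈ c.cycle ∧ heaviness G (.edge c.x c.y) ≤ s₂ * (√P.T / P.δ ^ 2))

/-- Refined heaviness of a labeled node: the number of valid configurations containing it all of
whose wedges and edges are light. -/
def refinedNode (P : Params) (s₁ s₂ : ℝ) {n N : ℕ} (G : SimpleGraph (Fin n))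
    (v : Fin n) (k : Fin N) (ℓ : Fin n → Label) : ℝ :=
  ({c : Config n N | c.IsConfig G ∧ IsValid P s₂ G c ∧ c.Has (.node v) k ℓ ∧
    WedgesLight P s₁ G c ∧ EdgesLight P s₁ s₂ G c}.ncard : ℝ)

/-- Refined heaviness `t(s,κ,ℓ)`. -/
def refinedHeaviness (P : Params) (s₁ s₂ : ℝ) {n N : ℕ} (G : SimpleGraph (Fin n))
    (s : Substructure n) (k : Fin N) (ℓ : Fin n → Label) : ℝ :=
  match s with
  | .node v => refinedNode P s₁ s₂ G v k ℓ
  | .edge u v => refinedEdge P s₁ G u v k ℓ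
  | .wedge _ _ _ | .oppositePair _ _ => heaviness G s

/-- The shift used for the given kind of substructure; `sh 0`, `sh 1`, `sh 2` are `s₁`, `s₂`, `s₃`. -/
def shiftOf (sh : Fin 3 → ℝ) {n : ℕ} : Substructure n → ℝ
  | .node _ => sh 2
  | .edge _ _ => sh 1
  | .wedge _ _ _ => sh 0
  | .oppositePair _ _ => sh 0 ^ 2

/-- A configuration is heavy if one of its labeled substructures is heavy; otherwise it is light. -/
def IsHeavy (P : Params) (sh : Fin 3 → ℝ) {n N : ℕ} (G : SimpleGraph (Fin n)) (c : Config n N) :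
    Prop :=
  ∃ s : Substructure n, s.In c.cycle ∧
    shiftOf sh s * threshold P s c.scale c.label <
      refinedHeaviness P (sh 0) (sh 1) G s c.scale c.label

/-! ### LLM configurations -/

/-- `c'` is the (extended) configuration `(A, 2 ^ j T ^ (1/4), x, y)`, where `c = (A, κ, x, y)`.  For
`j < 0` this is by convention `(A, 2 ^ (-j) T ^ (1/4), x', y')`, where `x' < y'` are the other two
nodes of `A`. -/
def Config.Rescaled {n N : ℕ} (c : Config n N) (j : ℤ) (c' : Config n N) : Prop :=
  c'.cycle = c.cycle ∧
    ((0 ≤ j ∧ ((c'.scale : ℕ) : ℤ) = j ∧ c'.x = c.x ∧ c'.y = c.y) ∨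
     (j < 0 ∧ ((c'.scale : ℕ) : ℤ) = -j ∧ c'.x < c'.y ∧
        ∀ v, v = c'.x ∨ v = c'.y ↔ IsNodeOf c.cycle v ∧ v ≠ c.x ∧ v ≠ c.y))

/-- Local minimality (used for light configurations).  The three clauses are the cases
`κ ≥ T^{1/4}/δ²`, `κ = T^{1/4}` and `T^{1/4} < κ < T^{1/4}/δ²`. -/
def IsLocallyMinimal (P : Params) (sh : Fin 3 → ℝ) {n N : ℕ} (G : SimpleGraph (Fin n))
    (c : Config n N) : Prop :=
  let κ := P.κ (c.scale : ℕ)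
  (P.κ 0 / P.δ ^ 2 ≤ κ →
    ∀ j c', c.Rescaled j c' → P.δ ^ 2 * κ ≤ P.κ j → P.κ j ≤ κ / 2 → IsHeavy P sh G c') ∧
  (κ = P.κ 0 →
    ∀ u w, IsNodeOf c.cycle u → IsNodeOf c.cycle w → u < w →
      toLex (c.x, c.y) ≤ toLex (u, w)) ∧
  (P.κ 0 < κ → κ < P.κ 0 / P.δ ^ 2 →
    (∀ j c', c.Rescaled j c' → max (P.δ ^ 2 * κ) (2 * √P.T / κ) ≤ P.κ j → P.κ j ≤ κ / 2 →
      IsHeavy P sh G c') ∧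
    ∀ c', c.Rescaled (-((c.scale : ℕ) : ℤ)) c' →
      IsHeavy P sh G c' ∨ (¬ IsHeavy P sh G c' ∧ toLex (c.x, c.y) < toLex (c'.x, c'.y)))

/-- A configuration is LLM if it is light, locally minimal and valid. -/
def IsLLM (P : Params) (sh : Fin 3 → ℝ) {n N : ℕ} (G : SimpleGraph (Fin n)) (c : Config n N) :
    Prop :=
  c.IsConfig G ∧ ¬ IsHeavy P sh G c ∧ IsLocallyMinimal P sh G c ∧ IsValid P (sh 1) G c

/-! ### The random choices of the counting algorithm -/

/-- Outcomes: which vertices are in which sampled set (for every `κ` and label), and the exponents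
of the three random shifts. -/
abbrev Sample (n N : ℕ) : Type := (Fin N × Label × Fin n → Bool) × (Fin 3 → ℕ)

/-- The shifts `s₁, s₂, s₃`, where `sᵢ = (1 + 1/(200 Lᵢ)) ^ (exponent)`. -/
def shifts (L : Fin 3 → ℝ) {n N : ℕ} (r : Sample n N) (i : Fin 3) : ℝ :=
  (1 + 1 / (200 * L i)) ^ r.2 i

/-- All vertices are sampled independently into each of the sets, and independently of this and of
each other the shifts are uniform among the powers of `1 + 1/(200 Lᵢ)` in `[1,2)`. -/
def sampleLaw (P : Params) (L : Fin 3 → ℝ) (n : ℕ) : Measure (Sample n P.numScales) :=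
  (Measure.pi fun i : Fin P.numScales × Label × Fin n =>
      bernoulliMeasure true false (P.prob (i.1 : ℕ) i.2.1)).prod
    (Measure.pi fun i : Fin 3 => uniformOn {e : ℕ | (1 + 1 / (200 * L i)) ^ e < (2 : ℝ)})

/-- A configuration of `G` is realized if each of its nodes was sampled into the set prescribed by
`κ` and its label.  These are exactly the queries of the counting algorithm. -/
def IsRealized {n N : ℕ} (G : SimpleGraph (Fin n)) (r : Sample n N) (c : Config n N) : Prop :=
  c.IsConfig G ∧ ∀ v, IsNodeOf c.cycle v → r.1 (c.scale, c.label v, v) = true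

/-! ### Three-pass streaming oracles -/

/-- `l` lists every edge of `G` exactly once. -/
def IsEdgeStream {n : ℕ} (G : SimpleGraph (Fin n)) (l : List (Sym2 (Fin n))) : Prop :=
  l.Nodup ∧ ∀ e, e ∈ l ↔ e ∈ G.edgeSet

/-- A randomized three-pass streaming oracle that runs alongside the counting algorithm.  Its memory
is a bit string.  It has free access to the random choices of the counting algorithm and to its own
coins, which are independent of those.  After the third pass it answers each query about a
configuration from its final memory. -/
structure Oracle (n N : ℕ) where
  Coins : Type
  coinLaw : PMF Coins
  init : Sample n N → Coins → List Bool
  step : Fin 3 → Sample n N → Coins → List Bool → Sym2 (Fin n) → List Bool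
  answer : Sample n N → Coins → List Bool → Config n N → Bool

namespace Oracle

variable {n N : ℕ}

/-- The memory at the start of pass `i` (for `i = 3`: after the last pass). -/
def memoryAt (O : Oracle n N) (r : Sample n N) (w : O.Coins)
    (stream : Fin 3 → List (Sym2 (Fin n))) : ℕ → List Bool
  | 0 => O.init r w
  | i + 1 => if h : i < 3 then
      (stream ⟨i, h⟩).foldl (O.step ⟨i, h⟩ r w) (O.memoryAt r w stream i)
    else O.memoryAt r w stream i

/-- At every moment of the three passes the memory has at most `b` bits. -/
def SpaceAtMost (O : Oracle n N) (r : Sample n N) (w : O.Coins)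
    (stream : Fin 3 → List (Sym2 (Fin n))) (b : ℝ) : Prop :=
  ∀ i : Fin 3, ∀ l, l <+: stream i →
    ((l.foldl (O.step i r w) (O.memoryAt r w stream i)).length : ℝ) ≤ b

/-- The answer of the oracle to a query after the three passes. -/
def output (O : Oracle n N) (r : Sample n N) (w : O.Coins)
    (stream : Fin 3 → List (Sym2 (Fin n))) (c : Config n N) : Bool :=
  O.answer r w (O.memoryAt r w stream 3) c

/-- The probability of an event over the choices of the counting algorithm (with law `μ`) and the
independent coins of the oracle. -/
def probability (O : Oracle n N) (μ : Measure (Sample n N)) (E : Sample n N → O.Coins → Prop) :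
    ℝ≥0∞ :=
  ∑' w : O.Coins, O.coinLaw w * μ {r | E r w}

end Oracle

/-- The factor `K (log n / ε) ^ K`, which is what `Õ` hides. -/
def polylog (K n : ℕ) (ε : ℝ) : ℝ := K * (logb 2 n / ε) ^ K

end FourCycleStream

end

/-! Give a node of type 1 the rate κ/√T and a node of type 2 the rate 1/κ (`Params.base`). The rates
of the four nodes of a configuration multiply to 1/T, and every threshold is T times the product of
the rates of the nodes of the substructure, divided by a power of δ. So if vertices are sampled at
these rates times polylogarithmic factors, only polylogarithmically many configurations are sampled
in expectation, and an edge whose ends have rates of product about 1/√T is caught with probability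
polylog/√T, which costs polylog·m/√T edges in all.

The memory is a set of edges. Besides the sets r of the counting algorithm the oracle samples vertex
sets Z (for nodes) and Y (for wedges and for edges with two labels of type 2) and vertex pairs F
(for true edge heaviness). The first pass keeps edges between sampled vertices whose rates have a
small product, and the edges in F. Only the edge between the two type 1 nodes of a configuration can
escape this; the second pass finds it, because it closes three known edges. The third pass keeps the
edges from nodes of tracked configurations to ends of first-pass edges, and a capped number of edges
in each of certain groups that serve to count common neighbours; a full group certifies a heavy
wedge. `Env.memSpec` describes the memory, and `Env.estLLM_recon` shows that the answer computed
from it equals the answer the estimators would give on all of G.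

Numbers of common neighbours and true edge heaviness are estimated by Chernoff bounds. Refined
heaviness is estimated by second moments (`chebyshev_config`): lightness bounds the number of
configurations through two or more common nodes, hence the variance (`card_sharing_le`,
`card_sharing_inter_le`). A decision is correct unless the true value lies in a narrow window around
the shifted threshold, which is unlikely for a random shift (`Pr_close_le`). The refined heaviness
of an edge is harder, since the wedge decisions inside the sample use the same set Y. The sample is
sandwiched between those at two fixed levels s₁/b and s₁b, and the size can jump between these
levels only for few shifts (`card_jumps_le`).

Each configuration fails with probability 1/polylog only, which forbids a union bound over all of
them. But which configurations are tracked depends on r and Z, and their bad events depend on Y and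
the shifts, so the probabilities multiply (`Pr_exists_badConfig_le`). For nodes, r is played against
Z and the shifts in the same way (`Pr_exists_badNode_le`). The parameters can then be fixed without
circularity (`Pr_not_success_le_third`). -/

noncomputable section

namespace FourCycleStream

open scoped Classical

section

/-! ### Finite probability spaces -/

/-- A probability distribution on a finite type, given by its real weights. -/
structure FinProb (Ω : Type*) [Fintype Ω] where
  w : Ω → ℝ
  nonneg : ∀ x, 0 ≤ w x
  sum_one : ∑ x, w x = 1

namespace FinProb

variable {Ω Ω' : Type*} [Fintype Ω] [Fintype Ω']

/-- Expectation. -/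
def E (D : FinProb Ω) (f : Ω → ℝ) : ℝ := ∑ x, D.w x * f x

/-- Probability of an event. -/
def Pr (D : FinProb Ω) (A : Ω → Prop) : ℝ := D.E fun x => if A x then 1 else 0

variable (D : FinProb Ω) (D' : FinProb Ω')

@[simp] lemma E_const (a : ℝ) : D.E (fun _ => a) = a := by
  simp [E, ← Finset.sum_mul, D.sum_one]

lemma E_add (f g : Ω → ℝ) : D.E (fun x => f x + g x) = D.E f + D.E g := by
  simp [E, mul_add, Finset.sum_add_distrib]

lemma E_sub (f g : Ω → ℝ) : D.E (fun x => f x - g x) = D.E f - D.E g := by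
  simp [E, mul_sub, Finset.sum_sub_distrib]

lemma E_mul_left (a : ℝ) (f : Ω → ℝ) : D.E (fun x => a * f x) = a * D.E f := by
  simp only [E, Finset.mul_sum]; exact Finset.sum_congr rfl fun _ _ => by ring

lemma E_mul_right (a : ℝ) (f : Ω → ℝ) : D.E (fun x => f x * a) = D.E f * a := by
  simp only [E, Finset.sum_mul]; exact Finset.sum_congr rfl fun _ _ => by ring

lemma E_sum {κ : Type*} (s : Finset κ) (f : κ → Ω → ℝ) :
    D.E (fun x => ∑ i ∈ s, f i x) = ∑ i ∈ s, D.E (f i) := by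
  simp only [E, Finset.mul_sum]; exact Finset.sum_comm

lemma E_mono {f g : Ω → ℝ} (h : ∀ x, f x ≤ g x) : D.E f ≤ D.E g :=
  Finset.sum_le_sum fun x _ => mul_le_mul_of_nonneg_left (h x) (D.nonneg x)

lemma E_nonneg {f : Ω → ℝ} (h : ∀ x, 0 ≤ f x) : 0 ≤ D.E f :=
  Finset.sum_nonneg fun x _ => mul_nonneg (D.nonneg x) (h x)

lemma Pr_nonneg (A : Ω → Prop) : 0 ≤ D.Pr A := D.E_nonneg fun x => by split_ifs <;> simp

lemma Pr_mono {A B : Ω → Prop} (h : ∀ x, A x → B x) : D.Pr A ≤ D.Pr B :=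
  D.E_mono fun x => by
    by_cases hA : A x
    · simp [hA, h x hA]
    · simp only [hA, if_false]; split_ifs <;> simp

lemma Pr_le_E {A : Ω → Prop} {f : Ω → ℝ} (hf : ∀ x, 0 ≤ f x) (h : ∀ x, A x → 1 ≤ f x) :
    D.Pr A ≤ D.E f :=
  D.E_mono fun x => by
    by_cases hA : A x
    · simp [hA, h x hA]
    · simp [hA, hf x]

lemma Pr_or (A B : Ω → Prop) : D.Pr (fun x => A x ∨ B x) ≤ D.Pr A + D.Pr B := by
  rw [Pr, Pr, Pr, ← E_add]
  refine D.E_mono fun x => ?_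
  by_cases hA : A x <;> by_cases hB : B x <;> simp [hA, hB]

lemma Pr_exists_le {κ : Type*} (s : Finset κ) (A : κ → Ω → Prop) :
    D.Pr (fun x => ∃ i ∈ s, A i x) ≤ ∑ i ∈ s, D.Pr (A i) := by
  unfold Pr
  rw [← E_sum]
  refine D.E_mono fun x => ?_
  split_ifs with h
  · obtain ⟨i, hi, hA⟩ := h
    refine le_trans ?_ (Finset.single_le_sum (f := fun i => if A i x then (1 : ℝ) else 0)
      (fun i _ => by positivity) hi)
    simp [hA]
  · exact Finset.sum_nonneg fun i _ => by positivity

lemma Pr_not (A : Ω → Prop) : D.Pr (fun x => ¬ A x) = 1 - D.Pr A := by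
  have : D.Pr (fun x => ¬ A x) + D.Pr A = 1 := by
    rw [Pr, Pr, ← E_add]
    refine Eq.trans ?_ (D.E_const 1)
    congr 1
    ext x; by_cases hA : A x <;> simp [hA]
  linarith

lemma markov {f : Ω → ℝ} (hf : ∀ x, 0 ≤ f x) {a : ℝ} (ha : 0 < a) :
    D.Pr (fun x => a < f x) ≤ D.E f / a := by
  rw [div_eq_mul_inv, ← E_mul_right]
  refine D.Pr_le_E (fun x => mul_nonneg (hf x) (by positivity)) fun x hx => ?_
  rw [← div_eq_mul_inv, le_div_iff₀ ha]; linarith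

lemma chebyshev (f : Ω → ℝ) (μ : ℝ) {a : ℝ} (ha : 0 < a) :
    D.Pr (fun x => a < |f x - μ|) ≤ D.E (fun x => (f x - μ) ^ 2) / a ^ 2 := by
  refine le_trans (D.Pr_mono (B := fun x => a ^ 2 < (f x - μ) ^ 2) fun x hx => ?_)
    (D.markov (fun x => sq_nonneg _) (by positivity))
  rw [← sq_abs (f x - μ)]
  exact pow_lt_pow_left₀ hx ha.le (by norm_num)

/-- The product distribution. -/
def prod : FinProb (Ω × Ω') where
  w x := D.w x.1 * D'.w x.2
  nonneg x := mul_nonneg (D.nonneg _) (D'.nonneg _)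
  sum_one := by
    rw [Fintype.sum_prod_type]
    simp [← Finset.mul_sum, D'.sum_one, D.sum_one]

lemma E_prod (f : Ω × Ω' → ℝ) : (D.prod D').E f = D.E fun x => D'.E fun y => f (x, y) := by
  simp only [E, prod, Fintype.sum_prod_type, Finset.mul_sum]
  exact Finset.sum_congr rfl fun _ _ => Finset.sum_congr rfl fun _ _ => by ring

lemma E_comm (f : Ω → Ω' → ℝ) :
    (D.E fun x => D'.E fun y => f x y) = D'.E fun y => D.E fun x => f x y := by
  simp only [E, Finset.mul_sum]
  rw [Finset.sum_comm]
  exact Finset.sum_congr rfl fun _ _ => Finset.sum_congr rfl fun _ _ => by ring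

lemma E_E_mul (f : Ω → ℝ) (g : Ω' → ℝ) :
    (D.E fun x => D'.E fun y => f x * g y) = D.E f * D'.E g := by
  simp only [E_mul_left, E_mul_right]

/-- The uniform distribution on `Fin m`. -/
def unif (m : ℕ) (hm : 0 < m) : FinProb (Fin m) where
  w _ := 1 / m
  nonneg _ := by positivity
  sum_one := by
    have : (m : ℝ) ≠ 0 := by positivity
    simp [this]

lemma Pr_unif (m : ℕ) (hm : 0 < m) (A : Fin m → Prop) :
    (unif m hm).Pr A = (Finset.univ.filter A).card / m := by
  simp only [Pr, E, unif, ← Finset.mul_sum]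
  rw [Finset.sum_boole]
  ring

/-- Independent Bernoulli variables. -/
def bern {ι : Type*} [Fintype ι] [DecidableEq ι] (p : ι → unitInterval) : FinProb (ι → Bool) where
  w ω := ∏ i, if ω i then (p i : ℝ) else 1 - p i
  nonneg ω := Finset.prod_nonneg fun i _ => by
    have h0 := (p i).2.1
    have h1 := (p i).2.2
    split_ifs
    · exact h0
    · linarith
  sum_one := by
    have := Finset.prod_univ_sum (fun _ : ι => (Finset.univ : Finset Bool))
      (fun i b => if b then (p i : ℝ) else 1 - p i)
    rw [Fintype.piFinset_univ] at this
    rw [← this]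
    simp

/-! ### Moments and tail bounds for independent Bernoulli variables. -/

section Bern

variable {ι : Type*} [Fintype ι] [DecidableEq ι] (p : ι → unitInterval)

lemma E_bern_prod (g : ι → Bool → ℝ) :
    (bern p).E (fun ω => ∏ i, g i (ω i)) = ∏ i, (p i * g i true + (1 - p i) * g i false) := by
  have := Finset.prod_univ_sum (fun _ : ι => (Finset.univ : Finset Bool))
    (fun i b => (if b then (p i : ℝ) else 1 - p i) * g i b)
  rw [Fintype.piFinset_univ] at this
  simp only [Fintype.sum_bool, if_true, Bool.false_eq_true, if_false] at this
  rw [this]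
  simp only [E, bern, ← Finset.prod_mul_distrib]

/-- The indicator that all coordinates in `J` are `true`. -/
def allOn (J : Finset ι) (ω : ι → Bool) : ℝ := if ∀ i ∈ J, ω i = true then 1 else 0

lemma allOn_eq_prod (J : Finset ι) (ω : ι → Bool) :
    allOn J ω = ∏ i, if i ∈ J then (if ω i then (1 : ℝ) else 0) else 1 := by
  rw [Finset.prod_ite_mem Finset.univ J, Finset.univ_inter, allOn, Finset.prod_boole]
  congr

lemma allOn_mul (J J' : Finset ι) (ω : ι → Bool) :
    allOn J ω * allOn J' ω = allOn (J ∪ J') ω := by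
  unfold allOn
  rw [ite_zero_mul_ite_zero, one_mul]
  congr 1
  simp only [Finset.mem_union, eq_iff_iff]
  constructor
  · rintro ⟨h, h'⟩ i (hi | hi)
    exacts [h i hi, h' i hi]
  · exact fun h => ⟨fun i hi => h i (Or.inl hi), fun i hi => h i (Or.inr hi)⟩

lemma E_allOn (J : Finset ι) : (bern p).E (allOn J) = ∏ i ∈ J, (p i : ℝ) := by
  rw [show allOn J = _ from funext (allOn_eq_prod J)]
  refine (E_bern_prod p fun i b => if i ∈ J then (if b then (1 : ℝ) else 0) else 1).trans ?_
  rw [← Finset.univ_inter J, ← Finset.prod_ite_mem Finset.univ J]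
  refine Finset.prod_congr rfl fun i _ => ?_
  by_cases hi : i ∈ J <;> simp [hi]

lemma Pr_allOn (J : Finset ι) :
    (bern p).Pr (fun ω => ∀ i ∈ J, ω i = true) = ∏ i ∈ J, (p i : ℝ) := by
  rw [← E_allOn p J]
  unfold Pr allOn
  congr! 3

/-- The number of `true` coordinates in `J`. -/
def countOn (J : Finset ι) (ω : ι → Bool) : ℝ := ((J.filter fun i => ω i = true).card : ℝ)

lemma E_exp_countOn (J : Finset ι) (lam : ℝ) :
    (bern p).E (fun ω => Real.exp (lam * countOn J ω)) =
      ∏ i ∈ J, (1 + p i * (Real.exp lam - 1)) := by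
  have h : (fun ω => Real.exp (lam * countOn J ω)) = fun ω => ∏ i,
      if i ∈ J then (if ω i then Real.exp lam else 1) else 1 := by
    ext ω
    rw [Finset.prod_ite_mem Finset.univ J, Finset.univ_inter, Finset.prod_ite,
      Finset.prod_const, Finset.prod_const_one, mul_one, countOn, mul_comm, Real.exp_nat_mul]
  rw [h]
  refine (E_bern_prod p fun i b => if i ∈ J then (if b then Real.exp lam else 1) else 1).trans ?_
  rw [← Finset.univ_inter J, ← Finset.prod_ite_mem Finset.univ J]
  refine Finset.prod_congr rfl fun i _ => ?_
  by_cases hi : i ∈ J <;> simp [hi]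
  ring

/-- From 1 + x ≤ eˣ in every factor and e^λ − 1 ≤ λ + λ² for |λ| ≤ 1. -/
lemma E_exp_countOn_le (J : Finset ι) (q : ℝ) (hq : ∀ i ∈ J, (p i : ℝ) = q) {lam : ℝ}
    (hlam : |lam| ≤ 1) :
    (bern p).E (fun ω => Real.exp (lam * countOn J ω)) ≤
      Real.exp (q * J.card * (lam + lam ^ 2)) := by
  rw [E_exp_countOn]
  calc ∏ i ∈ J, (1 + p i * (Real.exp lam - 1))
      ≤ ∏ i ∈ J, Real.exp (q * (lam + lam ^ 2)) := by
        refine Finset.prod_le_prod (fun i hi => ?_) fun i hi => ?_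
        · have h0 := (p i).2.1
          have h1 := (p i).2.2
          nlinarith [Real.exp_pos lam]
        · rw [hq i hi]
          have h0 : 0 ≤ q := hq i hi ▸ (p i).2.1
          have h2 := (abs_le.1 (Real.abs_exp_sub_one_sub_id_le hlam)).2
          refine le_trans ?_ (Real.add_one_le_exp _)
          nlinarith
    _ = _ := by
        rw [Finset.prod_const, ← Real.exp_nat_mul]; congr 1; ring

/-- Multiplicative Chernoff bound, with the failure probability controlled by a floor `m`. -/
lemma chernoff (J : Finset ι) (q : ℝ) (hq : ∀ i ∈ J, (p i : ℝ) = q) {γ m : ℝ}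
    (hγ : 0 < γ) (hγ1 : γ ≤ 1) (hqJ : 0 ≤ q * J.card) :
    (bern p).Pr (fun ω => γ * (q * J.card + m) < |countOn J ω - q * J.card|) ≤
      2 * Real.exp (-(γ ^ 2 * m / 2)) := by
  set μ := q * (J.card : ℝ) with hμ
  -- Exponential Markov inequality for both tails, with λ = ±γ/2. The exponent μλ² − |λ|γ(μ + m)
  -- equals −γ²μ/4 − γ²m/2, so the floor m alone gives a bound that is uniform in μ.
  have key : ∀ lam : ℝ, |lam| = γ / 2 →
      (bern p).Pr (fun ω => |lam| * γ * (μ + m) < lam * (countOn J ω - μ)) ≤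
        Real.exp (-(γ ^ 2 * m / 2)) := by
    intro lam hl
    have hl1 : |lam| ≤ 1 := by rw [hl]; linarith
    have hE := E_exp_countOn_le p J q hq hl1
    have h1 : (bern p).Pr (fun ω => |lam| * γ * (μ + m) < lam * (countOn J ω - μ)) ≤
        (bern p).E (fun ω => Real.exp (lam * countOn J ω) *
          Real.exp (-(lam * μ) - |lam| * γ * (μ + m))) := by
      refine Pr_le_E _ (fun ω => by positivity) fun ω h => ?_
      rw [← Real.exp_add]
      exact Real.one_le_exp (by nlinarith)
    refine h1.trans ?_
    rw [E_mul_right]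
    refine (mul_le_mul_of_nonneg_right hE (Real.exp_pos _).le).trans ?_
    rw [← Real.exp_add]
    refine Real.exp_le_exp.2 ?_
    have h2 : lam ^ 2 = (γ / 2) ^ 2 := by rw [← hl, sq_abs]
    rw [← hμ, hl, mul_add, h2]
    nlinarith [mul_nonneg hqJ (sq_nonneg γ)]
  have hp := key (γ / 2) (abs_of_pos (by positivity))
  have hn := key (-(γ / 2)) (by rw [abs_neg, abs_of_pos (by positivity)])
  refine le_trans (Pr_mono _ fun ω h => ?_) ((Pr_or _ _ _).trans
    ((add_le_add hp hn).trans (by linarith)))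
  rcases lt_abs.1 h with h | h
  · left
    rw [abs_of_pos (half_pos hγ)]
    have := mul_lt_mul_of_pos_left h (half_pos hγ)
    linarith
  · right
    rw [abs_neg, abs_of_pos (half_pos hγ)]
    have := mul_lt_mul_of_pos_left h (half_pos hγ)
    linarith

/-- Chernoff bound for sampling at a rate `min 1 ρ`, as an estimate of the cardinality. -/
lemma chernoff_rate (J : Finset ι) (q ρ : ℝ) (hq : ∀ i ∈ J, (p i : ℝ) = q) (hρ : 0 < ρ)
    (hqρ : q = min 1 ρ) {γ m : ℝ} (hγ : 0 < γ) (hγ1 : γ ≤ 1) (hm : 0 ≤ m) :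
    (bern p).Pr (fun ω => γ * (J.card + m / ρ) < |countOn J ω / q - J.card|) ≤
      2 * Real.exp (-(γ ^ 2 * m / 2)) := by
  have hq0 : 0 < q := by rw [hqρ]; exact lt_min one_pos hρ
  -- At rate 1 everything is sampled and the estimate is exact; below that, `chernoff` is divided by
  -- q.
  rcases le_or_gt 1 ρ with h1 | h1
  · have hq1 : q = 1 := by rw [hqρ, min_eq_left h1]
    have h0 : (bern p).Pr (fun ω => γ * (J.card + m / ρ) < |countOn J ω / q - J.card|) ≤
        (bern p).Pr (fun ω => ¬ ∀ i ∈ J, ω i = true) := by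
      refine Pr_mono _ fun ω h hall => ?_
      have : countOn J ω = J.card := by
        unfold countOn
        rw [Finset.filter_true_of_mem hall]
      rw [this, hq1] at h
      simp only [div_one, sub_self, abs_zero] at h
      have : 0 ≤ γ * (J.card + m / ρ) := by positivity
      linarith
    rw [Pr_not, Pr_allOn, Finset.prod_eq_one fun i hi => (hq i hi).trans hq1, sub_self] at h0
    exact h0.trans (by positivity)
  · have hqr : q = ρ := by rw [hqρ, min_eq_right h1.le]
    refine le_trans (Pr_mono _ fun ω h => ?_)
      (chernoff p J q hq hγ hγ1 (by positivity))
    have e : countOn J ω - q * J.card = (countOn J ω / q - J.card) * q := by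
      field_simp
    rw [e, abs_mul, abs_of_pos hq0]
    have : γ * (q * J.card + m) = γ * (J.card + m / ρ) * q := by
      rw [hqr]; field_simp
    rw [this]
    exact mul_lt_mul_of_pos_right h hq0

/-- Second moment bound for the number of fully sampled sets of a family. -/
lemma chebyshev_family {κ : Type*} (C : Finset κ) (J : κ → Finset ι) (q B γ θ : ℝ) (d : ℕ)
    (hp : ∀ c ∈ C, ∀ i ∈ J c, 0 < (p i : ℝ)) (hJ : ∀ c ∈ C, ∏ i ∈ J c, (p i : ℝ) = q)
    (hd : ∀ c ∈ C, (J c).card ≤ d)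
    (hB : ∀ c ∈ C, ∀ W ⊆ J c, W.Nonempty →
      (∏ i ∈ W, (1 / (p i : ℝ) - 1)) * ((C.filter fun c' => W ⊆ J c').card : ℝ) ≤ B)
    (hB0 : 0 ≤ B) (hγ : 0 < γ) (hθ : 0 < θ) :
    (bern p).Pr (fun ω => γ * (C.card + θ) <
      |((C.filter fun c => ∀ i ∈ J c, ω i = true).card : ℝ) / q - C.card|) ≤
      2 ^ d * B / (γ ^ 2 * θ) := by
  rcases C.eq_empty_or_nonempty with rfl | ⟨c0, hc0⟩
  · have : (bern p).Pr (fun ω => γ * (((∅ : Finset κ).card : ℝ) + θ) <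
      |((((∅ : Finset κ).filter fun c => ∀ i ∈ J c, ω i = true).card : ℝ)) / q -
        ((∅ : Finset κ).card : ℝ)|) ≤ (bern p).Pr (fun _ => False) := by
      refine Pr_mono _ fun ω h => ?_
      simp at h
      nlinarith [mul_pos hγ hθ]
    refine this.trans ?_
    simp only [Pr, if_false, E_const]
    positivity
  have hq0 : 0 < q := by
    rw [← hJ c0 hc0]; exact Finset.prod_pos (hp c0 hc0)
  have hX : ∀ ω, ((C.filter fun c => ∀ i ∈ J c, ω i = true).card : ℝ) = ∑ c ∈ C, allOn (J c) ω := by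
    intro ω; simp [allOn]
  have hcard : (0 : ℝ) < C.card := by exact_mod_cast Finset.card_pos.2 ⟨c0, hc0⟩
  have hmean : (bern p).E (fun ω => ∑ c ∈ C, allOn (J c) ω) = q * C.card := by
    rw [E_sum, Finset.sum_congr rfl fun c hc => (E_allOn p (J c)).trans (hJ c hc)]
    simp [mul_comm]
  -- Common coordinates count once, so the mixed moment is q² times the product of 1/p over the
  -- intersection. Expanding 1/p = 1 + (1/p − 1) over subsets W turns the sum over c' into numbers
  -- of members that contain W. The term W = ∅ gives the squared mean, and coordinates with p = 1
  -- contribute nothing.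
  have hpair : ∀ c ∈ C, ∀ c' ∈ C, (bern p).E (fun ω => allOn (J c) ω * allOn (J c') ω) =
      q ^ 2 * ∑ W ∈ (J c).powerset, if W ⊆ J c' then ∏ i ∈ W, (1 / (p i : ℝ) - 1) else 0 := by
    intro c hc c' hc'
    simp only [allOn_mul]
    rw [show (bern p).E (fun ω => allOn (J c ∪ J c') ω) = _ from E_allOn p _]
    have h1 := Finset.prod_union_inter (s₁ := J c) (s₂ := J c') (f := fun i => (p i : ℝ))
    rw [hJ c hc, hJ c' hc'] at h1
    have hpos : 0 < ∏ i ∈ J c ∩ J c', (p i : ℝ) :=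
      Finset.prod_pos fun i hi => hp c hc i (Finset.mem_inter.1 hi).1
    have h2 : ∏ i ∈ J c ∩ J c', (1 / (p i : ℝ)) =
        ∑ W ∈ (J c ∩ J c').powerset, ∏ i ∈ W, (1 / (p i : ℝ) - 1) := by
      rw [← Finset.prod_one_add]; simp
    have h3 : (J c ∩ J c').powerset = (J c).powerset.filter fun W => W ⊆ J c' := by
      ext W; rw [Finset.mem_powerset, Finset.subset_inter_iff, Finset.mem_filter,
        Finset.mem_powerset]
    rw [← Finset.sum_filter, ← h3, ← h2, Finset.prod_div_distrib, Finset.prod_const_one]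
    field_simp
    linarith
  have hsecond : (bern p).E (fun ω => (∑ c ∈ C, allOn (J c) ω) ^ 2) ≤
      (q * C.card) ^ 2 + q ^ 2 * (C.card * (2 ^ d * B)) := by
    have e1 : (fun ω => (∑ c ∈ C, allOn (J c) ω) ^ 2) =
        fun ω => ∑ c ∈ C, ∑ c' ∈ C, allOn (J c) ω * allOn (J c') ω := by
      ext ω; rw [sq, Finset.sum_mul_sum]
    rw [e1, E_sum]
    have e2 : ∀ c ∈ C, (bern p).E (fun ω => ∑ c' ∈ C, allOn (J c) ω * allOn (J c') ω) ≤
        q ^ 2 * (C.card + 2 ^ d * B) := by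
      intro c hc
      rw [E_sum, Finset.sum_congr rfl fun c' hc' => hpair c hc c' hc', ← Finset.mul_sum,
        Finset.sum_comm]
      refine mul_le_mul_of_nonneg_left ?_ (by positivity)
      have e3 : ∀ W ∈ (J c).powerset, (∑ c' ∈ C, if W ⊆ J c' then
          ∏ i ∈ W, (1 / (p i : ℝ) - 1) else 0) ≤ (if W = ∅ then (C.card : ℝ) else 0) + B := by
        intro W hW
        rw [← Finset.sum_filter, Finset.sum_const, nsmul_eq_mul, mul_comm]
        split_ifs with h0
        · subst h0
          simp [hB0]
        · rw [zero_add]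
          exact hB c hc W (Finset.mem_powerset.1 hW) (Finset.nonempty_iff_ne_empty.2 h0)
      refine (Finset.sum_le_sum e3).trans ?_
      rw [Finset.sum_add_distrib, Finset.sum_ite_eq' , if_pos (Finset.empty_mem_powerset _),
        Finset.sum_const, Finset.card_powerset, nsmul_eq_mul]
      have : ((2 ^ (J c).card : ℕ) : ℝ) ≤ 2 ^ d := by
        push_cast
        exact pow_le_pow_right₀ (by norm_num) (hd c hc)
      nlinarith
    refine (Finset.sum_le_sum e2).trans ?_
    rw [Finset.sum_const, nsmul_eq_mul]
    apply le_of_eq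
    ring
  have hpos : 0 < γ * (C.card + θ) := by positivity
  have hvar : (bern p).E (fun ω => (((C.filter fun c => ∀ i ∈ J c, ω i = true).card : ℝ) / q
      - C.card) ^ 2) ≤ C.card * (2 ^ d * B) := by
    have e : (fun ω => (((C.filter fun c => ∀ i ∈ J c, ω i = true).card : ℝ) / q - C.card) ^ 2) =
        fun ω => (1 / q ^ 2) * (∑ c ∈ C, allOn (J c) ω) ^ 2 -
          (2 * C.card / q) * (∑ c ∈ C, allOn (J c) ω) + (C.card : ℝ) ^ 2 := by
      ext ω; rw [hX ω]; field_simp; ring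
    rw [e, E_add, E_sub, E_mul_left, E_mul_left, hmean, E_const]
    have h4 := mul_le_mul_of_nonneg_left hsecond (by positivity : 0 ≤ 1 / q ^ 2)
    have h5 : 1 / q ^ 2 * ((q * C.card) ^ 2 + q ^ 2 * (C.card * (2 ^ d * B))) =
        (C.card : ℝ) ^ 2 + C.card * (2 ^ d * B) := by field_simp
    have h6 : 2 * C.card / q * (q * C.card) = 2 * (C.card : ℝ) ^ 2 := by field_simp
    rw [h6]; linarith
  refine (chebyshev _ _ _ hpos).trans ((div_le_div_of_nonneg_right hvar (by positivity)).trans ?_)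
  rw [div_le_div_iff₀ (by positivity) (by positivity)]
  -- With an error proportional to |C| + θ the size of the family drops out of the Chebyshev bound.
  have h7 : (C.card : ℝ) * θ ≤ (C.card + θ) ^ 2 := by nlinarith
  have h8 : 0 ≤ 2 ^ d * B * γ ^ 2 := by positivity
  nlinarith [mul_le_mul_of_nonneg_left h7 h8]

end Bern

end FinProb

end

section

/-! ### Encoding finite sets as bit strings -/

lemma flatMap_injective_of_length {α β : Type*} (f : α → List β) (hf : Function.Injective f) (b : ℕ)
    (hb : 0 < b) (hlen : ∀ a, (f a).length = b) :
    Function.Injective fun l : List α => l.flatMap f := by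
  intro l
  induction l with
  | nil =>
    intro l' h
    cases l' with
    | nil => rfl
    | cons a t =>
      have := congrArg List.length h
      simp [hlen] at this
      omega
  | cons a t ih =>
    intro l' h
    cases l' with
    | nil =>
      have := congrArg List.length h
      simp [hlen] at this
      omega
    | cons a' t' =>
      simp only [List.flatMap_cons] at h
      obtain ⟨h1, h2⟩ := List.append_inj h (by rw [hlen, hlen])
      rw [hf h1, ih h2]

/-- Elements are written as blocks of equal positive length, so the concatenation can be cut up
again and the set recovered from its blocks. -/
lemma exists_bitCode (α : Type*) [Fintype α] (b : ℕ) (hb : 0 < b) (h : Fintype.card α ≤ 2 ^ b) :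
    ∃ enc : Finset α → List Bool, Function.Injective enc ∧ ∀ S, (enc S).length = b * S.card := by
  obtain ⟨g⟩ : Nonempty (α ↪ (Fin b → Bool)) := by
    rw [Function.Embedding.nonempty_iff_card_le]; simpa using h
  have hlen : ∀ a, (List.ofFn (g a)).length = b := fun a => by simp
  have hinj : Function.Injective fun a => List.ofFn (g a) :=
    fun a a' h => g.injective (List.ofFn_injective h)
  refine ⟨fun S => S.toList.flatMap fun a => List.ofFn (g a), fun S S' h => ?_, fun S => ?_⟩
  · have := flatMap_injective_of_length _ hinj b hb hlen h
    rw [← Finset.toList_toFinset S, this, Finset.toList_toFinset]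
  · simp [List.length_flatMap, mul_comm]

/-! ### Oracles that remember a set of edges -/

section EdgeOracle

variable {n N : ℕ}

/-- One step: the edge is remembered if the rule says so. -/
def keepStep {α : Type*} [DecidableEq α]
    (keep : Finset α → α → Prop) (S : Finset α) (e : α) : Finset α :=
  if keep S e then insert e S else S

lemma subset_keepStep {α : Type*} [DecidableEq α]
    (keep : Finset α → α → Prop) (S : Finset α) (e : α) :
    S ⊆ keepStep keep S e := by
  unfold keepStep; split_ifs
  exacts [Finset.subset_insert _ _, Finset.Subset.refl _]

lemma subset_foldl_keepStep {α : Type*} [DecidableEq α]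
    (keep : Finset α → α → Prop) (l : List α) (S : Finset α) :
    S ⊆ l.foldl (keepStep keep) S := by
  induction l generalizing S with
  | nil => exact Finset.Subset.refl _
  | cons e t ih => exact (subset_keepStep keep S e).trans (ih _)

lemma foldl_keepStep_subset {α : Type*} [DecidableEq α]
    (keep : Finset α → α → Prop) (l : List α) (S : Finset α) :
    l.foldl (keepStep keep) S ⊆ S ∪ l.toFinset := by
  induction l generalizing S with
  | nil => simp
  | cons e t ih =>
    refine (ih _).trans ?_
    unfold keepStep
    split_ifs <;> intro x hx <;> simp at hx ⊢ <;> tauto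

lemma foldl_keepStep_mono_prefix {α : Type*} [DecidableEq α]
    (keep : Finset α → α → Prop) {l l' : List α}
    (h : l <+: l') (S : Finset α) :
    l.foldl (keepStep keep) S ⊆ l'.foldl (keepStep keep) S := by
  obtain ⟨t, rfl⟩ := h
  rw [List.foldl_append]
  exact subset_foldl_keepStep _ _ _

/-- If the rule does not depend on the memory, the memory is determined. -/
lemma foldl_keepStep_eq {α : Type*} [DecidableEq α]
    (keep : Finset α → α → Prop) (K : α → Prop) (S₀ : Finset α)
    (l : List α) (hK : ∀ S e, S₀ ⊆ S → S ⊆ S₀ ∪ l.toFinset → e ∈ l → (keep S e ↔ K e)) :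
    l.foldl (keepStep keep) S₀ = S₀ ∪ l.toFinset.filter K := by
  have main : ∀ l₂ l₁ : List α, l₁ ++ l₂ = l →
      l₂.foldl (keepStep keep) (S₀ ∪ l₁.toFinset.filter K) = S₀ ∪ l.toFinset.filter K := by
    intro l₂
    induction l₂ with
    | nil => intro l₁ h; simp at h; simp [h]
    | cons e t ih =>
      intro l₁ h
      rw [List.foldl_cons, ← ih (l₁ ++ [e]) (by simpa using h)]
      congr 1
      have hk := hK (S₀ ∪ l₁.toFinset.filter K) e Finset.subset_union_left
        (by rw [← h]; intro x hx; simp at hx ⊢; tauto) (by rw [← h]; simp)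
      unfold keepStep
      by_cases hKe : K e
      · rw [if_pos (hk.2 hKe)]
        ext x
        by_cases hx : x = e
        · subst hx; simp [hKe]
        · simp [hx]
      · rw [if_neg (fun h => hKe (hk.1 h))]
        ext x
        by_cases hx : x = e
        · subst hx; simp [hKe]
        · simp [hx]
  simpa using main l [] rfl

/-- An edge that was not remembered was rejected at some moment. -/
lemma exists_not_keep_of_notMem {α : Type*} [DecidableEq α]
    (keep : Finset α → α → Prop) (S₀ : Finset α)
    (l : List α) {e : α} (he : e ∈ l) (hn : e ∉ l.foldl (keepStep keep) S₀) :
    ∃ S, S₀ ⊆ S ∧ S ⊆ l.foldl (keepStep keep) S₀ ∧ ¬ keep S e := by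
  obtain ⟨l₁, l₂, rfl⟩ := List.append_of_mem he
  refine ⟨l₁.foldl (keepStep keep) S₀, subset_foldl_keepStep _ _ _,
    foldl_keepStep_mono_prefix _ (List.prefix_append _ _) _, fun hk => hn ?_⟩
  rw [List.foldl_append, List.foldl_cons]
  refine subset_foldl_keepStep _ _ _ ?_
  rw [keepStep, if_pos hk]
  exact Finset.mem_insert_self _ _

/-- Size of the memory when edges are remembered either because they lie in a fixed set, or because
they lie in a group of which fewer than `cap` edges are remembered so far. -/
lemma card_foldl_keepStep_le {α γ : Type*} [DecidableEq α]
    (keep : Finset α → α → Prop) (S₀ A : Finset α)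
    (l : List α) (I : Finset γ) (grp : γ → Finset α) (cap : ℕ)
    (hk : ∀ S e, S₀ ⊆ S → S ⊆ S₀ ∪ l.toFinset → e ∈ l → keep S e →
      e ∈ A ∨ ∃ g ∈ I, e ∈ grp g ∧ (S ∩ grp g).card < cap) :
    (l.foldl (keepStep keep) S₀).card ≤ S₀.card + A.card + I.card * cap := by
  -- Potential argument: a new edge outside A raises min(cap, |S ∩ grp g|) for the group that
  -- admitted it, and no other such term falls.
  have main : ∀ l₂ l₁ : List α, l₁ ++ l₂ = l → ∀ S, S₀ ⊆ S → S ⊆ S₀ ∪ l₁.toFinset →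
      (S \ A).card ≤ S₀.card + ∑ g ∈ I, min cap (S ∩ grp g).card →
      ((l₂.foldl (keepStep keep) S) \ A).card ≤
        S₀.card + ∑ g ∈ I, min cap ((l₂.foldl (keepStep keep) S) ∩ grp g).card := by
    intro l₂
    induction l₂ with
    | nil => intro l₁ _ S _ _ h; exact h
    | cons e t ih =>
      intro l₁ hl S h1 h2 h3
      rw [List.foldl_cons]
      refine ih (l₁ ++ [e]) (by simpa using hl) _ (h1.trans (subset_keepStep _ _ _)) ?_ ?_
      · unfold keepStep
        split_ifs <;> intro x hx <;> simp at hx ⊢ <;> have := @h2 x <;> simp at this <;> tauto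
      · unfold keepStep
        split_ifs with hke
        · have hmono : ∀ g ∈ I, min cap (S ∩ grp g).card ≤ min cap ((insert e S) ∩ grp g).card :=
            fun g _ => min_le_min le_rfl (Finset.card_le_card
              (Finset.inter_subset_inter_right (Finset.subset_insert _ _)))
          by_cases heS : e ∈ S
          · rwa [Finset.insert_eq_of_mem heS]
          rcases hk S e h1 (h2.trans (by rw [← hl]; intro x hx; simp at hx ⊢; tauto))
            (by rw [← hl]; simp) hke with hA | ⟨g, hg, heg, hlt⟩
          · rw [Finset.insert_sdiff_of_mem _ hA]
            exact h3.trans (Nat.add_le_add_left (Finset.sum_le_sum hmono) _)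
          · have hlt' : min cap (S ∩ grp g).card < min cap ((insert e S) ∩ grp g).card := by
              rw [Finset.insert_inter_of_mem heg, Finset.card_insert_of_notMem (by simp [heS])]
              omega
            have := Finset.sum_lt_sum hmono ⟨g, hg, hlt'⟩
            have h4 : (insert e S \ A).card ≤ (S \ A).card + 1 :=
              (Finset.card_le_card (t := insert e (S \ A)) fun x hx => by
                simp at hx ⊢; tauto).trans (Finset.card_insert_le _ _)
            omega
        · exact h3
  have h := main l [] rfl S₀ (Finset.Subset.refl _) (by simp)
    ((Finset.card_le_card Finset.sdiff_subset).trans (Nat.le_add_right _ _))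
  have h2 : ∑ g ∈ I, min cap ((l.foldl (keepStep keep) S₀) ∩ grp g).card ≤ I.card * cap := by
    refine (Finset.sum_le_card_nsmul _ _ cap fun g _ => min_le_left _ _).trans (by simp)
  have h3 : (l.foldl (keepStep keep) S₀).card ≤
      ((l.foldl (keepStep keep) S₀) \ A).card + A.card := by
    have := Finset.le_card_sdiff A (l.foldl (keepStep keep) S₀)
    omega
  omega

/-- The oracle whose memory is a set of edges, encoded as a bit string. -/
def edgeOracle {Coins : Type} (law : PMF Coins) (enc : Finset (Sym2 (Fin n)) → List Bool)
    (keep : Fin 3 → Sample n N → Coins → Finset (Sym2 (Fin n)) → Sym2 (Fin n) → Prop)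
    (ans : Sample n N → Coins → Finset (Sym2 (Fin n)) → Config n N → Prop) : Oracle n N where
  Coins := Coins
  coinLaw := law
  init _ _ := enc ∅
  step i r w mem e := enc (keepStep (keep i r w) (Function.invFun enc mem) e)
  answer r w mem q := decide (ans r w (Function.invFun enc mem) q)

/-- The set remembered at the start of pass `i`. -/
def memSet (keep : Fin 3 → Finset (Sym2 (Fin n)) → Sym2 (Fin n) → Prop)
    (stream : Fin 3 → List (Sym2 (Fin n))) : ℕ → Finset (Sym2 (Fin n))
  | 0 => ∅
  | i + 1 => if h : i < 3 then
      (stream ⟨i, h⟩).foldl (keepStep (keep ⟨i, h⟩)) (memSet keep stream i)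
    else memSet keep stream i

variable {Coins : Type} (law : PMF Coins) (enc : Finset (Sym2 (Fin n)) → List Bool)
    (keep : Fin 3 → Sample n N → Coins → Finset (Sym2 (Fin n)) → Sym2 (Fin n) → Prop)
    (ans : Sample n N → Coins → Finset (Sym2 (Fin n)) → Config n N → Prop)

/-- As `enc` is injective, decoding undoes it, and from here on the bit strings can be replaced by
the sets they encode. -/
lemma edgeOracle_foldl (henc : Function.Injective enc) (i : Fin 3) (r : Sample n N) (w : Coins)
    (l : List (Sym2 (Fin n))) (S : Finset (Sym2 (Fin n))) :
    l.foldl ((edgeOracle law enc keep ans).step i r w) (enc S) =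
      enc (l.foldl (keepStep (keep i r w)) S) := by
  induction l generalizing S with
  | nil => rfl
  | cons e t ih =>
    rw [List.foldl_cons, List.foldl_cons, ← ih]
    simp only [edgeOracle]
    rw [Function.leftInverse_invFun henc S]

lemma edgeOracle_memoryAt (henc : Function.Injective enc) (r : Sample n N) (w : Coins)
    (stream : Fin 3 → List (Sym2 (Fin n))) (i : ℕ) :
    (edgeOracle law enc keep ans).memoryAt r w stream i =
      enc (memSet (fun i => keep i r w) stream i) := by
  induction i with
  | zero => rfl
  | succ i ih =>
    simp only [Oracle.memoryAt, memSet]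
    split_ifs with h
    · rw [ih]; exact edgeOracle_foldl law enc keep ans henc _ r w _ _
    · exact ih

lemma edgeOracle_output (henc : Function.Injective enc) (r : Sample n N) (w : Coins)
    (stream : Fin 3 → List (Sym2 (Fin n))) (q : Config n N) :
    (edgeOracle law enc keep ans).output r w stream q = true ↔
      ans r w (memSet (fun i => keep i r w) stream 3) q := by
  unfold Oracle.output
  rw [edgeOracle_memoryAt law enc keep ans henc]
  simp [edgeOracle, Function.leftInverse_invFun henc _]

lemma memSet_mono (keep : Fin 3 → Finset (Sym2 (Fin n)) → Sym2 (Fin n) → Prop)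
    (stream : Fin 3 → List (Sym2 (Fin n))) (i : ℕ) :
    memSet keep stream i ⊆ memSet keep stream (i + 1) := by
  simp only [memSet]
  split_ifs with h
  · exact subset_foldl_keepStep _ _ _
  · exact Finset.Subset.refl _

lemma edgeOracle_spaceAtMost (henc : Function.Injective enc) (bits : ℕ)
    (hlen : ∀ S, (enc S).length = bits * S.card) (r : Sample n N) (w : Coins)
    (stream : Fin 3 → List (Sym2 (Fin n))) (b : ℝ)
    (hb : (bits : ℝ) * (memSet (fun i => keep i r w) stream 3).card ≤ b) :
    (edgeOracle law enc keep ans).SpaceAtMost r w stream b := by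
  intro i l hl
  rw [edgeOracle_memoryAt law enc keep ans henc, edgeOracle_foldl law enc keep ans henc, hlen]
  push_cast
  refine le_trans (mul_le_mul_of_nonneg_left ?_ (by positivity)) hb
  norm_cast
  -- The memory never shrinks, so its final size bounds its size at every moment.
  refine Finset.card_le_card ((foldl_keepStep_mono_prefix _ hl _).trans ?_)
  have h1 : (stream i).foldl (keepStep (keep i r w)) (memSet (fun i => keep i r w) stream i) =
      memSet (fun i => keep i r w) stream (i + 1) := by
    simp [memSet, i.2]
  rw [h1]
  have hmono : Monotone (memSet (fun i => keep i r w) stream) :=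
    monotone_nat_of_le_succ fun i => memSet_mono _ _ i
  exact hmono (by omega)

end EdgeOracle

/-! ### The random choices as finite probability spaces -/

/-- A finite distribution as a `PMF`. -/
def FinProb.toPMF {Ω : Type} [Fintype Ω] (D : FinProb Ω) : PMF Ω :=
  PMF.ofFintype (fun x => ENNReal.ofReal (D.w x)) (by
    rw [← ENNReal.ofReal_sum_of_nonneg fun x _ => D.nonneg x, D.sum_one, ENNReal.ofReal_one])

/-- The number of values of a random shift with parameter `L`. -/
def numShifts (L : ℝ) : ℕ := sInf {e : ℕ | 2 ≤ (1 + 1 / (200 * L)) ^ e}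

/-- The admissible exponents form an initial segment of ℕ, so the random exponent may be modelled as
a uniform element of `Fin (numShifts L)`. -/
lemma shift_lt_two_iff {L : ℝ} (hL : 1 ≤ L) (e : ℕ) :
    (1 + 1 / (200 * L)) ^ e < 2 ↔ e < numShifts L := by
  have hb : 1 < 1 + 1 / (200 * L) := by
    have : 0 < 1 / (200 * L) := by positivity
    linarith
  have hne : {e : ℕ | 2 ≤ (1 + 1 / (200 * L)) ^ e}.Nonempty := by
    obtain ⟨e, he⟩ := pow_unbounded_of_one_lt 2 hb
    exact ⟨e, he.le⟩
  constructor
  · intro h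
    by_contra hcon
    push Not at hcon
    have h1 : 2 ≤ (1 + 1 / (200 * L)) ^ numShifts L := Nat.sInf_mem hne
    have h2 := pow_le_pow_right₀ hb.le hcon
    linarith
  · intro h
    by_contra hcon
    push Not at hcon
    exact absurd (Nat.sInf_le (s := {e : ℕ | 2 ≤ (1 + 1 / (200 * L)) ^ e}) hcon) (not_le.2 h)

/-- Since (1 + 1/(200L))^(100L) ≤ e^(1/2) < 2. An event that holds for boundedly many exponents
therefore has probability O(1/L). -/
lemma le_numShifts {L : ℝ} (hL : 1 ≤ L) : 100 * L ≤ numShifts L := by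
  have h : ⌊100 * L⌋₊ < numShifts L := by
    rw [← shift_lt_two_iff hL]
    have h1 : (1 + 1 / (200 * L)) ≤ Real.exp (1 / (200 * L)) := by
      rw [add_comm]; exact Real.add_one_le_exp _
    calc (1 + 1 / (200 * L)) ^ ⌊100 * L⌋₊ ≤ Real.exp (1 / (200 * L)) ^ ⌊100 * L⌋₊ :=
          pow_le_pow_left₀ (by positivity) h1 _
      _ = Real.exp (⌊100 * L⌋₊ * (1 / (200 * L))) := (Real.exp_nat_mul _ _).symm
      _ ≤ Real.exp (1 / 2) := by
          refine Real.exp_le_exp.2 ?_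
          have := Nat.floor_le (by positivity : 0 ≤ 100 * L)
          rw [mul_one_div, div_le_div_iff₀ (by positivity) (by norm_num)]
          linarith
      _ < 2 := by
          have h2 := Real.exp_one_lt_d9
          have h3 : Real.exp (1 / 2) ^ 2 = Real.exp 1 := by
            rw [← Real.exp_nat_mul]; norm_num
          nlinarith [Real.exp_pos (1 / 2)]
  have := Nat.lt_floor_add_one (100 * L)
  have h' : ((⌊100 * L⌋₊ + 1 : ℕ) : ℝ) ≤ numShifts L := by exact_mod_cast h
  push_cast at h'
  linarith

lemma numShifts_pos {L : ℝ} (hL : 1 ≤ L) : 0 < numShifts L := by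
  have := le_numShifts hL
  have : (0 : ℝ) < numShifts L := by linarith
  exact_mod_cast this

/-- Exponents of the three shifts. -/
abbrev ShiftExp (L : Fin 3 → ℝ) : Type :=
  Fin (numShifts (L 0)) × Fin (numShifts (L 1)) × Fin (numShifts (L 2))

/-- The uniform distribution of the exponents. -/
def shiftDist (L : Fin 3 → ℝ) (hL : ∀ i, 1 ≤ L i) : FinProb (ShiftExp L) :=
  (FinProb.unif _ (numShifts_pos (hL 0))).prod
    ((FinProb.unif _ (numShifts_pos (hL 1))).prod (FinProb.unif _ (numShifts_pos (hL 2))))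

/-- The sampled sets of the counting algorithm. -/
def setDist (P : Params) (n : ℕ) : FinProb (Fin P.numScales × Label × Fin n → Bool) :=
  FinProb.bern fun i : Fin P.numScales × Label × Fin n => P.prob (i.1 : ℕ) i.2.1

/-- The outcome with given sets and exponents. -/
def toSample {n N : ℕ} {L : Fin 3 → ℝ} (x : (Fin N × Label × Fin n → Bool) × ShiftExp L) :
    Sample n N :=
  (x.1, ![(x.2.1 : ℕ), (x.2.2.1 : ℕ), (x.2.2.2 : ℕ)])

lemma toSample_injective {n N : ℕ} {L : Fin 3 → ℝ} :
    Function.Injective (toSample (n := n) (N := N) (L := L)) := by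
  rintro ⟨a, b, c, d⟩ ⟨a', b', c', d'⟩ h
  simp only [toSample, Prod.mk.injEq] at h
  obtain ⟨h1, h2⟩ := h
  have e0 := congrFun h2 0
  have e1 := congrFun h2 1
  have e2 := congrFun h2 2
  simp at e0 e1 e2
  simp [h1, Fin.ext_iff, e0, e1, e2]

lemma uniformOn_shift {L : ℝ} (hL : 1 ≤ L) (e : Fin (numShifts L)) :
    uniformOn {e : ℕ | (1 + 1 / (200 * L)) ^ e < (2 : ℝ)} {(e : ℕ)} =
      ENNReal.ofReal (1 / numShifts L) := by
  have h1 : {e : ℕ | (1 + 1 / (200 * L)) ^ e < (2 : ℝ)} = ((Finset.range (numShifts L) : Finset ℕ) :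
      Set ℕ) := by
    ext e; simpa using shift_lt_two_iff hL e
  have h2 : ({(e : ℕ)} : Set ℕ) = (({(e : ℕ)} : Finset ℕ) : Set ℕ) := by simp
  rw [h1, h2, uniformOn_apply_finset]
  rw [Finset.inter_singleton_of_mem (by simp), Finset.card_singleton, Finset.card_range,
    ENNReal.ofReal_div_of_pos (by exact_mod_cast numShifts_pos hL)]
  simp

lemma isProbabilityMeasure_uniformOn_shift {L : ℝ} (hL : 1 ≤ L) :
    IsProbabilityMeasure (uniformOn {e : ℕ | (1 + 1 / (200 * L)) ^ e < (2 : ℝ)}) := by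
  refine isProbabilityMeasure_uniformOn ?_ ⟨0, by simp⟩
  refine (Set.finite_Iio (numShifts L)).subset fun e he => ?_
  exact (shift_lt_two_iff hL e).1 he

lemma bernoulliMeasure_singleton (p : unitInterval) (b : Bool) :
    bernoulliMeasure true false p {b} = ENNReal.ofReal (if b then (p : ℝ) else 1 - p) := by
  have h := bernoulliMeasure_real_apply (x := true) (y := false) p (s := {b}) (by simp)
  rw [measureReal_def] at h
  rw [← ENNReal.ofReal_toReal (measure_ne_top (bernoulliMeasure true false p) {b}), h]
  cases b <;> simp

lemma sampleLaw_singleton (P : Params) (L : Fin 3 → ℝ) (hL : ∀ i, 1 ≤ L i) (n : ℕ)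
    (x : (Fin P.numScales × Label × Fin n → Bool) × ShiftExp L) :
    sampleLaw P L n {toSample x} =
      ENNReal.ofReal (((setDist P n).prod (shiftDist L hL)).w x) := by
  have : ∀ i, IsProbabilityMeasure (uniformOn {e : ℕ | (1 + 1 / (200 * L i)) ^ e < (2 : ℝ)}) :=
    fun i => isProbabilityMeasure_uniformOn_shift (hL i)
  have h1 : ({toSample x} : Set (Sample n P.numScales)) = {x.1} ×ˢ {(toSample x).2} := by
    rw [Set.singleton_prod_singleton]; rfl
  rw [h1, sampleLaw, Measure.prod_prod, Measure.pi_singleton, Measure.pi_singleton]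
  simp only [FinProb.prod, setDist, FinProb.bern, shiftDist, FinProb.unif]
  rw [ENNReal.ofReal_mul (Finset.prod_nonneg fun i _ => by
    have h0 := (P.prob (i.1 : ℕ) i.2.1).2.1
    have h1 := (P.prob (i.1 : ℕ) i.2.1).2.2
    split_ifs
    · exact h0
    · linarith)]
  congr 1
  · rw [ENNReal.ofReal_prod_of_nonneg fun i _ => by
      have h0 := (P.prob (i.1 : ℕ) i.2.1).2.1
      have h1 := (P.prob (i.1 : ℕ) i.2.1).2.2
      split_ifs
      · exact h0
      · linarith]
    refine Finset.prod_congr rfl fun i _ => ?_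
    exact bernoulliMeasure_singleton _ _
  · rw [Fin.prod_univ_three]
    have e0 := uniformOn_shift (hL 0) x.2.1
    have e1 := uniformOn_shift (hL 1) x.2.2.1
    have e2 := uniformOn_shift (hL 2) x.2.2.2
    simp only [toSample, Matrix.cons_val_zero, Matrix.cons_val_one, Matrix.cons_val] at e0 e1 e2 ⊢
    rw [e0, e1, e2, ← ENNReal.ofReal_mul (by positivity), ← ENNReal.ofReal_mul (by positivity),
      mul_assoc]

/-- One inequality is enough, as only lower bounds on probabilities are wanted: the outcomes of the
finite model are distinct atoms of the law, with the right masses. -/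
lemma ofReal_Pr_le_sampleLaw (P : Params) (L : Fin 3 → ℝ) (hL : ∀ i, 1 ≤ L i) (n : ℕ)
    (A : Sample n P.numScales → Prop) :
    ENNReal.ofReal (((setDist P n).prod (shiftDist L hL)).Pr fun x => A (toSample x)) ≤
      sampleLaw P L n {r | A r} := by
  set D := (setDist P n).prod (shiftDist L hL)
  have h1 : ((Finset.univ.filter fun x => A (toSample x)).image
      (toSample (n := n) (L := L)) : Set (Sample n P.numScales)) ⊆ {r | A r} := by
    intro r hr
    simp only [Finset.coe_image, Set.mem_image, Finset.mem_coe, Finset.mem_filter] at hr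
    obtain ⟨x, ⟨_, hx⟩, rfl⟩ := hr
    exact hx
  refine le_trans (le_of_eq ?_) (measure_mono h1)
  rw [← sum_measure_singleton, Finset.sum_image fun x _ y _ h => toSample_injective h]
  simp only [sampleLaw_singleton P L hL n, FinProb.Pr, FinProb.E]
  rw [ENNReal.ofReal_sum_of_nonneg fun x _ => mul_nonneg (D.nonneg x) (by split_ifs <;> simp),
    Finset.sum_filter]
  refine Finset.sum_congr rfl fun x _ => ?_
  split_ifs <;> simp [D]

/-- The type of coins is a field of the oracle, so its identification with a given type and law
enters as hypotheses. -/
lemma ofReal_Pr_le_probability (P : Params) (L : Fin 3 → ℝ) (hL : ∀ i, 1 ≤ L i) (n : ℕ)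
    {Coins : Type} [Fintype Coins] (D : FinProb Coins) (O : Oracle n P.numScales)
    (hC : O.Coins = Coins) (hlaw : HEq O.coinLaw D.toPMF)
    (E : Sample n P.numScales → Coins → Prop) (E' : Sample n P.numScales → O.Coins → Prop)
    (hE : ∀ r w, E r (cast hC w) → E' r w) :
    ENNReal.ofReal ((setDist P n).E fun r => D.E fun w => (shiftDist L hL).E fun e =>
        if E (toSample (r, e)) w then 1 else 0) ≤ O.probability (sampleLaw P L n) E' := by
  obtain ⟨C, law, i, s, a⟩ := O
  simp only at hC
  subst hC
  simp only [heq_eq_eq] at hlaw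
  subst hlaw
  unfold Oracle.probability
  rw [tsum_fintype, FinProb.E_comm]
  simp only [FinProb.toPMF, PMF.ofFintype_apply]
  simp only [FinProb.E.eq_1 D]
  rw [ENNReal.ofReal_sum_of_nonneg fun x _ => mul_nonneg (D.nonneg x)
    (FinProb.E_nonneg _ fun r => FinProb.E_nonneg _ fun e => by split_ifs <;> simp)]
  refine Finset.sum_le_sum fun w _ => ?_
  rw [ENNReal.ofReal_mul (D.nonneg w)]
  refine mul_le_mul_right ?_ _
  refine le_trans (le_of_eq ?_) ((ofReal_Pr_le_sampleLaw P L hL n fun r => E r w).trans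
    (measure_mono fun r hr => hE r w hr))
  rw [FinProb.Pr, FinProb.E_prod]

end

section

/-! ### Combinatorics of four-cycles -/

/-- The finite set of all elements with a property. -/
def filt {α : Type*} [Fintype α] (p : α → Prop) : Finset α := Finset.univ.filter p

@[simp] lemma mem_filt {α : Type*} [Fintype α] {p : α → Prop} {x : α} : x ∈ filt p ↔ p x := by
  simp [filt]

lemma ncard_eq_card_filt {α : Type*} [Fintype α] (p : α → Prop) :
    {x | p x}.ncard = (filt p).card := by
  rw [← Set.ncard_coe_finset]; congr 1; ext; simp

instance {n N : ℕ} : Fintype (Config n N) := Fintype.ofFinite _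

variable {n N : ℕ}

/-- The edge set of the closed walk `a b c d`. -/
def cyc (a b c d : Fin n) : Finset (Sym2 (Fin n)) := {s(a, b), s(b, c), s(c, d), s(d, a)}

/-- `a b c d` is a four-cycle of `G`. -/
structure IsCyc (G : SimpleGraph (Fin n)) (a b c d : Fin n) : Prop where
  ab : G.Adj a b
  bc : G.Adj b c
  cd : G.Adj c d
  da : G.Adj d a
  ac : a ≠ c
  bd : b ≠ d

lemma IsCyc.rot {G : SimpleGraph (Fin n)} {a b c d : Fin n} (h : IsCyc G a b c d) :
    IsCyc G b c d a := ⟨h.bc, h.cd, h.da, h.ab, h.bd, h.ac.symm⟩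

lemma IsCyc.rev {G : SimpleGraph (Fin n)} {a b c d : Fin n} (h : IsCyc G a b c d) :
    IsCyc G a d c b := ⟨h.da.symm, h.cd.symm, h.bc.symm, h.ab.symm, h.ac, h.bd.symm⟩

lemma mem_cyc {a b c d : Fin n} {e : Sym2 (Fin n)} :
    e ∈ cyc a b c d ↔ e = s(a, b) ∨ e = s(b, c) ∨ e = s(c, d) ∨ e = s(d, a) := by
  simp [cyc]

lemma cyc_rot (a b c d : Fin n) : cyc b c d a = cyc a b c d := by
  ext e; rw [mem_cyc, mem_cyc]; tauto

lemma cyc_rev (a b c d : Fin n) : cyc a d c b = cyc a b c d := by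
  ext e
  rw [mem_cyc, mem_cyc, Sym2.eq_swap (a := a) (b := d), Sym2.eq_swap (a := d) (b := c),
    Sym2.eq_swap (a := c) (b := b), Sym2.eq_swap (a := b) (b := a)]
  tauto

lemma mem_fourCycles_iff {G : SimpleGraph (Fin n)} {A : Finset (Sym2 (Fin n))} :
    A ∈ fourCycles G ↔ ∃ a b c d, IsCyc G a b c d ∧ A = cyc a b c d := by
  constructor
  · rintro ⟨a, b, c, d, hn, h1, h2, h3, h4, rfl⟩
    simp at hn
    exact ⟨a, b, c, d, ⟨h1, h2, h3, h4, by tauto, by tauto⟩, rfl⟩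
  · rintro ⟨a, b, c, d, h, rfl⟩
    refine ⟨a, b, c, d, ?_, h.ab, h.bc, h.cd, h.da, rfl⟩
    have := h.ab.ne; have := h.bc.ne; have := h.cd.ne; have := h.da.ne.symm; have := h.ac
    have := h.bd
    simp; tauto

lemma isNodeOf_cyc {a b c d v : Fin n} :
    IsNodeOf (cyc a b c d) v ↔ v = a ∨ v = b ∨ v = c ∨ v = d := by
  simp only [IsNodeOf, mem_cyc]
  constructor
  · rintro ⟨e, rfl | rfl | rfl | rfl, hv⟩ <;> simp at hv <;> tauto
  · rintro (rfl | rfl | rfl | rfl)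
    exacts [⟨_, Or.inl rfl, by simp⟩, ⟨_, Or.inl rfl, by simp⟩,
      ⟨_, Or.inr (Or.inl rfl), by simp⟩, ⟨_, Or.inr (Or.inr (Or.inl rfl)), by simp⟩]

lemma isNodeOf_of_mem {A : Finset (Sym2 (Fin n))} {u v : Fin n} (h : s(u, v) ∈ A) :
    IsNodeOf A u ∧ IsNodeOf A v := ⟨⟨_, h, by simp⟩, ⟨_, h, by simp⟩⟩

section

variable {G : SimpleGraph (Fin n)} {A : Finset (Sym2 (Fin n))}

lemma exists_cyc_of_node (hA : A ∈ fourCycles G) {v : Fin n} (hv : IsNodeOf A v) :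
    ∃ b c d, IsCyc G v b c d ∧ A = cyc v b c d := by
  obtain ⟨p, q, r, t, h, rfl⟩ := mem_fourCycles_iff.1 hA
  rcases isNodeOf_cyc.1 hv with rfl | rfl | rfl | rfl
  · exact ⟨_, _, _, h, rfl⟩
  · exact ⟨_, _, _, h.rot, (cyc_rot _ _ _ _).symm⟩
  · exact ⟨_, _, _, h.rot.rot, by rw [cyc_rot, cyc_rot]⟩
  · exact ⟨_, _, _, h.rot.rot.rot, by rw [cyc_rot, cyc_rot, cyc_rot]⟩

lemma mk_mem_cyc_iff {a b c d v : Fin n} (h : IsCyc G a b c d) :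
    s(a, v) ∈ cyc a b c d ↔ v = b ∨ v = d := by
  have := h.ab.ne; have := h.bc.ne; have := h.cd.ne; have := h.da.ne.symm; have := h.ac
  have := h.bd
  simp only [mem_cyc, Sym2.eq_iff]
  grind

lemma exists_cyc_of_edge (hA : A ∈ fourCycles G) {u v : Fin n} (hv : s(u, v) ∈ A) :
    ∃ c d, IsCyc G u v c d ∧ A = cyc u v c d := by
  obtain ⟨b, c, d, h, rfl⟩ := exists_cyc_of_node hA (isNodeOf_of_mem hv).1
  rcases (mk_mem_cyc_iff h).1 hv with rfl | rfl
  · exact ⟨_, _, h, rfl⟩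
  · exact ⟨_, _, h.rev, (cyc_rev _ _ _ _).symm⟩

lemma exists_cyc_of_wedge (hA : A ∈ fourCycles G) {a w b : Fin n} (hab : a ≠ b)
    (h1 : s(a, w) ∈ A) (h2 : s(w, b) ∈ A) : ∃ z, IsCyc G a w b z ∧ A = cyc a w b z := by
  rw [Sym2.eq_swap] at h1
  obtain ⟨c, d, h, rfl⟩ := exists_cyc_of_edge hA h1
  rcases (mk_mem_cyc_iff h).1 h2 with rfl | rfl
  · exact absurd rfl hab
  · exact ⟨c, h.rev.rot.rot.rot, by
      rw [← cyc_rev w a c b, ← cyc_rot w b c a, ← cyc_rot b c a w, ← cyc_rot c a w b]⟩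

lemma exists_cyc_of_opposite (hA : A ∈ fourCycles G) {u v : Fin n} (huv : u ≠ v)
    (h1 : IsNodeOf A u) (h2 : IsNodeOf A v) (h3 : s(u, v) ∉ A) :
    ∃ w z, IsCyc G u w v z ∧ A = cyc u w v z := by
  obtain ⟨b, c, d, h, rfl⟩ := exists_cyc_of_node hA h1
  rw [mk_mem_cyc_iff h] at h3
  rcases isNodeOf_cyc.1 h2 with rfl | rfl | rfl | rfl
  · exact absurd rfl huv
  · tauto
  · exact ⟨_, _, h, rfl⟩
  · tauto

lemma cyc_mem (h : IsCyc G a b c d) : cyc a b c d ∈ fourCycles G :=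
  mem_fourCycles_iff.2 ⟨_, _, _, _, h, rfl⟩

/-- The node d is recovered as the other neighbour of u, and c as the other neighbour of v. Cycles
through an edge thus correspond to ordered pairs of vertices, which is how `heaviness_edge` counts
them. -/
lemma cyc_inj_edge {u v c d c' d' : Fin n} (h : IsCyc G u v c d) (h' : IsCyc G u v c' d')
    (e : cyc u v c d = cyc u v c' d') : c = c' ∧ d = d' := by
  have hd : s(u, d) ∈ cyc u v c' d' := by rw [← e, mk_mem_cyc_iff h]; tauto
  rw [mk_mem_cyc_iff h'] at hd
  have hc : s(v, c) ∈ cyc v c' d' u := by rw [cyc_rot, ← e, mem_cyc]; tauto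
  rw [mk_mem_cyc_iff h'.rot] at hc
  have := h.ac; have := h.bd
  grind

lemma cyc_inj_wedge {a w b z z' : Fin n} (h : IsCyc G a w b z) (h' : IsCyc G a w b z')
    (e : cyc a w b z = cyc a w b z') : z = z' := (cyc_inj_edge h h' e).2

lemma adj_of_mem (hA : A ∈ fourCycles G) {u v : Fin n} (h : s(u, v) ∈ A) : G.Adj u v := by
  obtain ⟨_, _, h, -⟩ := exists_cyc_of_edge hA h
  exact h.ab

/-- The nodes of a four-cycle. -/
def nodeSet (A : Finset (Sym2 (Fin n))) : Finset (Fin n) := filt (IsNodeOf A)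

@[simp] lemma mem_nodeSet {v : Fin n} : v ∈ nodeSet A ↔ IsNodeOf A v := by simp [nodeSet]

lemma nodeSet_cyc (a b c d : Fin n) : nodeSet (cyc a b c d) = {a, b, c, d} := by
  ext v; simp [isNodeOf_cyc]

lemma prod_nodeSet {M : Type*} [CommMonoid M] {a b c d : Fin n} (h : IsCyc G a b c d)
    (f : Fin n → M) : ∏ v ∈ nodeSet (cyc a b c d), f v = f a * f b * f c * f d := by
  have := h.ab.ne; have := h.bc.ne; have := h.cd.ne; have := h.da.ne.symm; have := h.ac
  have := h.bd
  rw [nodeSet_cyc, Finset.prod_insert (by simp; tauto), Finset.prod_insert (by simp; tauto),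
    Finset.prod_insert (by simp; tauto), Finset.prod_singleton]
  simp only [mul_assoc]

lemma card_nodeSet (hA : A ∈ fourCycles G) : (nodeSet A).card = 4 := by
  obtain ⟨a, b, c, d, h, rfl⟩ := mem_fourCycles_iff.1 hA
  have := h.ab.ne; have := h.bc.ne; have := h.cd.ne; have := h.da.ne.symm; have := h.ac
  have := h.bd
  rw [nodeSet_cyc, Finset.card_insert_of_notMem (by simp; tauto),
    Finset.card_insert_of_notMem (by simp; tauto), Finset.card_insert_of_notMem (by simp; tauto),
    Finset.card_singleton]

lemma card_fourCycle (hA : A ∈ fourCycles G) : A.card = 4 := by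
  obtain ⟨a, b, c, d, h, rfl⟩ := mem_fourCycles_iff.1 hA
  have := h.ab.ne; have := h.bc.ne; have := h.cd.ne; have := h.da.ne.symm; have := h.ac
  have := h.bd
  rw [cyc, Finset.card_insert_of_notMem (by simp; tauto),
    Finset.card_insert_of_notMem (by simp; tauto), Finset.card_insert_of_notMem (by simp; tauto),
    Finset.card_singleton]

/-! ### Heaviness as a number of walks -/

lemma heaviness_eq_card (G : SimpleGraph (Fin n)) (s : Substructure n) :
    heaviness G s = ((filt fun A => A ∈ fourCycles G ∧ s.In A).card : ℝ) := by
  rw [heaviness, ← ncard_eq_card_filt]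

/-- Common neighbours. -/
def commonNbrs (G : SimpleGraph (Fin n)) (a b : Fin n) : Finset (Fin n) :=
  filt fun z => G.Adj a z ∧ G.Adj b z

@[simp] lemma mem_commonNbrs {a b z : Fin n} :
    z ∈ commonNbrs G a b ↔ G.Adj a z ∧ G.Adj b z := by simp [commonNbrs]

/-- The fourth node is any common neighbour of a and b except w, which accounts for the 1. In
particular the heaviness of a wedge depends on its end points only. -/
lemma heaviness_wedge {a w b : Fin n} (hab : a ≠ b) (h1 : G.Adj a w) (h2 : G.Adj w b) :
    heaviness G (.wedge a w b) + 1 = (commonNbrs G a b).card := by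
  have hw : w ∈ commonNbrs G a b := by simp [h1, h2.symm]
  have : (filt fun A => A ∈ fourCycles G ∧ (Substructure.wedge a w b).In A).card =
      ((commonNbrs G a b).erase w).card := by
    symm
    refine Finset.card_bij (fun z _ => cyc a w b z) ?_ ?_ ?_
    · intro z hz
      simp only [Finset.mem_erase, mem_commonNbrs] at hz
      have hc : IsCyc G a w b z := ⟨h1, h2, hz.2.2, hz.2.1.symm, hab, hz.1.symm⟩
      simp only [mem_filt, Substructure.In]
      exact ⟨cyc_mem hc, hab, by rw [mem_cyc]; tauto, by rw [mem_cyc]; tauto⟩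
    · intro z hz z' hz' e
      simp only [Finset.mem_erase, mem_commonNbrs] at hz hz'
      exact cyc_inj_wedge ⟨h1, h2, hz.2.2, hz.2.1.symm, hab, hz.1.symm⟩
        ⟨h1, h2, hz'.2.2, hz'.2.1.symm, hab, hz'.1.symm⟩ e
    · intro A hA
      simp only [mem_filt, Substructure.In] at hA
      obtain ⟨z, hz, rfl⟩ := exists_cyc_of_wedge hA.1 hA.2.1 hA.2.2.1 hA.2.2.2
      exact ⟨z, by simp [hz.cd, hz.da.symm, hz.bd.symm], rfl⟩
  rw [heaviness_eq_card, this, ← Finset.card_erase_add_one hw]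
  push_cast; rfl

lemma heaviness_edge (G : SimpleGraph (Fin n)) (u v : Fin n) :
    heaviness G (.edge u v) =
      ((filt fun p : Fin n × Fin n => IsCyc G u v p.1 p.2).card : ℝ) := by
  rw [heaviness_eq_card]
  congr 1
  symm
  refine Finset.card_bij (fun p _ => cyc u v p.1 p.2) ?_ ?_ ?_
  · intro p hp
    simp only [mem_filt, Substructure.In] at hp ⊢
    exact ⟨cyc_mem hp, by rw [mem_cyc]; tauto⟩
  · intro p hp p' hp' e
    simp only [mem_filt] at hp hp'
    obtain ⟨h1, h2⟩ := cyc_inj_edge hp hp' e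
    exact Prod.ext h1 h2
  · intro A hA
    simp only [mem_filt, Substructure.In] at hA
    obtain ⟨c, d, hc, rfl⟩ := exists_cyc_of_edge hA.1 hA.2
    exact ⟨(c, d), by simpa using hc, rfl⟩

/-- A pair of opposite nodes is in at most `(t + 1 choose 2) ≤ t ^ 2` four-cycles, where `t` is the
heaviness of a wedge between them. -/
lemma heaviness_oppositePair_le {u w v : Fin n} (huv : u ≠ v) (h1 : G.Adj u w) (h2 : G.Adj w v) :
    heaviness G (.oppositePair u v) ≤ heaviness G (.wedge u w v) ^ 2 := by
  have hw : w ∈ commonNbrs G u v := by simp [h1, h2.symm]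
  have hcard : (filt fun A => A ∈ fourCycles G ∧
      (Substructure.oppositePair u v).In A).card ≤ ((commonNbrs G u v).card).choose 2 := by
    rw [← Finset.card_powersetCard]
    refine le_trans (Finset.card_le_card (t := ((commonNbrs G u v).powersetCard 2).image
      fun S => S.image (fun w => s(u, w)) ∪ S.image fun w => s(w, v)) ?_) Finset.card_image_le
    intro A hA
    simp only [mem_filt, Substructure.In] at hA
    obtain ⟨w, z, hc, rfl⟩ := exists_cyc_of_opposite hA.1 hA.2.1 hA.2.2.1 hA.2.2.2.1 hA.2.2.2.2
    rw [Finset.mem_image]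
    refine ⟨{w, z}, ?_, ?_⟩
    · rw [Finset.mem_powersetCard]
      refine ⟨?_, Finset.card_pair hc.bd⟩
      intro x hx
      simp only [Finset.mem_insert, Finset.mem_singleton] at hx
      rcases hx with rfl | rfl
      · simp [hc.ab, hc.bc.symm]
      · simp [hc.da.symm, hc.cd]
    · ext e
      rw [mem_cyc, Sym2.eq_swap (a := v), Sym2.eq_swap (a := z) (b := u)]
      simp only [Finset.image_insert, Finset.image_singleton, Finset.mem_union, Finset.mem_insert,
        Finset.mem_singleton]
      tauto
  have ht := heaviness_wedge huv h1 h2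
  rw [heaviness_eq_card G (.wedge u w v)] at ht ⊢
  rw [heaviness_eq_card]
  set t := (filt fun A => A ∈ fourCycles G ∧ (Substructure.wedge u w v).In A).card
  have ht' : (commonNbrs G u v).card = t + 1 := by exact_mod_cast ht.symm
  rw [ht'] at hcard
  have h3 : (t + 1).choose 2 ≤ t ^ 2 := by
    rw [Nat.choose_two_right, Nat.add_sub_cancel]
    refine Nat.div_le_of_le_mul ?_
    rcases Nat.eq_zero_or_pos t with h | h
    · simp [h]
    · nlinarith
  exact_mod_cast hcard.trans h3

lemma card_fourCycles_le_pow (G : SimpleGraph (Fin n)) : (fourCycles G).ncard ≤ n ^ 4 := by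
  have : fourCycles G ⊆ ((Finset.univ : Finset ((Fin n × Fin n) × Fin n × Fin n)).image
      fun p => cyc p.1.1 p.1.2 p.2.1 p.2.2 : Finset _) := by
    intro A hA
    obtain ⟨a, b, c, d, -, rfl⟩ := mem_fourCycles_iff.1 hA
    simp only [Finset.coe_image, Finset.coe_univ, Set.image_univ, Set.mem_range]
    exact ⟨((a, b), c, d), rfl⟩
  refine (Set.ncard_le_ncard this).trans ?_
  rw [Set.ncard_coe_finset]
  refine Finset.card_image_le.trans (le_of_eq ?_)
  simp; ring

/-- A four-cycle is determined by two opposite directed edges. This yields √T ≤ 2m, so a bounded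
number of stored edges fits into O(m/√T). -/
lemma card_fourCycles_le_sq (G : SimpleGraph (Fin n)) :
    (fourCycles G).ncard ≤ (2 * G.edgeSet.ncard) ^ 2 := by
  have : fourCycles G ⊆ ((Finset.univ : Finset (G.Dart × G.Dart)).image
      fun p => cyc p.1.fst p.1.snd p.2.fst p.2.snd : Finset _) := by
    intro A hA
    obtain ⟨a, b, c, d, h, rfl⟩ := mem_fourCycles_iff.1 hA
    simp only [Finset.coe_image, Finset.coe_univ, Set.image_univ, Set.mem_range]
    exact ⟨(⟨(a, b), h.ab⟩, ⟨(c, d), h.cd⟩), rfl⟩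
  refine (Set.ncard_le_ncard this).trans ?_
  rw [Set.ncard_coe_finset]
  refine Finset.card_image_le.trans (le_of_eq ?_)
  rw [Finset.card_univ, Fintype.card_prod, SimpleGraph.dart_card_eq_twice_card_edges,
    ← SimpleGraph.coe_edgeFinset, Set.ncard_coe_finset]
  ring

/-! ### The labeling of a configuration -/

lemma Config.isOne_label (c : Config n N) (v : Fin n) :
    (c.label v).isOne = true ↔ v = c.x ∨ v = c.y := by
  unfold Config.label
  split_ifs with h1 h2 h3 h4 h5 <;> simp_all [Label.isOne]

/-- The two label patterns, in cyclic order. -/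
def LabelPattern (l₀ l₁ l₂ l₃ : Label) : Prop :=
  (l₀ = .S1 ∧ l₁ = .S2 ∧ l₂ = .S1 ∧ l₃ = .S2) ∨ (l₀ = .R1a ∧ l₁ = .R1b ∧ l₂ = .R2a ∧ l₃ = .R2b)

/-- Normal form behind the arguments about labels: walk around the cycle from x, towards y if the
two are adjacent; the labels then follow one of two fixed patterns. -/
lemma Config.exists_form {c : Config n N} (hc : c.IsConfig G) :
    ∃ v₀ v₁ v₂ v₃, IsCyc G v₀ v₁ v₂ v₃ ∧ c.cycle = cyc v₀ v₁ v₂ v₃ ∧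
      LabelPattern (c.label v₀) (c.label v₁) (c.label v₂) (c.label v₃) ∧ v₀ = c.x ∧
      (c.label v₀ = .S1 → v₂ = c.y) ∧ (c.label v₀ = .R1a → v₁ = c.y) := by
  obtain ⟨hA, hx, hy, hxy⟩ := hc
  have hR : ∀ v w, IsCyc G c.x c.y v w → c.cycle = cyc c.x c.y v w →
      c.label c.x = .R1a ∧ c.label c.y = .R1b ∧ c.label v = .R2a ∧ c.label w = .R2b := by
    intro v w h e
    have hmem : s(c.x, c.y) ∈ c.cycle := by rw [e, mem_cyc]; tauto
    have hw : s(c.x, w) ∈ c.cycle := by rw [e, mk_mem_cyc_iff h]; tauto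
    have hv : s(c.x, v) ∉ c.cycle := by
      rw [e, mk_mem_cyc_iff h]; have := h.bc.ne'; have := h.cd.ne; tauto
    unfold Config.label
    simp only [if_pos hmem, if_pos hw, if_neg hv, if_true, if_neg h.ab.ne', if_neg h.ac.symm,
      if_neg h.bc.ne', if_neg h.da.ne, if_neg h.bd.symm, and_self]
  obtain ⟨b, p, d, h, e⟩ := exists_cyc_of_node hA hx
  rw [e] at hy
  rcases isNodeOf_cyc.1 hy with h0 | h0 | h0 | h0
  · exact absurd h0 hxy.ne'
  · subst h0
    obtain ⟨h1, h2, h3, h4⟩ := hR _ _ h e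
    exact ⟨_, _, _, _, h, e, Or.inr ⟨h1, h2, h3, h4⟩, rfl, by rw [h1]; simp, fun _ => rfl⟩
  · subst h0
    have hmem : s(c.x, c.y) ∉ c.cycle := by
      rw [e, mk_mem_cyc_iff h]; have := h.bc.ne'; have := h.cd.ne; tauto
    have hl : ∀ v, c.label v = if v = c.x ∨ v = c.y then .S1 else .S2 := by
      intro v; unfold Config.label; rw [if_neg hmem]
    refine ⟨_, _, _, _, h, e, Or.inl ⟨?_, ?_, ?_, ?_⟩, rfl, fun _ => rfl, ?_⟩
    · rw [hl, if_pos (Or.inl rfl)]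
    · rw [hl, if_neg (by have := h.ab.ne'; have := h.bc.ne; tauto)]
    · rw [hl, if_pos (Or.inr rfl)]
    · rw [hl, if_neg (by have := h.da.ne; have := h.cd.ne'; tauto)]
    · rw [hl, if_pos (Or.inl rfl)]; simp
  · subst h0
    have e' : c.cycle = cyc c.x c.y p b := by rw [e, ← cyc_rev]
    obtain ⟨h1, h2, h3, h4⟩ := hR _ _ h.rev e'
    exact ⟨_, _, _, _, h.rev, e', Or.inr ⟨h1, h2, h3, h4⟩, rfl, by rw [h1]; simp, fun _ => rfl⟩

/-- Whether nodes with the given labels are adjacent in the cycle of a configuration. -/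
def adjLabel : Label → Label → Bool
  | .S1, .S2 | .S2, .S1 | .R1a, .R1b | .R1b, .R1a | .R1b, .R2a | .R2a, .R1b
  | .R2a, .R2b | .R2b, .R2a | .R2b, .R1a | .R1a, .R2b => true
  | _, _ => false

/-- Labels alone decide adjacency in the cycle, so configurations that share labelled nodes also
share the substructure on these nodes. -/
lemma Config.mem_cycle_iff {c : Config n N} (hc : c.IsConfig G) {u v : Fin n}
    (hu : IsNodeOf c.cycle u) (hv : IsNodeOf c.cycle v) (huv : u ≠ v) :
    s(u, v) ∈ c.cycle ↔ adjLabel (c.label u) (c.label v) = true := by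
  obtain ⟨v₀, v₁, v₂, v₃, h, e, hl, -⟩ := c.exists_form hc
  have i0 := fun v => mk_mem_cyc_iff (v := v) h
  have i1 := fun v => mk_mem_cyc_iff (v := v) h.rot
  have i2 := fun v => mk_mem_cyc_iff (v := v) h.rot.rot
  have i3 := fun v => mk_mem_cyc_iff (v := v) h.rot.rot.rot
  rw [cyc_rot] at i1
  rw [cyc_rot, cyc_rot] at i2
  rw [cyc_rot, cyc_rot, cyc_rot] at i3
  rw [e] at hu hv ⊢
  have := h.ab.ne; have := h.bc.ne; have := h.cd.ne; have := h.da.ne.symm; have := h.ac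
  have := h.bd
  rcases isNodeOf_cyc.1 hu with rfl | rfl | rfl | rfl <;>
  rcases isNodeOf_cyc.1 hv with rfl | rfl | rfl | rfl <;>
  first
  | exact absurd rfl huv
  | (rcases hl with ⟨l0, l1, l2, l3⟩ | ⟨l0, l1, l2, l3⟩ <;>
      simp only [l0, l1, l2, l3, adjLabel, i0, i1, i2, i3] <;> simp <;> tauto)

/-- For a given cycle and scale only the pair (x, y) of its four nodes is free. -/
lemma card_config_le (𝒜 : Finset (Finset (Sym2 (Fin n)))) (k : Fin N) :
    (filt fun c : Config n N =>
      c.scale = k ∧ c.IsConfig G ∧ c.cycle ∈ 𝒜).card ≤ 16 * 𝒜.card := by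
  set S := filt fun c : Config n N => c.scale = k ∧ c.IsConfig G ∧ c.cycle ∈ 𝒜
  have h1 := Finset.card_le_mul_card_image (f := Config.cycle) S 16 (fun A hA => ?_)
  · refine h1.trans (Nat.mul_le_mul_left _ (Finset.card_le_card fun A hA => ?_))
    obtain ⟨c, hc, rfl⟩ := Finset.mem_image.1 hA
    simp [S] at hc
    exact hc.2.2
  · obtain ⟨c, hc, rfl⟩ := Finset.mem_image.1 hA
    simp only [S, mem_filt] at hc
    have h4 := card_nodeSet hc.2.1.1
    have : (nodeSet c.cycle ×ˢ nodeSet c.cycle).card = 16 := by rw [Finset.card_product, h4]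
    rw [← this]
    refine Finset.card_le_card_of_injOn (fun c' => (c'.x, c'.y)) ?_ ?_
    · intro c' hc'
      simp only [S, Finset.coe_filter, Set.mem_ofPred_eq, mem_filt] at hc'
      simp only [Finset.coe_product, Set.mem_prod, Finset.mem_coe, mem_nodeSet, ← hc'.2]
      exact ⟨hc'.1.2.1.2.1, hc'.1.2.1.2.2.1⟩
    · intro c₁ h₁ c₂ h₂ e
      simp only [S, Finset.coe_filter, Set.mem_ofPred_eq, mem_filt, Prod.mk.injEq] at h₁ h₂ e
      obtain ⟨A1, k1, x1, y1⟩ := c₁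
      obtain ⟨A2, k2, x2, y2⟩ := c₂
      simp_all

end

end

section

/-! ### Scales and thresholds -/

/-- The standing assumptions on the parameters. -/
structure Params.Good (P : Params) : Prop where
  two_le_T : 2 ≤ P.T
  ε_pos : 0 < P.ε
  ε_le : P.ε ≤ 1

namespace Params.Good

variable {P : Params} (hP : P.Good)
include hP

lemma T_pos : 0 < P.T := by have := hP.two_le_T; linarith

lemma one_le_log : 1 ≤ logb 2 P.T := by
  rw [Real.le_logb_iff_rpow_le (by norm_num) hP.T_pos]
  simpa using hP.two_le_T

lemma δ_pos : 0 < P.δ := by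
  have := hP.one_le_log
  have := hP.ε_pos
  unfold Params.δ; positivity

lemma δ_le : P.δ ≤ 1 := by
  have h1 := hP.one_le_log
  have h2 := hP.ε_le
  have h3 : 1 ≤ logb 2 P.T ^ 3 := one_le_pow₀ h1
  unfold Params.δ
  rw [div_le_one (by positivity)]
  linarith

lemma sqrt_pos : 0 < √P.T := Real.sqrt_pos.2 hP.T_pos

lemma sq_sqrt : √P.T * √P.T = P.T := Real.mul_self_sqrt hP.T_pos.le

lemma κ_pos (j : ℤ) : 0 < P.κ j := by
  have := hP.T_pos
  unfold Params.κ; positivity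

/-- Replacing κ by √T/κ is the negation of j. It exchanges the rates of the two types, in accordance
with the convention for negative j. -/
lemma κ_mul_neg (j : ℤ) : P.κ j * P.κ (-j) = √P.T := by
  have h := hP.T_pos
  unfold Params.κ
  rw [zpow_neg]
  have h1 : P.T ^ (1 / 4 : ℝ) * P.T ^ (1 / 4 : ℝ) = √P.T := by
    rw [← Real.rpow_add h, Real.sqrt_eq_rpow]; norm_num
  have h2 : (2 : ℝ) ^ j ≠ 0 := by positivity
  field_simp
  rw [← h1]; ring

lemma κ_mono {i j : ℤ} (h : i ≤ j) : P.κ i ≤ P.κ j := by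
  have := hP.T_pos
  unfold Params.κ
  exact mul_le_mul_of_nonneg_right (zpow_le_zpow_right₀ (by norm_num) h) (by positivity)

lemma κ_zero_sq : P.κ 0 * P.κ 0 = √P.T := by simpa using hP.κ_mul_neg 0

lemma sqrt_le_κ_sq (k : ℕ) : √P.T ≤ P.κ k * P.κ k := by
  rw [← hP.κ_zero_sq]
  have := hP.κ_mono (show (0 : ℤ) ≤ k by omega)
  have := hP.κ_pos 0
  nlinarith

lemma κ_le (k : ℕ) (hk : k < P.numScales) : P.κ k ≤ 2 * √P.T := by
  have hT := hP.T_pos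
  set τ := P.T ^ (1 / 4 : ℝ) with hτ
  have h0 : 0 < τ := by positivity
  have h1 : τ * τ = √P.T := by
    rw [hτ, ← Real.rpow_add hT, Real.sqrt_eq_rpow]; norm_num
  have h2 : (2 : ℝ) ^ k ≤ 2 * τ := by
    unfold Params.numScales at hk
    have hlog : 0 ≤ logb 2 τ := by
      apply Real.logb_nonneg (by norm_num)
      exact Real.one_le_rpow (by have := hP.two_le_T; linarith) (by norm_num)
    have h3 : (k : ℝ) ≤ logb 2 τ + 1 := by
      have := Nat.ceil_lt_add_one hlog
      have h4 : (k : ℝ) ≤ (⌈logb 2 τ⌉₊ : ℝ) := by exact_mod_cast Nat.lt_succ_iff.1 hk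
      linarith
    calc (2 : ℝ) ^ k = (2 : ℝ) ^ (k : ℝ) := (Real.rpow_natCast _ _).symm
      _ ≤ (2 : ℝ) ^ (logb 2 τ + 1) := Real.rpow_le_rpow_of_exponent_le (by norm_num) h3
      _ = 2 * τ := by
        rw [Real.rpow_add (by norm_num), Real.rpow_logb (by norm_num) (by norm_num) h0]
        simp [mul_comm]
  unfold Params.κ
  rw [zpow_natCast, ← hτ, ← h1]
  nlinarith

end Params.Good

/-- The sampling rate, up to the polylogarithmic factor, of a set with label `l`. -/
def Params.base (P : Params) (k : ℤ) (l : Label) : ℝ :=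
  if l.isOne then P.κ k / √P.T else 1 / P.κ k

lemma Params.Good.base_pos {P : Params} (hP : P.Good) (k : ℤ) (l : Label) : 0 < P.base k l := by
  have := hP.sqrt_pos
  have := hP.κ_pos k
  unfold Params.base; split_ifs <;> positivity

lemma Params.Good.base_le_two {P : Params} (hP : P.Good) (k : ℕ) (hk : k < P.numScales)
    (l : Label) : P.base k l ≤ 2 := by
  have h1 := hP.sqrt_pos
  have h2 := hP.κ_le k hk
  have h3 := hP.κ_pos k
  unfold Params.base
  split_ifs
  · rw [div_le_iff₀ h1]; exact h2
  · have h4 := hP.sqrt_le_κ_sq k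
    have h5 : 1 ≤ √P.T := by
      rw [Real.one_le_sqrt]; have := hP.two_le_T; linarith
    rw [div_le_iff₀ h3]
    nlinarith

/-! ### Thresholds as products of rates. -/

section Thresholds

variable {n N : ℕ} {P : Params} (hP : P.Good) (k : Fin N) (ℓ : Fin n → Label)
include hP

/-- In terms of rates all thresholds become T times a product over the nodes, over a power of δ;
this uniform shape replaces the case distinctions by the number of type 1 nodes. -/
lemma threshold_node (v : Fin n) :
    threshold P (.node v) k ℓ = P.T * P.base (k : ℕ) (ℓ v) / P.δ ^ (1.5 : ℝ) := by
  have h1 := hP.sqrt_pos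
  have h2 := hP.κ_pos (k : ℕ)
  have h3 := hP.sq_sqrt
  have h4 : 0 < P.δ ^ (1.5 : ℝ) := Real.rpow_pos_of_pos hP.δ_pos _
  have h5 := hP.T_pos
  cases h : (ℓ v).isOne <;>
    simp [threshold, numOnes, Substructure.nodes, Params.base, h] <;> field_simp
  linarith [Real.sq_sqrt hP.T_pos.le]

lemma threshold_edge (u v : Fin n) :
    threshold P (.edge u v) k ℓ =
      P.T * P.base (k : ℕ) (ℓ u) * P.base (k : ℕ) (ℓ v) / P.δ ^ 2 := by
  have h1 := hP.sqrt_pos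
  have h2 := hP.κ_pos (k : ℕ)
  have h3 := Real.sq_sqrt hP.T_pos.le
  have h4 := hP.δ_pos
  cases h : (ℓ u).isOne <;> cases h' : (ℓ v).isOne <;>
    simp [threshold, numOnes, Substructure.nodes, Params.base, h, h'] <;>
    field_simp <;> linarith

lemma threshold_oppositePair (u v : Fin n) :
    threshold P (.oppositePair u v) k ℓ =
      P.T * P.base (k : ℕ) (ℓ u) * P.base (k : ℕ) (ℓ v) / P.δ ^ 2 :=
  threshold_edge hP k ℓ u v

/-- The condition is needed since the last branch of `threshold` fits only one node of type 1; the
other counts do not occur in configurations, by `numOnes_wedge`. -/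
lemma threshold_wedge (a w b : Fin n)
    (h : numOnes (.wedge a w b) ℓ = 1 ∨ numOnes (.wedge a w b) ℓ = 2) :
    threshold P (.wedge a w b) k ℓ =
      P.T * P.base (k : ℕ) (ℓ a) * P.base (k : ℕ) (ℓ w) * P.base (k : ℕ) (ℓ b) / P.δ := by
  have h1 := hP.sqrt_pos
  have h2 := hP.κ_pos (k : ℕ)
  have h3 := Real.sq_sqrt hP.T_pos.le
  have h4 := hP.δ_pos
  cases ha : (ℓ a).isOne <;> cases hw : (ℓ w).isOne <;> cases hb : (ℓ b).isOne <;>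
    simp [numOnes, Substructure.nodes, ha, hw, hb] at h <;>
    simp [threshold, numOnes, Substructure.nodes, Params.base, ha, hw, hb] <;>
    field_simp <;> linarith

lemma threshold_nonneg (s : Substructure n) : 0 ≤ threshold P s k ℓ := by
  have h1 := hP.sqrt_pos
  have h2 := hP.κ_pos (k : ℕ)
  have h4 := hP.δ_pos
  have h5 := hP.T_pos
  cases s <;> simp only [threshold] <;> split_ifs <;> positivity

end Thresholds

/-! ### Rates around a configuration. -/

section Config

variable {n N : ℕ} {P : Params} {G : SimpleGraph (Fin n)} {c : Config n N}

/-- There are two nodes of each type, and (κ/√T)²(1/κ)² = 1/T. -/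
lemma LabelPattern.base_mul (hP : P.Good) (k : ℤ) {l₀ l₁ l₂ l₃ : Label}
    (h : LabelPattern l₀ l₁ l₂ l₃) :
    P.T * (P.base k l₀ * P.base k l₁ * P.base k l₂ * P.base k l₃) = 1 := by
  have h1 := hP.sqrt_pos
  have h2 := hP.κ_pos k
  have h3 := Real.sq_sqrt hP.T_pos.le
  rcases h with ⟨rfl, rfl, rfl, rfl⟩ | ⟨rfl, rfl, rfl, rfl⟩ <;>
    simp [Params.base, Label.isOne] <;> field_simp <;> linarith

lemma Config.prod_base (hP : P.Good) (hc : c.IsConfig G) (k : ℤ) :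
    P.T * ∏ v ∈ nodeSet c.cycle, P.base k (c.label v) = 1 := by
  obtain ⟨v₀, v₁, v₂, v₃, h, e, hl, -⟩ := c.exists_form hc
  rw [e, prod_nodeSet h]
  exact hl.base_mul hP k

lemma Config.prod_base_cyc (hP : P.Good) (hc : c.IsConfig G) (k : ℤ) {a b d e : Fin n}
    (h : IsCyc G a b d e) (hA : c.cycle = cyc a b d e) :
    P.T * (P.base k (c.label a) * P.base k (c.label b) * P.base k (c.label d) *
      P.base k (c.label e)) = 1 := by
  have := c.prod_base hP hc k
  rwa [hA, prod_nodeSet h] at this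

lemma numOnes_wedge (hc : c.IsConfig G) {a w b : Fin n}
    (h : (Substructure.wedge a w b).In c.cycle) :
    numOnes (.wedge a w b) c.label = 1 ∨ numOnes (.wedge a w b) c.label = 2 := by
  obtain ⟨hab, h1, h2⟩ := h
  obtain ⟨z, hz, e⟩ := exists_cyc_of_wedge hc.1 hab h1 h2
  obtain ⟨-, hx, hy, hxy⟩ := hc
  have key : ∀ v, (c.label v).isOne = decide (v = c.x ∨ v = c.y) := fun v => by
    rw [Bool.eq_iff_iff, c.isOne_label]; simp
  have := hz.ab.ne; have := hz.bc.ne; have := hz.cd.ne; have := hz.da.ne.symm; have := hz.bd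
  rw [e, isNodeOf_cyc] at hx hy
  simp only [numOnes, Substructure.nodes, List.countP_cons, List.countP_nil, key]
  generalize c.x = x at *
  generalize c.y = y at *
  rcases hx with rfl | rfl | rfl | rfl <;> rcases hy with rfl | rfl | rfl | rfl <;>
    simp_all [eq_comm]

end Config

end

section

/-! ### Light configurations and families through common nodes -/

variable {n N : ℕ} {P : Params} {G : SimpleGraph (Fin n)} {c : Config n N}

lemma wedge_in_cyc {a w b z : Fin n} (h : IsCyc G a w b z) :
    (Substructure.wedge a w b).In (cyc a w b z) :=
  ⟨h.ac, by rw [mem_cyc]; tauto, by rw [mem_cyc]; tauto⟩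

lemma heaviness_nonneg (s : Substructure n) : 0 ≤ heaviness G s := by
  unfold heaviness; positivity

lemma threshold_wedge_config (hP : P.Good) (hc : c.IsConfig G) {a w b : Fin n}
    (h : (Substructure.wedge a w b).In c.cycle) :
    threshold P (.wedge a w b) c.scale c.label =
      P.T * P.base (c.scale : ℕ) (c.label a) * P.base (c.scale : ℕ) (c.label w) *
        P.base (c.scale : ℕ) (c.label b) / P.δ :=
  threshold_wedge hP _ _ _ _ _ (numOnes_wedge hc h)

/-- If the wedges of a configuration are light, so are its pairs of opposite nodes. -/
lemma oppositePair_light (hP : P.Good) (hc : c.IsConfig G) {s : ℝ}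
    (hw : WedgesLight P s G c) {u v : Fin n} (h : (Substructure.oppositePair u v).In c.cycle) :
    heaviness G (.oppositePair u v) ≤
      s ^ 2 * threshold P (.oppositePair u v) c.scale c.label := by
  obtain ⟨huv, hu, hv, hn⟩ := h
  obtain ⟨w, z, hz, e⟩ := exists_cyc_of_opposite hc.1 huv hu hv hn
  have i1 : (Substructure.wedge u w v).In c.cycle := by rw [e]; exact wedge_in_cyc hz
  have i2 : (Substructure.wedge u z v).In c.cycle := by
    rw [e, ← cyc_rev]; exact wedge_in_cyc hz.rev
  have h1 := hw _ _ _ i1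
  have h2 := hw _ _ _ i2
  rw [threshold_wedge_config hP hc i1] at h1
  rw [threshold_wedge_config hP hc i2] at h2
  have h3 := heaviness_oppositePair_le hz.ac hz.ab hz.bc
  have h4 := heaviness_wedge hz.ac hz.ab hz.bc
  have h5 := heaviness_wedge hz.ac hz.da.symm hz.cd.symm
  -- Both wedges between u and v have the same heaviness t, so t² is at most the product of the two
  -- wedge bounds. The four rates multiply to 1/T, which leaves s² times the threshold of the pair;
  -- hence the shift s₁² for opposite pairs.
  have h6 : heaviness G (.wedge u z v) = heaviness G (.wedge u w v) := by linarith
  rw [h6] at h2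
  have h7 := c.prod_base_cyc hP hc (c.scale : ℕ) hz e
  have hδ := hP.δ_pos
  have hn0 := heaviness_nonneg (G := G) (.wedge u w v)
  rw [threshold_oppositePair hP]
  have h8 := mul_le_mul h1 h2 hn0 (hn0.trans h1)
  refine h3.trans ((le_of_eq (sq _)).trans (h8.trans (le_of_eq ?_)))
  field_simp
  linear_combination (s ^ 2 * P.T * P.base (c.scale : ℕ) (c.label u) *
    P.base (c.scale : ℕ) (c.label v)) * h7

/-- Opposite pairs drop out by `oppositePair_light`, so the oracle needs no estimate for them. -/
lemma isHeavy_iff (hP : P.Good) (hc : c.IsConfig G) {sh : Fin 3 → ℝ} :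
    IsHeavy P sh G c ↔ ¬ WedgesLight P (sh 0) G c ∨ ¬ EdgesLight P (sh 0) (sh 1) G c ∨
      ∃ v, IsNodeOf c.cycle v ∧ sh 2 * threshold P (.node v) c.scale c.label <
        refinedNode P (sh 0) (sh 1) G v c.scale c.label := by
  constructor
  · rintro ⟨s, hin, hlt⟩
    by_contra hcon
    push Not at hcon
    obtain ⟨h1, h2, h3⟩ := hcon
    cases s with
    | node v => exact absurd (h3 v hin) (not_le.2 hlt)
    | edge u v => exact absurd (h2 u v hin) (not_le.2 hlt)
    | wedge a w b => exact absurd (h1 a w b hin) (not_le.2 hlt)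
    | oppositePair u v => exact absurd (oppositePair_light hP hc h1 hin) (not_le.2 hlt)
  · rintro (h | h | ⟨v, hv, h⟩)
    · unfold WedgesLight at h
      push Not at h
      obtain ⟨a, w, b, hin, h⟩ := h
      exact ⟨.wedge a w b, hin, h⟩
    · unfold EdgesLight at h
      push Not at h
      obtain ⟨u, v, hin, h⟩ := h
      exact ⟨.edge u v, hin, h⟩
    · exact ⟨.node v, hv, h⟩

lemma card_config_le_heaviness (s : Substructure n) (k : Fin N) :
    ((filt fun c : Config n N => c.scale = k ∧ c.IsConfig G ∧ s.In c.cycle).card : ℝ) ≤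
      16 * heaviness G s := by
  have h := card_config_le (G := G) (filt fun A => A ∈ fourCycles G ∧ s.In A) k
  rw [heaviness_eq_card]
  norm_cast
  refine le_trans (Finset.card_le_card fun c hc => ?_) h
  simp only [mem_filt] at hc ⊢
  exact ⟨hc.1, hc.2.1, hc.2.1.1, hc.2.2⟩

/-- Configurations that share the nodes in `V`, with their labels, with `c`. -/
def sharing (G : SimpleGraph (Fin n)) (c : Config n N) (V : Finset (Fin n)) :
    Finset (Config n N) :=
  filt fun c' => c'.scale = c.scale ∧ c'.IsConfig G ∧
    ∀ v ∈ V, IsNodeOf c'.cycle v ∧ c'.label v = c.label v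

lemma mem_cycle_of_sharing (hc : c.IsConfig G) {V : Finset (Fin n)} {c' : Config n N}
    (hc' : c' ∈ sharing G c V) {u v : Fin n} (hu : u ∈ V) (hv : v ∈ V)
    (hu' : IsNodeOf c.cycle u) (hv' : IsNodeOf c.cycle v) (huv : u ≠ v) :
    s(u, v) ∈ c'.cycle ↔ s(u, v) ∈ c.cycle := by
  simp only [sharing, mem_filt] at hc'
  obtain ⟨-, h1, h2⟩ := hc'
  rw [Config.mem_cycle_iff h1 (h2 u hu).1 (h2 v hv).1 huv, Config.mem_cycle_iff hc hu' hv' huv,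
    (h2 u hu).2, (h2 v hv).2]

lemma card_sharing_le_of_in (s : Substructure n) {V : Finset (Fin n)}
    (h : ∀ c' ∈ sharing G c V, s.In c'.cycle) :
    ((sharing G c V).card : ℝ) ≤ 16 * heaviness G s := by
  refine le_trans ?_ (card_config_le_heaviness (N := N) s c.scale)
  norm_cast
  refine Finset.card_le_card fun c' hc' => ?_
  have h1 := h c' hc'
  simp only [sharing, mem_filt] at hc' ⊢
  exact ⟨hc'.1, hc'.2.1, h1⟩

lemma inv_δ_le (hP : P.Good) : 1 / P.δ ≤ 1 / P.δ ^ 2 ∧ 1 ≤ 1 / P.δ ^ 2 := by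
  have h0 := hP.δ_pos
  have h1 := hP.δ_le
  have h2 : P.δ ^ 2 ≤ P.δ := by nlinarith
  exact ⟨one_div_le_one_div_of_le (by positivity) h2,
    by rw [one_le_div (by positivity)]; nlinarith⟩

/-- Four common labelled nodes force the same cycle, and the factor T∏ base is 1 here. -/
lemma card_sharing_all (hP : P.Good) (hc : c.IsConfig G) :
    ((sharing G c (nodeSet c.cycle)).card : ℝ) ≤
      16 * (P.T * ∏ v ∈ nodeSet c.cycle, P.base (c.scale : ℕ) (c.label v)) := by
  rw [c.prod_base hP hc]
  have h := card_config_le (G := G) {c.cycle} c.scale (N := N)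
  rw [Finset.card_singleton] at h
  norm_cast
  refine le_trans (Finset.card_le_card fun c' hc' => ?_) h
  have h2 := fun u v => mem_cycle_of_sharing hc hc' (u := u) (v := v)
  simp only [sharing, mem_filt] at hc' ⊢
  refine ⟨hc'.1, hc'.2.1, Finset.mem_singleton.2 ?_⟩
  symm
  refine Finset.eq_of_subset_of_card_le (fun e he => ?_)
    (by rw [card_fourCycle hc.1, card_fourCycle hc'.2.1.1])
  induction e with
  | _ u v =>
    have h3 := isNodeOf_of_mem he
    exact (h2 u v (by simpa using h3.1) (by simpa using h3.2) h3.1 h3.2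
      (adj_of_mem hc.1 he).ne).2 he

lemma card_sharing_wedge (hP : P.Good) (hc : c.IsConfig G) {s : ℝ} (hw : WedgesLight P s G c)
    {a w b z : Fin n} (h : IsCyc G a w b z) (e : c.cycle = cyc a w b z) :
    ((sharing G c {a, w, b}).card : ℝ) ≤ 16 * s / P.δ *
      (P.T * ∏ v ∈ ({a, w, b} : Finset (Fin n)), P.base (c.scale : ℕ) (c.label v)) := by
  have i1 : (Substructure.wedge a w b).In c.cycle := by rw [e]; exact wedge_in_cyc h
  have n1 := isNodeOf_of_mem i1.2.1
  have n2 := isNodeOf_of_mem i1.2.2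
  refine (card_sharing_le_of_in (.wedge a w b) fun c' hc' => ?_).trans ?_
  · exact ⟨i1.1, (mem_cycle_of_sharing hc hc' (by simp) (by simp) n1.1 n1.2 h.ab.ne).2 i1.2.1,
      (mem_cycle_of_sharing hc hc' (by simp) (by simp) n2.1 n2.2 h.bc.ne).2 i1.2.2⟩
  · have h1 := hw _ _ _ i1
    rw [threshold_wedge_config hP hc i1] at h1
    rw [Finset.prod_insert (by have := h.ab.ne; have := h.ac; simp; tauto),
      Finset.prod_insert (by have := h.bc.ne; simp; tauto), Finset.prod_singleton]
    refine (mul_le_mul_of_nonneg_left h1 (by norm_num)).trans (le_of_eq ?_)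
    ring

lemma card_sharing_opposite (hP : P.Good) (hc : c.IsConfig G) {s : ℝ}
    (hw : WedgesLight P s G c) {u v : Fin n} (h : (Substructure.oppositePair u v).In c.cycle) :
    ((sharing G c {u, v}).card : ℝ) ≤ 16 * s ^ 2 / P.δ ^ 2 *
      (P.T * ∏ v ∈ ({u, v} : Finset (Fin n)), P.base (c.scale : ℕ) (c.label v)) := by
  have h1 := oppositePair_light hP hc hw h
  obtain ⟨huv, hu, hv, hn⟩ := h
  refine (card_sharing_le_of_in (.oppositePair u v) fun c' hc' => ?_).trans ?_
  · refine ⟨huv, ?_, ?_, fun h => hn ?_⟩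
    · exact ((mem_filt.1 hc').2.2 u (by simp)).1
    · exact ((mem_filt.1 hc').2.2 v (by simp)).1
    · exact (mem_cycle_of_sharing hc hc' (by simp) (by simp) hu hv huv).1 h
  · rw [threshold_oppositePair hP] at h1
    rw [Finset.prod_pair huv]
    refine (mul_le_mul_of_nonneg_left h1 (by norm_num)).trans (le_of_eq ?_)
    ring

/-- The number of configurations that share at least three nodes, or two opposite nodes, with a
configuration with light wedges. -/
lemma card_sharing_le (hP : P.Good) (hc : c.IsConfig G) {s : ℝ} (hs : 0 ≤ s) (hs4 : s ≤ 4)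
    (hw : WedgesLight P s G c) {V : Finset (Fin n)} (hV : V ⊆ nodeSet c.cycle)
    (hcard : 2 ≤ V.card) (hadj : ∀ u v, V = {u, v} → u ≠ v → s(u, v) ∉ c.cycle) :
    ((sharing G c V).card : ℝ) ≤ 256 / P.δ ^ 2 *
      (P.T * ∏ v ∈ V, P.base (c.scale : ℕ) (c.label v)) := by
  have hδ := hP.δ_pos
  obtain ⟨hδ1, hδ2⟩ := inv_δ_le hP
  have hpos : 0 ≤ P.T * ∏ v ∈ V, P.base (c.scale : ℕ) (c.label v) :=
    mul_nonneg hP.T_pos.le (Finset.prod_nonneg fun v _ => (hP.base_pos _ _).le)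
  have h4 := card_nodeSet hc.1
  have hle : V.card ≤ 4 := h4 ▸ Finset.card_le_card hV
  -- An opposite pair, a wedge, or the whole cycle. The constant is 256 = 16·4², from s ≤ 4.
  have hcases : V.card = 2 ∨ V.card = 3 ∨ V.card = 4 := by omega
  have hs2 : s ^ 2 ≤ 16 := by nlinarith
  rcases hcases with h | h | h
  · obtain ⟨u, v, huv, rfl⟩ := Finset.card_eq_two.1 h
    refine (card_sharing_opposite hP hc hw ⟨huv, ?_, ?_, hadj u v rfl huv⟩).trans ?_
    · exact mem_nodeSet.1 (hV (by simp))
    · exact mem_nodeSet.1 (hV (by simp))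
    · refine mul_le_mul_of_nonneg_right ?_ hpos
      exact div_le_div_of_nonneg_right (by linarith) (by positivity)
  · obtain ⟨d, hd⟩ := Finset.card_eq_one.1
      (show (nodeSet c.cycle \ V).card = 1 by rw [Finset.card_sdiff_of_subset hV]; omega)
    have hd1 : IsNodeOf c.cycle d := by
      have : d ∈ nodeSet c.cycle \ V := by rw [hd]; simp
      simpa using (Finset.mem_sdiff.1 this).1
    obtain ⟨a, w, b, hcyc, e⟩ := exists_cyc_of_node hc.1 hd1
    have e' : c.cycle = cyc a w b d := by rw [e, ← cyc_rot]
    have hVe : V = {a, w, b} := by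
      have h1 : V = nodeSet c.cycle \ {d} := by
        rw [← hd, Finset.sdiff_sdiff_eq_self hV]
      rw [h1, e, nodeSet_cyc]
      have := hcyc.ab.ne'; have := hcyc.ac.symm; have := hcyc.da.ne
      ext x; simp
      constructor
      · tauto
      · rintro (rfl | rfl | rfl) <;> tauto
    subst hVe
    refine (card_sharing_wedge hP hc hw hcyc.rot e').trans ?_
    refine mul_le_mul_of_nonneg_right ?_ hpos
    have : 16 * s / P.δ ≤ 64 * (1 / P.δ) := by
      rw [mul_one_div]
      exact div_le_div_of_nonneg_right (by linarith) hδ.le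
    have : (0 : ℝ) ≤ 1 / P.δ ^ 2 := by positivity
    have : 256 / P.δ ^ 2 = 256 * (1 / P.δ ^ 2) := by ring
    linarith
  · have hVe : V = nodeSet c.cycle := Finset.eq_of_subset_of_card_le hV (by omega)
    subst hVe
    refine (card_sharing_all hP hc).trans (mul_le_mul_of_nonneg_right ?_ hpos)
    have : 256 / P.δ ^ 2 = 256 * (1 / P.δ ^ 2) := by ring
    linarith

/-- The number of configurations that share at least two nodes with a light configuration. -/
lemma card_sharing_inter_le (hP : P.Good) (hc : c.IsConfig G) {s₁ s₂ : ℝ} (hs1 : 0 ≤ s₁)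
    (hs14 : s₁ ≤ 4) (hs24 : s₂ ≤ 4) (hw : WedgesLight P s₁ G c)
    (he : EdgesLight P s₁ s₂ G c)
    {V : Finset (Fin n)} (hV : V ⊆ nodeSet c.cycle) (hcard : 2 ≤ V.card) :
    (((sharing G c V).filter fun c' => WedgesLight P s₁ G c').card : ℝ) ≤ 256 / P.δ ^ 2 *
      (P.T * ∏ v ∈ V, P.base (c.scale : ℕ) (c.label v)) := by
  by_cases hadj : ∀ u v, V = {u, v} → u ≠ v → s(u, v) ∉ c.cycle
  · refine le_trans ?_ (card_sharing_le hP hc hs1 hs14 hw hV hcard hadj)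
    exact_mod_cast Finset.card_filter_le _ _
  push Not at hadj
  obtain ⟨u, v, rfl, huv, hmem⟩ := hadj
  have hpos : 0 ≤ P.T * ∏ v ∈ ({u, v} : Finset (Fin n)), P.base (c.scale : ℕ) (c.label v) :=
    mul_nonneg hP.T_pos.le (Finset.prod_nonneg fun v _ => (hP.base_pos _ _).le)
  have hδ := hP.δ_pos
  have hn := isNodeOf_of_mem hmem
  have h1 := he u v hmem
  have hthr := threshold_edge hP c.scale c.label u v
  have hfin : 16 * (s₂ * threshold P (.edge u v) c.scale c.label) ≤ 256 / P.δ ^ 2 *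
      (P.T * ∏ v ∈ ({u, v} : Finset (Fin n)), P.base (c.scale : ℕ) (c.label v)) := by
    rw [hthr, Finset.prod_pair huv]
    rw [Finset.prod_pair huv] at hpos
    have : 16 * (s₂ * (P.T * P.base (c.scale : ℕ) (c.label u) * P.base (c.scale : ℕ) (c.label v) /
      P.δ ^ 2)) = (16 * s₂) / P.δ ^ 2 * (P.T * (P.base (c.scale : ℕ) (c.label u) *
        P.base (c.scale : ℕ) (c.label v))) := by ring
    rw [this]
    refine mul_le_mul_of_nonneg_right ?_ hpos
    exact div_le_div_of_nonneg_right (by linarith) (by positivity)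
  refine le_trans ?_ hfin
  have hin : ∀ c' ∈ sharing G c {u, v}, s(u, v) ∈ c'.cycle := fun c' hc' =>
    (mem_cycle_of_sharing hc hc' (by simp) (by simp) hn.1 hn.2 huv).2 hmem
  unfold refinedEdge at h1
  -- For two labels of type 2 the refined heaviness counts only configurations with light wedges,
  -- hence the filter in the statement. Otherwise it is the true heaviness, with at most 16
  -- configurations per cycle.
  split_ifs at h1 with h0
  · have h2 : (((sharing G c {u, v}).filter fun c' => WedgesLight P s₁ G c').card : ℝ) ≤
        s₂ * threshold P (.edge u v) c.scale c.label := by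
      refine le_trans ?_ h1
      rw [ncard_eq_card_filt]
      norm_cast
      refine Finset.card_le_card fun c' hc' => ?_
      rw [Finset.mem_filter] at hc'
      have h3 := hin c' hc'.1
      have h4 := mem_filt.1 hc'.1
      rw [mem_filt]
      refine ⟨h4.2.1, ⟨h4.1, h3, ?_⟩, hc'.2⟩
      intro x hx
      simp only [Substructure.nodes, List.mem_cons, List.not_mem_nil, or_false] at hx
      exact (h4.2.2 x (by simpa using hx)).2.symm
    have : 0 ≤ threshold P (.edge u v) c.scale c.label := threshold_nonneg hP _ _ _
    linarith [mul_le_mul_of_nonneg_right hs24 this]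
  · refine le_trans (b := ((sharing G c {u, v}).card : ℝ))
      (by exact_mod_cast Finset.card_filter_le _ _) ?_
    exact (card_sharing_le_of_in (.edge u v) hin).trans (by linarith)

end

section

/-! ### Rescaled configurations -/

variable {n N : ℕ} {P : Params} {G : SimpleGraph (Fin n)} {c : Config n N}

/-- Local minimality with respect to an arbitrary notion of heaviness. -/
def LocMin (P : Params) (Hv : Config n N → Prop) (c : Config n N) : Prop :=
  let κ := P.κ (c.scale : ℕ)
  (P.κ 0 / P.δ ^ 2 ≤ κ →
    ∀ j c', c.Rescaled j c' → P.δ ^ 2 * κ ≤ P.κ j → P.κ j ≤ κ / 2 → Hv c') ∧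
  (κ = P.κ 0 →
    ∀ u w, IsNodeOf c.cycle u → IsNodeOf c.cycle w → u < w →
      toLex (c.x, c.y) ≤ toLex (u, w)) ∧
  (P.κ 0 < κ → κ < P.κ 0 / P.δ ^ 2 →
    (∀ j c', c.Rescaled j c' → max (P.δ ^ 2 * κ) (2 * √P.T / κ) ≤ P.κ j → P.κ j ≤ κ / 2 →
      Hv c') ∧
    ∀ c', c.Rescaled (-((c.scale : ℕ) : ℤ)) c' →
      Hv c' ∨ (¬ Hv c' ∧ toLex (c.x, c.y) < toLex (c'.x, c'.y)))

/-- The configurations whose heaviness matters for whether `c` is LLM. -/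
def Relevant (P : Params) (c c' : Config n N) : Prop :=
  ∃ j : ℤ, c.Rescaled j c' ∧ P.δ ^ 4 * P.κ (c.scale : ℕ) ≤ P.κ j ∧ P.κ j ≤ P.κ (c.scale : ℕ)

lemma Relevant.refl (hP : P.Good) (c : Config n N) : Relevant P c c := by
  refine ⟨(c.scale : ℕ), ⟨rfl, Or.inl ⟨by omega, rfl, rfl, rfl⟩⟩, ?_, le_rfl⟩
  have h1 := hP.δ_pos
  have h2 : P.δ ^ 4 ≤ 1 := pow_le_one₀ h1.le hP.δ_le
  have h3 := hP.κ_pos (c.scale : ℕ)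
  nlinarith

/-- Most comparisons have κ' ≥ δ²κ. The exchange with √T/κ occurs only for κ < T^{1/4}/δ², where
√T/κ ≥ δ⁴κ; this is the origin of the fourth power in `Relevant`. -/
lemma locMin_congr (hP : P.Good) {Hv Hv' : Config n N → Prop}
    (h : ∀ c', Relevant P c c' → (Hv c' ↔ Hv' c')) : LocMin P Hv c ↔ LocMin P Hv' c := by
  have hδ := hP.δ_pos
  have hδ1 := hP.δ_le
  have hδ2 : P.δ ^ 2 ≤ 1 := pow_le_one₀ hδ.le hδ1
  have hκ := hP.κ_pos (c.scale : ℕ)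
  have hδ4 : P.δ ^ 4 ≤ P.δ ^ 2 := pow_le_pow_of_le_one hδ.le hδ1 (by norm_num)
  have h1 : ∀ j c', c.Rescaled j c' → P.δ ^ 2 * P.κ (c.scale : ℕ) ≤ P.κ j →
      P.κ j ≤ P.κ (c.scale : ℕ) / 2 → (Hv c' ↔ Hv' c') := fun j c' hr hl hu =>
    h c' ⟨j, hr, (mul_le_mul_of_nonneg_right hδ4 hκ.le).trans hl, by linarith⟩
  have h2 : ∀ c', P.κ 0 < P.κ (c.scale : ℕ) → P.κ (c.scale : ℕ) < P.κ 0 / P.δ ^ 2 →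
      c.Rescaled (-((c.scale : ℕ) : ℤ)) c' → (Hv c' ↔ Hv' c') := by
    intro c' hlo hhi hr
    refine h c' ⟨_, hr, ?_, hP.κ_mono (by omega)⟩
    have e1 := hP.κ_mul_neg (c.scale : ℕ)
    rw [← hP.κ_zero_sq] at e1
    have h0 := hP.κ_pos 0
    rw [lt_div_iff₀ (by positivity)] at hhi
    have e2 : P.δ ^ 4 * P.κ (c.scale : ℕ) * P.κ (c.scale : ℕ) ≤ P.κ 0 * P.κ 0 := by
      have : P.δ ^ 4 * P.κ (c.scale : ℕ) * P.κ (c.scale : ℕ) =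
        (P.κ (c.scale : ℕ) * P.δ ^ 2) * (P.κ (c.scale : ℕ) * P.δ ^ 2) := by ring
      rw [this]
      exact mul_le_mul hhi.le hhi.le (by positivity) h0.le
    rw [← e1] at e2
    nlinarith
  unfold LocMin
  simp only
  refine and_congr ?_ (and_congr Iff.rfl ?_)
  · refine imp_congr_right fun _ => forall_congr' fun j => forall_congr' fun c' =>
      imp_congr_right fun hr => imp_congr_right fun hl => imp_congr_right fun hu => h1 j c' hr hl hu
  · refine imp_congr_right fun hlo => imp_congr_right fun hhi => and_congr ?_ ?_
    · refine forall_congr' fun j => forall_congr' fun c' => imp_congr_right fun hr =>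
        imp_congr_right fun hl => imp_congr_right fun hu =>
          h1 j c' hr ((le_max_left _ _).trans hl) hu
    · refine forall_congr' fun c' => imp_congr_right fun hr => ?_
      rw [h2 c' hlo hhi hr]

lemma Relevant.isConfig {c' : Config n N} (h : Relevant P c c') (hc : c.IsConfig G) :
    c'.IsConfig G := by
  obtain ⟨j, ⟨hA, ⟨-, -, hx, hy⟩ | ⟨-, -, hxy, hn⟩⟩, -, -⟩ := h
  · unfold Config.IsConfig
    rw [hA, hx, hy]; exact hc
  · refine ⟨hA ▸ hc.1, ?_, ?_, hxy⟩
    · rw [hA]; exact ((hn _).1 (Or.inl rfl)).1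
    · rw [hA]; exact ((hn _).1 (Or.inr rfl)).1

lemma Relevant.cycle_eq {c' : Config n N} (h : Relevant P c c') : c'.cycle = c.cycle := by
  obtain ⟨j, ⟨hA, -⟩, -⟩ := h; exact hA

/-- For j ≥ 0 the types stay and κ falls by a factor of at least δ⁴. For j < 0 the types are
exchanged, and `κ_mul_neg` turns the rate of the exchanged type at −j into that of the original type
at j. -/
lemma Relevant.base_le (hP : P.Good) {c' : Config n N} (h : Relevant P c c') {v : Fin n}
    (hv : IsNodeOf c.cycle v) : P.base (c.scale : ℕ) (c.label v) ≤
      1 / P.δ ^ 4 * P.base (c'.scale : ℕ) (c'.label v) := by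
  obtain ⟨j, ⟨hA, hcase⟩, hl, hu⟩ := h
  have hδ := hP.δ_pos
  have hδ4 : P.δ ^ 4 ≤ 1 := pow_le_one₀ hδ.le hP.δ_le
  have hδ' : 1 ≤ 1 / P.δ ^ 4 := by rw [one_le_div (by positivity)]; exact hδ4
  have hκ := hP.κ_pos (c.scale : ℕ)
  have hκj := hP.κ_pos j
  have hs := hP.sqrt_pos
  have key1 : P.κ (c.scale : ℕ) / √P.T ≤ 1 / P.δ ^ 4 * (P.κ j / √P.T) := by
    rw [one_div_mul_eq_div, le_div_iff₀ (by positivity), div_mul_eq_mul_div]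
    exact div_le_div_of_nonneg_right (by linarith) hs.le
  have key2 : 1 / P.κ (c.scale : ℕ) ≤ 1 / P.δ ^ 4 * (1 / P.κ j) := by
    have h1 : 1 / P.κ (c.scale : ℕ) ≤ 1 / P.κ j := one_div_le_one_div_of_le hκj hu
    have h2 : 0 < 1 / P.κ j := by positivity
    nlinarith
  rcases hcase with ⟨hj, hk, hx, hy⟩ | ⟨hj, hk, hxy, hn⟩
  · have hone : (c'.label v).isOne = (c.label v).isOne := by
      rw [Bool.eq_iff_iff, Config.isOne_label, Config.isOne_label, hx, hy]
    have hk' : (((c'.scale : ℕ) : ℤ)) = j := hk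
    unfold Params.base
    rw [hone, hk']
    split_ifs
    exacts [key1, key2]
  · have hone : (c'.label v).isOne = ! (c.label v).isOne := by
      rw [Bool.eq_iff_iff, Config.isOne_label, hn, Bool.not_eq_true', ← Bool.not_eq_true,
        Config.isOne_label]
      tauto
    have e1 := hP.κ_mul_neg j
    have e2 := hP.κ_pos (-j)
    unfold Params.base
    rw [hone, hk]
    cases (c.label v).isOne
    · simp only [Bool.not_false, if_true, Bool.false_eq_true, if_false]
      have : P.κ (-j) / √P.T = 1 / P.κ j := by
        rw [← e1]; field_simp
      rw [this]; exact key2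
    · simp only [Bool.not_true, if_true, Bool.false_eq_true, if_false]
      have : 1 / P.κ (-j) = P.κ j / √P.T := by
        rw [← e1]; field_simp
      rw [this]; exact key1

/-! ### Sampled configurations -/

/-- Membership of vertices in sampled sets indexed by scale and label. -/
abbrev SetCoins (n N : ℕ) : Type := Fin N × Label × Fin n → Bool

/-- All nodes of `c` are in the sets prescribed by their labels. -/
def AllIn (r : SetCoins n N) (c : Config n N) : Prop :=
  ∀ v, IsNodeOf c.cycle v → r (c.scale, c.label v, v) = true

/-- The configuration is sampled by its node `v` being in a set `(k, l)` of `r` of comparable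
rate, and all others nodes being in the sets of `Z`. -/
def SampledAt (P : Params) (r Z : SetCoins n N) (c : Config n N) (v : Fin n) (k : Fin N)
    (l : Label) : Prop :=
  IsNodeOf c.cycle v ∧ r (k, l, v) = true ∧
    P.base (k : ℕ) l ≤ 1 / P.δ ^ 4 * P.base (c.scale : ℕ) (c.label v) ∧
    ∀ u, IsNodeOf c.cycle u → u ≠ v → Z (c.scale, c.label u, u) = true

/-- The configurations whose lightness the oracle keeps track of. -/
def Sampled (P : Params) (r Z : SetCoins n N) (c : Config n N) : Prop :=
  (∃ q : Config n N, q.IsConfig ⊤ ∧ AllIn r q ∧ Relevant P q c) ∨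
    ∃ v k l, SampledAt P r Z c v k l

/-- Every node of a tracked configuration lies in a sampled set of comparable rate: in a set of the
query it is relevant to, or in r for the anchor and in Z for the others. -/
lemma Sampled.exists_src (hP : P.Good) {r Z : SetCoins n N} (h : Sampled P r Z c) {v : Fin n}
    (hv : IsNodeOf c.cycle v) : ∃ k l, (r (k, l, v) = true ∨ Z (k, l, v) = true) ∧
      P.base (k : ℕ) l ≤ 1 / P.δ ^ 4 * P.base (c.scale : ℕ) (c.label v) := by
  rcases h with ⟨q, hq, hin, hrel⟩ | ⟨u, k, l, hu, hr, hb, hZ⟩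
  · have hv' : IsNodeOf q.cycle v := hrel.cycle_eq ▸ hv
    exact ⟨_, _, Or.inl (hin v hv'), hrel.base_le hP hv'⟩
  · by_cases huv : v = u
    · subst huv; exact ⟨k, l, Or.inl hr, hb⟩
    · refine ⟨_, _, Or.inr (hZ v hv huv), ?_⟩
      have hδ := hP.δ_pos
      have hδ' : 1 ≤ 1 / P.δ ^ 4 := by
        rw [one_le_div (by positivity)]; exact pow_le_one₀ hδ.le hP.δ_le
      have := hP.base_pos (c.scale : ℕ) (c.label v)
      nlinarith

/-- All edges of a configuration but one have rate at most `1 / √T`. -/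
lemma exists_edge_base_le (hP : P.Good) (hc : c.IsConfig G) :
    ∃ e₀ ∈ c.cycle, ∀ u v, s(u, v) ∈ c.cycle → s(u, v) ≠ e₀ →
      P.base (c.scale : ℕ) (c.label u) * P.base (c.scale : ℕ) (c.label v) * √P.T ≤ 1 := by
  have hs := hP.sqrt_pos
  have hκ := hP.κ_pos (c.scale : ℕ)
  have hκ2 := hP.sqrt_le_κ_sq c.scale
  -- One node of each type gives exactly 1/√T, two nodes of type 2 give 1/κ² ≤ 1/√T. Only an edge xy
  -- between the nodes of type 1 is exempt; if x and y are opposite, any edge may be named as the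
  -- exception.
  have key : ∀ u v, ¬ ((c.label u).isOne = true ∧ (c.label v).isOne = true) →
      P.base (c.scale : ℕ) (c.label u) * P.base (c.scale : ℕ) (c.label v) * √P.T ≤ 1 := by
    intro u v h
    unfold Params.base
    cases h1 : (c.label u).isOne <;> cases h2 : (c.label v).isOne <;> simp [h1, h2] at h ⊢
    · rw [← mul_inv, inv_mul_le_iff₀ (by positivity)]; linarith
    · exact le_of_eq (by field_simp)
    · exact le_of_eq (by field_simp)
  have hxy : ∀ u v, s(u, v) ∈ c.cycle →
      ((c.label u).isOne = true ∧ (c.label v).isOne = true) → s(u, v) = s(c.x, c.y) := by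
    intro u v huv h
    have hne := (adj_of_mem hc.1 huv).ne
    rw [Config.isOne_label, Config.isOne_label] at h
    rcases h with ⟨rfl | rfl, rfl | rfl⟩
    · exact absurd rfl hne
    · rfl
    · exact Sym2.eq_swap
    · exact absurd rfl hne
  by_cases h : s(c.x, c.y) ∈ c.cycle
  · exact ⟨_, h, fun u v huv hne => key u v fun hone => hne (hxy u v huv hone)⟩
  · obtain ⟨e, he⟩ : c.cycle.Nonempty := by
      rw [← Finset.card_pos, card_fourCycle hc.1]; norm_num
    exact ⟨e, he, fun u v huv _ => key u v fun hone => h (hxy u v huv hone ▸ huv)⟩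

lemma isConfig_mono {H : SimpleGraph (Fin n)} (h : c.IsConfig G)
    (hH : ∀ u v, s(u, v) ∈ c.cycle → H.Adj u v) : c.IsConfig H := by
  refine ⟨?_, h.2⟩
  obtain ⟨a, b, d, e, hc, hA⟩ := mem_fourCycles_iff.1 h.1
  rw [hA] at hH ⊢
  refine cyc_mem ⟨hH _ _ ?_, hH _ _ ?_, hH _ _ ?_, hH _ _ ?_, hc.ac, hc.bd⟩ <;> rw [mem_cyc] <;>
    tauto

end

section

/-! ### The edges remembered by the oracle -/

/-- All parameters and random choices of the oracle. -/
structure Env (n N : ℕ) where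
  P : Params
  MZ : ℝ
  MY : ℝ
  MF : ℝ
  cap : ℕ
  s : Fin 3 → ℝ
  r : SetCoins n N
  Z : SetCoins n N
  Y : SetCoins n N
  F : Fin n × Fin n → Bool

namespace Env

variable {n N : ℕ} (V : Env n N)

/-- The sources of sampled vertices. -/
def src : Fin 3 → SetCoins n N := ![V.r, V.Z, V.Y]

/-- Both vertices are sampled, in sets whose rates have a product of at most `δ⁻⁸ / √T`. -/
def Near (a b : Fin n) : Prop :=
  ∃ i i' k k' l l', V.src i (k, l, a) = true ∧ V.src i' (k', l', b) = true ∧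
    V.P.base (k : ℕ) l * V.P.base (k' : ℕ) l' * √V.P.T ≤ 1 / V.P.δ ^ 8

/-- The edges remembered in the first pass. -/
def first : Finset (Sym2 (Fin n)) :=
  filt fun e => ∃ a b, e = s(a, b) ∧ (V.Near a b ∨ V.F (a, b) = true)

/-- The edges that complete a sampled configuration. -/
def second (S : Finset (Sym2 (Fin n))) : Finset (Sym2 (Fin n)) :=
  filt fun e => ∃ c : Config n N, c.IsConfig ⊤ ∧ Sampled V.P V.r V.Z c ∧ e ∈ c.cycle ∧
    ∀ e' ∈ c.cycle, e' ≠ e → e' ∈ S ∩ V.first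

/-- The sampled configurations found in the first two passes. -/
def found (S : Finset (Sym2 (Fin n))) : Finset (Config n N) :=
  filt fun c => c.IsConfig ⊤ ∧ Sampled V.P V.r V.Z c ∧
    ∀ e ∈ c.cycle, e ∈ S ∧ (e ∈ V.first ∨ e ∈ V.second S)

/-- End points of edges remembered in the first pass. -/
def touched (S : Finset (Sym2 (Fin n))) : Finset (Fin n) :=
  filt fun b => ∃ e ∈ S ∩ V.first, b ∈ e

/-- The edges from `b` to the sampled neighbours of a node `a` of a configuration. -/
def group (S : Finset (Sym2 (Fin n))) (g : Config n N × Fin n × Label × Fin n) :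
    Finset (Sym2 (Fin n)) :=
  filt fun e => ∃ z, e = s(g.2.2.2, z) ∧ V.Y (g.1.scale, g.2.2.1, z) = true ∧
    s(g.2.1, z) ∈ S ∩ V.first

/-- The index set of the groups. -/
def groups (S : Finset (Sym2 (Fin n))) : Finset (Config n N × Fin n × Label × Fin n) :=
  filt fun g => g.1 ∈ V.found S ∧ IsNodeOf g.1.cycle g.2.1 ∧ g.2.2.2 ∈ V.touched S

/-- The edges between nodes of found configurations and vertices touched in the first pass. -/
def links (S : Finset (Sym2 (Fin n))) : Finset (Sym2 (Fin n)) :=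
  filt fun e => ∃ g ∈ V.groups S, e = s(g.2.1, g.2.2.2)

/-- The rule according to which edges are remembered in the three passes. -/
def keep (i : Fin 3) (S : Finset (Sym2 (Fin n))) (e : Sym2 (Fin n)) : Prop :=
  if i = 0 then e ∈ V.first
  else if i = 1 then e ∈ V.second S
  else e ∈ V.links S ∨ ∃ g ∈ V.groups S, e ∈ V.group S g ∧ (S ∩ V.group S g).card < V.cap

lemma groups_congr {S S' : Finset (Sym2 (Fin n))} (h1 : S ∩ V.first = S' ∩ V.first)
    (h2 : V.found S = V.found S') : V.groups S = V.groups S' := by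
  unfold groups touched; rw [h1, h2]

/-- Each found configuration has 4 nodes, there are 6 labels, and every first-pass edge touches 2
vertices. -/
lemma card_groups_le (S : Finset (Sym2 (Fin n))) (G : SimpleGraph (Fin n))
    (hG : ∀ c ∈ V.found S, c.IsConfig G) :
    (V.groups S).card ≤ (V.found S).card * (4 * (6 * (2 * (S ∩ V.first).card))) := by
  have ht : (V.touched S).card ≤ (S ∩ V.first).card * 2 := by
    have : V.touched S ⊆ (S ∩ V.first).biUnion fun e => e.toFinset := by
      intro b hb
      simp only [touched, mem_filt] at hb
      obtain ⟨e, he, hbe⟩ := hb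
      exact Finset.mem_biUnion.2 ⟨e, he, by simpa using hbe⟩
    refine (Finset.card_le_card this).trans (Finset.card_biUnion_le_card_mul _ _ _ fun e _ => ?_)
    induction e with
    | _ u v =>
      refine (Finset.card_le_card (t := {u, v}) fun x hx => ?_).trans Finset.card_le_two
      simpa using hx
  have h : V.groups S ⊆ (V.found S).biUnion fun c =>
      {c} ×ˢ (nodeSet c.cycle ×ˢ ((Finset.univ : Finset Label) ×ˢ V.touched S)) := by
    intro g hg
    simp only [groups, mem_filt] at hg
    refine Finset.mem_biUnion.2 ⟨g.1, hg.1, ?_⟩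
    simp [hg.2.1, hg.2.2]
  refine (Finset.card_le_card h).trans (Finset.card_biUnion_le_card_mul _ _ _ fun c hc => ?_)
  rw [Finset.card_product, Finset.card_product, Finset.card_product, card_nodeSet (hG c hc).1,
    Finset.card_singleton, one_mul]
  have h6 : (Finset.univ : Finset Label).card = 6 := rfl
  rw [h6]
  omega

lemma src_zero {x} (h : V.r x = true) : V.src 0 x = true := h
lemma src_one {x} (h : V.Z x = true) : V.src 1 x = true := h
lemma src_two {x} (h : V.Y x = true) : V.src 2 x = true := h

/-- A node of a sampled configuration is sampled at a comparable rate. -/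
lemma exists_src_of_sampled (hP : V.P.Good) {c : Config n N} (h : Sampled V.P V.r V.Z c)
    {v : Fin n} (hv : IsNodeOf c.cycle v) : ∃ i k l, V.src i (k, l, v) = true ∧
      V.P.base (k : ℕ) l ≤ 1 / V.P.δ ^ 4 * V.P.base (c.scale : ℕ) (c.label v) := by
  obtain ⟨k, l, h1 | h1, h2⟩ := h.exists_src hP hv
  · exact ⟨0, k, l, V.src_zero h1, h2⟩
  · exact ⟨1, k, l, V.src_one h1, h2⟩

/-- Each end loses a factor δ⁻⁴ against its rate in c, which explains the δ⁻⁸ in `Near`. -/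
lemma near_of_sampled (hP : V.P.Good) {c : Config n N} (h : Sampled V.P V.r V.Z c) {u v : Fin n}
    (hu : IsNodeOf c.cycle u) (hv : IsNodeOf c.cycle v)
    (hb : V.P.base (c.scale : ℕ) (c.label u) * V.P.base (c.scale : ℕ) (c.label v) * √V.P.T ≤ 1) :
    V.Near u v := by
  obtain ⟨i, k, l, h1, h2⟩ := V.exists_src_of_sampled hP h hu
  obtain ⟨i', k', l', h1', h2'⟩ := V.exists_src_of_sampled hP h hv
  refine ⟨i, i', k, k', l, l', h1, h1', ?_⟩
  have hδ := hP.δ_pos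
  have h3 := mul_le_mul h2 h2' (hP.base_pos _ _).le ((hP.base_pos _ _).le.trans h2)
  refine (mul_le_mul_of_nonneg_right h3 (Real.sqrt_nonneg _)).trans ?_
  have : 1 / V.P.δ ^ 4 * V.P.base (c.scale : ℕ) (c.label u) *
      (1 / V.P.δ ^ 4 * V.P.base (c.scale : ℕ) (c.label v)) * √V.P.T = 1 / V.P.δ ^ 8 *
      (V.P.base (c.scale : ℕ) (c.label u) * V.P.base (c.scale : ℕ) (c.label v) * √V.P.T) := by
    field_simp
  rw [this]
  exact mul_le_of_le_one_right (by positivity) hb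

lemma near_of_probe (hP : V.P.Good) {c : Config n N} (h : Sampled V.P V.r V.Z c) {u z : Fin n}
    (hu : IsNodeOf c.cycle u) {l : Label} (hz : V.Y (c.scale, l, z) = true)
    (hb : V.P.base (c.scale : ℕ) (c.label u) * V.P.base (c.scale : ℕ) l * √V.P.T ≤ 1) :
    V.Near u z := by
  obtain ⟨i, k, l', h1, h2⟩ := V.exists_src_of_sampled hP h hu
  refine ⟨i, 2, k, c.scale, l', l, h1, V.src_two hz, ?_⟩
  have hδ := hP.δ_pos
  have h3 := mul_le_mul_of_nonneg_right h2 (hP.base_pos (c.scale : ℕ) l).le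
  refine (mul_le_mul_of_nonneg_right h3 (Real.sqrt_nonneg _)).trans ?_
  have h4 : 1 / V.P.δ ^ 4 ≤ 1 / V.P.δ ^ 8 :=
    one_div_le_one_div_of_le (by positivity) (pow_le_pow_of_le_one hδ.le hP.δ_le (by norm_num))
  have : 1 / V.P.δ ^ 4 * V.P.base (c.scale : ℕ) (c.label u) * V.P.base (c.scale : ℕ) l *
      √V.P.T = 1 / V.P.δ ^ 4 *
      (V.P.base (c.scale : ℕ) (c.label u) * V.P.base (c.scale : ℕ) l * √V.P.T) := by ring
  rw [this]
  exact (mul_le_of_le_one_right (by positivity) hb).trans h4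

lemma mk_mem_first {a b : Fin n} (h : V.Near a b) : s(a, b) ∈ V.first :=
  mem_filt.2 ⟨a, b, rfl, Or.inl h⟩

/-- The edge set of `G` as a finite set. -/
def _root_.FourCycleStream.edgesOf {n : ℕ} (G : SimpleGraph (Fin n)) : Finset (Sym2 (Fin n)) :=
  filt fun e => e ∈ G.edgeSet

/-- The sampled configurations of `G`. -/
def pop (G : SimpleGraph (Fin n)) : Finset (Config n N) :=
  filt fun c => c.IsConfig G ∧ Sampled V.P V.r V.Z c

lemma cycle_subset_edgesOf {G : SimpleGraph (Fin n)} {c : Config n N} (hc : c.IsConfig G) :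
    c.cycle ⊆ edgesOf G := by
  intro e he
  induction e with
  | _ u v => exact mem_filt.2 (adj_of_mem hc.1 he)

lemma isConfig_top {G : SimpleGraph (Fin n)} {c : Config n N} (hc : c.IsConfig G) :
    c.IsConfig ⊤ := isConfig_mono hc fun _ _ h => (adj_of_mem hc.1 h).ne

lemma isConfig_of_subset {G : SimpleGraph (Fin n)} {c : Config n N} (hc : c.IsConfig ⊤)
    (h : c.cycle ⊆ edgesOf G) : c.IsConfig G :=
  isConfig_mono hc fun _ _ he => (mem_filt (p := fun e => e ∈ G.edgeSet)).1 (h he)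

/-- What the memory `S` contains after the three passes. -/
structure MemSpec (G : SimpleGraph (Fin n)) (S : Finset (Sym2 (Fin n))) : Prop where
  subset : S ⊆ edgesOf G
  first_subset : edgesOf G ∩ V.first ⊆ S
  cycle_subset : ∀ c ∈ V.pop G, c.cycle ⊆ S
  link : ∀ c ∈ V.pop G, ∀ a b, IsNodeOf c.cycle a → b ∈ V.touched (edgesOf G) → G.Adj a b →
    s(a, b) ∈ S
  grp : ∀ c ∈ V.pop G, ∀ a l b, IsNodeOf c.cycle a → b ∈ V.touched (edgesOf G) →
    ∀ e ∈ V.group (edgesOf G) (c, a, l, b), e ∈ edgesOf G → e ∉ S →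
      V.cap ≤ (S ∩ V.group (edgesOf G) (c, a, l, b)).card
  card_le : S.card ≤ (edgesOf G ∩ V.first).card + 4 * (V.pop G).card +
    (V.pop G).card * (4 * (6 * (2 * (edgesOf G ∩ V.first).card))) * (1 + V.cap)

lemma second_congr {S S' : Finset (Sym2 (Fin n))} (h : S ∩ V.first = S' ∩ V.first) :
    V.second S = V.second S' := by unfold second; rw [h]

/-- A single growing set suffices: the rules see it through its intersection with `first`, frozen
after the first pass, and through `found`, frozen after the second. Apart from the cap, each pass
therefore acts by a fixed rule. -/
lemma memSpec (hP : V.P.Good) (G : SimpleGraph (Fin n)) (stream : Fin 3 → List (Sym2 (Fin n)))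
    (hs : ∀ i, IsEdgeStream G (stream i)) :
    V.MemSpec G (memSet V.keep stream 3) := by
  set E := edgesOf G
  have hst : ∀ i, (stream i).toFinset = E := by
    intro i; ext e; simp [E, edgesOf, (hs i).2 e]
  set M := E ∩ V.first with hM
  have hME : M ⊆ E := Finset.inter_subset_left
  have inter_first : ∀ S, M ⊆ S → S ⊆ E → S ∩ V.first = M := fun S h1 h2 =>
    (Finset.inter_subset_inter_right h2).antisymm
      (Finset.subset_inter h1 Finset.inter_subset_right)
  have hEM : E ∩ V.first = M := rfl
  have mem_l : ∀ {i e}, e ∈ stream i ↔ e ∈ E := by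
    intro i e; rw [← List.mem_toFinset, hst]
  -- first pass
  have p1 : memSet V.keep stream 1 = M := by
    have := foldl_keepStep_eq (V.keep 0) (fun e => e ∈ V.first) ∅ (stream 0)
      (fun S e _ _ _ => by simp [keep])
    rw [hst] at this
    simp only [memSet]
    rw [dif_pos (by norm_num)]
    refine this.trans ?_
    ext e; simp [hM]
  -- second pass
  set M2 := M ∪ E.filter fun e => e ∈ V.second E with hM2
  have hM2E : M2 ⊆ E := Finset.union_subset hME (Finset.filter_subset _ _)
  have p2 : memSet V.keep stream 2 = M2 := by
    have := foldl_keepStep_eq (V.keep 1) (fun e => e ∈ V.second E) M (stream 1)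
      (fun S e h1 h2 _ => by
        rw [hst] at h2
        have h3 : S ⊆ E := h2.trans (Finset.union_subset hME (Finset.Subset.refl _))
        simp only [keep]
        rw [if_neg (by decide), if_pos trivial,
          V.second_congr ((inter_first S h1 h3).trans hEM.symm)])
    rw [hst] at this
    rw [show memSet V.keep stream 2 = (stream 1).foldl (keepStep (V.keep 1))
      (memSet V.keep stream 1) from rfl, p1, hM2]
    convert this using 2
    ext e; simp only [Finset.mem_filter]
  -- found configurations
  have hpop : ∀ c ∈ V.pop G, ∀ e ∈ c.cycle, e ∈ E ∧ (e ∈ V.first ∨ e ∈ V.second E) := by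
    intro c hc e he
    obtain ⟨hcG, hsm⟩ := mem_filt.1 hc
    refine ⟨cycle_subset_edgesOf hcG he, ?_⟩
    by_contra hcon
    push Not at hcon
    -- Three edges of a sampled configuration are kept in the first pass; if the remaining edge e₀
    -- is not, it closes them in the second.
    obtain ⟨e₀, he₀, hb⟩ := exists_edge_base_le hP hcG
    have hfirst : ∀ e' ∈ c.cycle, e' ≠ e₀ → e' ∈ V.first := by
      intro e' he' hne
      induction e' with
      | _ u v =>
        have hn := isNodeOf_of_mem he'
        exact V.mk_mem_first (V.near_of_sampled hP hsm hn.1 hn.2 (hb u v he' hne))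
    have hee : e = e₀ := by
      by_contra hne; exact hcon.1 (hfirst e he hne)
    subst hee
    refine hcon.2 (mem_filt.2 ⟨c, isConfig_top hcG, hsm, he, fun e' he' hne => ?_⟩)
    exact Finset.mem_inter.2 ⟨cycle_subset_edgesOf hcG he', hfirst e' he' hne⟩
  -- Edges stored in the third pass create no new found configurations, because `found` admits only
  -- edges selected by the rules of the first two passes.
  have found_eq : ∀ S, M2 ⊆ S → S ⊆ E → V.found S = V.pop G := by
    intro S h1 h2
    have h3 : S ∩ V.first = E ∩ V.first :=
      inter_first S (Finset.subset_union_left.trans h1) h2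
    ext c
    unfold found pop
    rw [mem_filt, mem_filt, V.second_congr h3]
    constructor
    · rintro ⟨hc, hsm, hall⟩
      exact ⟨isConfig_of_subset hc fun e he => h2 (hall e he).1, hsm⟩
    · intro hc
      refine ⟨isConfig_top hc.1, hc.2, fun e he => ?_⟩
      have h4 := hpop c (mem_filt.2 hc) e he
      refine ⟨h1 ?_, h4.2⟩
      rcases h4.2 with h5 | h5
      · exact Finset.mem_union_left _ (Finset.mem_inter.2 ⟨h4.1, h5⟩)
      · exact Finset.mem_union_right _ (Finset.mem_filter.2 ⟨h4.1, h5⟩)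
  have cap_first : ∀ S, M2 ⊆ S → S ⊆ E → S ∩ V.first = E ∩ V.first := fun S h1 h2 =>
    inter_first S (Finset.subset_union_left.trans h1) h2
  have hfE : V.found E = V.pop G := found_eq E hM2E (Finset.Subset.refl _)
  -- third pass
  have keep3 : ∀ S, M2 ⊆ S → S ⊆ E → ∀ e, V.keep 2 S e ↔
      (e ∈ V.links E ∨ ∃ g ∈ V.groups E, e ∈ V.group E g ∧
        (S ∩ V.group E g).card < V.cap) := by
    intro S h1 h2 e
    have e1 := cap_first S h1 h2
    have e2 : V.groups S = V.groups E :=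
      V.groups_congr e1 ((found_eq S h1 h2).trans hfE.symm)
    have e3 : ∀ g, V.group S g = V.group E g := by
      intro g; unfold group; rw [e1]
    simp only [keep]
    rw [if_neg (by decide), if_neg (by decide)]
    unfold links
    rw [e2]
    simp only [e3]
  set S3 := memSet V.keep stream 3 with hS3
  have p3 : S3 = (stream 2).foldl (keepStep (V.keep 2)) M2 := by
    rw [hS3, show memSet V.keep stream 3 = (stream 2).foldl (keepStep (V.keep 2))
      (memSet V.keep stream 2) from rfl, p2]
  have h23 : M2 ⊆ S3 := by rw [p3]; exact subset_foldl_keepStep _ _ _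
  have h3E : S3 ⊆ E := by
    rw [p3]
    refine (foldl_keepStep_subset _ _ _).trans ?_
    rw [hst]
    exact Finset.union_subset hM2E (Finset.Subset.refl _)
  have hpopfound : ∀ {c a l b}, c ∈ V.pop G → IsNodeOf c.cycle a → b ∈ V.touched E →
      (c, a, l, b) ∈ V.groups E := fun hc ha hb => mem_filt.2 ⟨by rw [hfE]; exact hc, ha, hb⟩
  refine ⟨h3E, Finset.subset_union_left.trans h23, ?_, ?_, ?_, ?_⟩
  · intro c hc e he
    have h4 := hpop c hc e he
    refine h23 ?_
    rcases h4.2 with h5 | h5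
    · exact Finset.mem_union_left _ (Finset.mem_inter.2 ⟨h4.1, h5⟩)
    · exact Finset.mem_union_right _ (Finset.mem_filter.2 ⟨h4.1, h5⟩)
  · intro c hc a b ha hb hadj
    by_contra hn
    rw [p3] at hn
    obtain ⟨S, h1, h2, h3⟩ := exists_not_keep_of_notMem (V.keep 2) M2 (stream 2)
      (e := s(a, b)) (mem_l.2 (mem_filt.2 hadj)) hn
    rw [← p3] at h2
    rw [keep3 S h1 (h2.trans h3E)] at h3
    -- The label plays no role for links; any of the six will do.
    exact h3 (Or.inl (mem_filt.2 ⟨(c, a, .S1, b), hpopfound hc ha hb, rfl⟩))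
  · intro c hc a l b ha hb e he heE hn
    rw [p3] at hn
    obtain ⟨S, h1, h2, h3⟩ := exists_not_keep_of_notMem (V.keep 2) M2 (stream 2)
      (mem_l.2 heE) hn
    rw [← p3] at h2
    rw [keep3 S h1 (h2.trans h3E)] at h3
    push Not at h3
    exact (h3.2 (c, a, l, b) (hpopfound hc ha hb) he).trans
      (Finset.card_le_card (Finset.inter_subset_inter_right h2))
  · have h1 := card_foldl_keepStep_le (V.keep 2) M2 (V.links E) (stream 2) (V.groups E)
      (V.group E) V.cap (fun S e h1 h2 _ hk => by
        rw [hst] at h2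
        exact (keep3 S h1 (h2.trans (Finset.union_subset hM2E (Finset.Subset.refl _))) e).1 hk)
    rw [← p3] at h1
    have h2 : (V.links E).card ≤ (V.groups E).card := by
      have : V.links E ⊆ (V.groups E).image fun g => s(g.2.1, g.2.2.2) := by
        intro e he
        obtain ⟨g, hg, rfl⟩ := mem_filt.1 he
        exact Finset.mem_image_of_mem _ hg
      exact (Finset.card_le_card this).trans Finset.card_image_le
    have h3 := V.card_groups_le E G (fun c hc => by
      rw [hfE] at hc; exact (mem_filt.1 hc).1)
    rw [hfE] at h3
    -- An edge of the second pass lies in the cycle of a sampled configuration of G.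
    have h4 : M2.card ≤ M.card + 4 * (V.pop G).card := by
      refine (Finset.card_union_le _ _).trans (Nat.add_le_add_left ?_ _)
      have : (E.filter fun e => e ∈ V.second E) ⊆ (V.pop G).biUnion fun c => c.cycle := by
        intro e he
        rw [Finset.mem_filter] at he
        obtain ⟨c, hc, hsm, hec, hall⟩ := mem_filt.1 he.2
        refine Finset.mem_biUnion.2 ⟨c, mem_filt.2 ⟨isConfig_of_subset hc fun e' he' => ?_, hsm⟩,
          hec⟩
        by_cases hne : e' = e
        · rw [hne]; exact he.1
        · exact (Finset.mem_inter.1 (hall e' he' hne)).1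
      rw [mul_comm]
      refine (Finset.card_le_card this).trans (Finset.card_biUnion_le_card_mul _ _ _ fun c hc => ?_)
      exact (card_fourCycle (mem_filt.1 hc).1.1).le
    have h5 := Nat.mul_le_mul_right V.cap h3
    have h6 : (V.pop G).card * (4 * (6 * (2 * M.card))) * (1 + V.cap) =
      (V.pop G).card * (4 * (6 * (2 * M.card))) +
        (V.pop G).card * (4 * (6 * (2 * M.card))) * V.cap := by ring
    change S3.card ≤ M.card + _ + _
    rw [hEM, h6]
    rw [hEM] at h3 h5
    omega

end Env

end

section

variable {n N : ℕ} {P : Params} {G : SimpleGraph (Fin n)} {c : Config n N}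

/-! ### Labels along a wedge -/

/-- The label patterns around a cycle, starting at any node and in any direction. -/
def CyclicPattern (l₀ l₁ l₂ l₃ : Label) : Prop :=
  LabelPattern l₀ l₁ l₂ l₃ ∨ LabelPattern l₁ l₂ l₃ l₀ ∨ LabelPattern l₂ l₃ l₀ l₁ ∨
  LabelPattern l₃ l₀ l₁ l₂ ∨ LabelPattern l₃ l₂ l₁ l₀ ∨ LabelPattern l₀ l₃ l₂ l₁ ∨
  LabelPattern l₁ l₀ l₃ l₂ ∨ LabelPattern l₂ l₁ l₀ l₃

lemma Config.exists_form_wedge (hc : c.IsConfig G) {a w b : Fin n}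
    (h : (Substructure.wedge a w b).In c.cycle) :
    ∃ z, IsCyc G a w b z ∧ c.cycle = cyc a w b z ∧
      CyclicPattern (c.label a) (c.label w) (c.label b) (c.label z) := by
  obtain ⟨v₀, v₁, v₂, v₃, h', e, hl, -⟩ := c.exists_form hc
  obtain ⟨z, hz, ez⟩ := exists_cyc_of_wedge hc.1 h.1 h.2.1 h.2.2
  refine ⟨z, hz, ez, ?_⟩
  have i0 := fun v => mk_mem_cyc_iff (v := v) h'
  have i1 := fun v => mk_mem_cyc_iff (v := v) h'.rot
  have i2 := fun v => mk_mem_cyc_iff (v := v) h'.rot.rot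
  have i3 := fun v => mk_mem_cyc_iff (v := v) h'.rot.rot.rot
  rw [cyc_rot] at i1
  rw [cyc_rot, cyc_rot] at i2
  rw [cyc_rot, cyc_rot, cyc_rot] at i3
  have ha : s(a, w) ∈ cyc v₀ v₁ v₂ v₃ := e ▸ h.2.1
  have hw : s(w, b) ∈ cyc v₀ v₁ v₂ v₃ := e ▸ h.2.2
  have hb : s(b, z) ∈ cyc v₀ v₁ v₂ v₃ := by rw [← e, ez, mem_cyc]; tauto
  have hn : IsNodeOf (cyc v₀ v₁ v₂ v₃) a := (isNodeOf_of_mem ha).1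
  have hab := hz.ac
  have hwz := hz.bd
  unfold CyclicPattern
  rcases isNodeOf_cyc.1 hn with rfl | rfl | rfl | rfl <;>
  simp only [i0, i1, i2, i3] at ha <;> rcases ha with rfl | rfl <;>
  simp only [i0, i1, i2, i3] at hw <;> rcases hw with rfl | rfl <;>
  first
  | exact absurd rfl hab
  | (simp only [i0, i1, i2, i3] at hb
     rcases hb with rfl | rfl <;> first | exact absurd rfl hwz | tauto)

/-- The label with which common neighbours of the end points of a wedge are sampled. -/
def Label.probe : Label → Label
  | .S1 => .S2
  | .S2 => .S1
  | .R1a | .R2a => .R1b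
  | .R1b | .R2b => .R1a

section Pattern

variable {l₀ l₁ l₂ l₃ : Label} (h : CyclicPattern l₀ l₁ l₂ l₃)
include h

lemma CyclicPattern.cases : (l₀ = .S1 ∧ l₁ = .S2 ∧ l₂ = .S1 ∧ l₃ = .S2) ∨
    (l₀ = .S2 ∧ l₁ = .S1 ∧ l₂ = .S2 ∧ l₃ = .S1) ∨
    (l₀ = .R1a ∧ l₁ = .R1b ∧ l₂ = .R2a ∧ l₃ = .R2b) ∨
    (l₀ = .R2b ∧ l₁ = .R1a ∧ l₂ = .R1b ∧ l₃ = .R2a) ∨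
    (l₀ = .R2a ∧ l₁ = .R2b ∧ l₂ = .R1a ∧ l₃ = .R1b) ∨
    (l₀ = .R1b ∧ l₁ = .R2a ∧ l₂ = .R2b ∧ l₃ = .R1a) ∨
    (l₀ = .R2b ∧ l₁ = .R2a ∧ l₂ = .R1b ∧ l₃ = .R1a) ∨
    (l₀ = .R1a ∧ l₁ = .R2b ∧ l₂ = .R2a ∧ l₃ = .R1b) ∨
    (l₀ = .R1b ∧ l₁ = .R1a ∧ l₂ = .R2b ∧ l₃ = .R2a) ∨
    (l₀ = .R2a ∧ l₁ = .R1b ∧ l₂ = .R1a ∧ l₃ = .R2b) := by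
  rcases h with h | h | h | h | h | h | h | h <;> rcases h with h | h <;>
    obtain ⟨rfl, rfl, rfl, rfl⟩ := h <;> decide

omit h in
lemma base_mul_base_of_ne (hP : P.Good) (k : ℤ) {l l' : Label} (h : l.isOne ≠ l'.isOne) :
    P.base k l * P.base k l' * √P.T = 1 := by
  have hs := hP.sqrt_pos
  have hκ := hP.κ_pos k
  unfold Params.base
  cases h1 : l.isOne <;> cases h2 : l'.isOne <;> simp [h1, h2] at h ⊢ <;> field_simp

/-- In the S pattern the probe differs in type from both ends of the wedge. In the R pattern the
ends have different types and the probe has type 1. Thus edges from one of the ends to probes are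
caught in the first pass. -/
lemma CyclicPattern.base_probe_le (hP : P.Good) (k : ℤ) :
    P.base k l₀ * P.base k l₀.probe * √P.T ≤ 1 ∨ P.base k l₂ * P.base k l₀.probe * √P.T ≤ 1 := by
  rcases h.cases with h | h | h | h | h | h | h | h | h | h <;> obtain ⟨rfl, rfl, rfl, rfl⟩ := h <;>
    first
    | exact Or.inl (base_mul_base_of_ne hP k (by decide)).le
    | exact Or.inr (base_mul_base_of_ne hP k (by decide)).le

lemma CyclicPattern.base_mul (hP : P.Good) (k : ℤ) :
    P.T * (P.base k l₀ * P.base k l₁ * P.base k l₂ * P.base k l₃) = 1 := by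
  rcases h with h | h | h | h | h | h | h | h <;> rw [← h.base_mul hP k] <;> ring

/-- The probe is sampled at least as densely as the fourth node. Hence the inverse rate of the probe
is below the wedge threshold, and sampling at this rate can resolve the threshold. -/
lemma CyclicPattern.one_le_base_mul_probe (hP : P.Good) (k : ℕ) :
    1 ≤ P.T * (P.base k l₀ * P.base k l₁ * P.base k l₂ * P.base k l₀.probe) := by
  have h1 := h.base_mul hP k
  have h3 : P.base k l₃ ≤ P.base k l₀.probe := by
    have hs := hP.sqrt_pos
    have hκ := hP.κ_pos k
    have hle : 1 / P.κ k ≤ P.κ k / √P.T := by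
      rw [div_le_div_iff₀ hκ hs]; linarith [hP.sqrt_le_κ_sq k]
    rcases h.cases with h | h | h | h | h | h | h | h | h | h <;>
      obtain ⟨rfl, rfl, rfl, rfl⟩ := h <;> simp only [Params.base, Label.isOne, Label.probe] <;>
      first | exact le_rfl | simpa using hle
  rw [← h1]
  have hT := hP.T_pos
  have := hP.base_pos k l₀
  have := hP.base_pos k l₁
  have := hP.base_pos k l₂
  gcongr

end Pattern

/-! ### The estimators -/

/-- A sampling probability. -/
def rate (P : Params) (M : ℝ) (k : ℤ) (l : Label) : unitInterval :=
  Set.projIcc (0 : ℝ) 1 zero_le_one (M * P.base k l)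

/-- The probability with which pairs of vertices are sampled. -/
def pairRate (P : Params) (M : ℝ) : unitInterval :=
  Set.projIcc (0 : ℝ) 1 zero_le_one (M / √P.T)

lemma coe_projIcc {x : ℝ} (hx : 0 ≤ x) :
    (Set.projIcc (0 : ℝ) 1 zero_le_one x : ℝ) = min 1 x := by
  rw [Set.coe_projIcc, max_eq_right (le_min zero_le_one hx)]

lemma coe_rate (hP : P.Good) {M : ℝ} (hM : 0 ≤ M) (k : ℤ) (l : Label) :
    (rate P M k l : ℝ) = min 1 (M * P.base k l) :=
  coe_projIcc (mul_nonneg hM (hP.base_pos k l).le)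

/-- The probability that three nodes other than one with label `l` are sampled. -/
def nodeRate (P : Params) (M : ℝ) (k : ℤ) (l : Label) : ℝ :=
  if l.isOne then rate P M k .S1 * (rate P M k .S2 : ℝ) ^ 2
  else (rate P M k .S1 : ℝ) ^ 2 * rate P M k .S2

namespace Env

variable (V : Env n N) (H : SimpleGraph (Fin n))

/-- The sampled common neighbours of two vertices. -/
def probes (k : Fin N) (l : Label) (a b : Fin n) : Finset (Fin n) :=
  filt fun z => V.Y (k, l, z) = true ∧ H.Adj a z ∧ H.Adj b z

/-- The estimate for the heaviness of a wedge from `a` to `b`. -/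
def estWedge (k : Fin N) (l : Label) (a b : Fin n) : ℝ :=
  (V.probes H k l a b).card / rate V.P V.MY (k : ℕ) l - 1

/-- All wedges are estimated to be light. -/
def EstWedgesLight (c : Config n N) : Prop :=
  ∀ a w b, (Substructure.wedge a w b).In c.cycle →
    V.estWedge H c.scale (c.label a).probe a b ≤
      V.s 0 * threshold V.P (.wedge a w b) c.scale c.label

/-- The estimate for the heaviness of an edge. -/
def estEdge (u v : Fin n) : ℝ :=
  (filt fun p : Fin n × Fin n => V.F p = true ∧ IsCyc H u v p.1 p.2).card / pairRate V.P V.MF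

/-- The configurations that are counted in the estimate for the refined heaviness of an edge. -/
def edgeFamily (u v : Fin n) (k : Fin N) (ℓ : Fin n → Label) : Finset (Config n N) :=
  filt fun c => c.IsConfig H ∧ c.Has (.edge u v) k ℓ ∧ V.EstWedgesLight H c ∧
    V.Y (k, .R1a, c.x) = true ∧ V.Y (k, .R1b, c.y) = true

/-- The estimate for the refined heaviness of an edge. -/
def estRefinedEdge (u v : Fin n) (k : Fin N) (ℓ : Fin n → Label) : ℝ :=
  if numOnes (.edge u v) ℓ = 0 then
    (V.edgeFamily H u v k ℓ).card / (rate V.P V.MY (k : ℕ) .R1a * rate V.P V.MY (k : ℕ) .R1b)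
  else V.estEdge H u v

/-- All edges are estimated to be light. -/
def EstEdgesLight (c : Config n N) : Prop :=
  ∀ u v, (Substructure.edge u v).In c.cycle →
    V.estRefinedEdge H u v c.scale c.label ≤
      V.s 1 * threshold V.P (.edge u v) c.scale c.label

/-- The configuration is estimated to be valid. -/
def EstValid (c : Config n N) : Prop :=
  ¬ (s(c.x, c.y) ∈ c.cycle ∧ V.estEdge H c.x c.y ≤ V.s 1 * (√V.P.T / V.P.δ ^ 2))

/-- The configurations that are counted in the estimate for the refined heaviness of a node. -/
def nodeFamily (v : Fin n) (k : Fin N) (ℓ : Fin n → Label) : Finset (Config n N) :=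
  filt fun c => (c.IsConfig H ∧ V.EstValid H c ∧ c.Has (.node v) k ℓ ∧ V.EstWedgesLight H c ∧
    V.EstEdgesLight H c) ∧ ∀ u, IsNodeOf c.cycle u → u ≠ v → V.Z (k, c.label u, u) = true

/-- The estimate for the refined heaviness of a node. -/
def estNode (v : Fin n) (k : Fin N) (ℓ : Fin n → Label) : ℝ :=
  (V.nodeFamily H v k ℓ).card / nodeRate V.P V.MZ (k : ℕ) (ℓ v)

/-- The configuration is estimated to be heavy. -/
def EstHeavy (c : Config n N) : Prop :=
  ¬ V.EstWedgesLight H c ∨ ¬ V.EstEdgesLight H c ∨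
    ∃ v, IsNodeOf c.cycle v ∧
      V.s 2 * threshold V.P (.node v) c.scale c.label < V.estNode H v c.scale c.label

/-- The answer of the oracle, computed from the graph `H`. -/
def EstLLM (c : Config n N) : Prop :=
  ¬ V.EstHeavy H c ∧ LocMin V.P (V.EstHeavy H) c ∧ V.EstValid H c

lemma probes_comm (k : Fin N) (l : Label) (a b : Fin n) :
    V.probes H k l a b = V.probes H k l b a := by
  ext z; simp only [probes, mem_filt]; tauto

/-! ### The remembered edges determine the estimates -/

/-- The graph of the remembered edges. -/
def _root_.FourCycleStream.recon {n : ℕ} (S : Finset (Sym2 (Fin n))) : SimpleGraph (Fin n) :=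
  SimpleGraph.fromEdgeSet (S : Set (Sym2 (Fin n)))

section Recon

variable {V} {S : Finset (Sym2 (Fin n))} (hS : V.MemSpec G S) (hP : V.P.Good)
include hS

lemma recon_adj {u v : Fin n} : (recon S).Adj u v ↔ s(u, v) ∈ S := by
  rw [recon, SimpleGraph.fromEdgeSet_adj]
  refine ⟨fun h => h.1, fun h => ⟨h, ?_⟩⟩
  have := hS.subset h
  have h2 : G.Adj u v := (mem_filt (p := fun e => e ∈ G.edgeSet)).1 this
  exact h2.ne

lemma adj_of_recon {u v : Fin n} (h : (recon S).Adj u v) : G.Adj u v :=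
  (mem_filt (p := fun e => e ∈ G.edgeSet)).1 (hS.subset ((recon_adj hS).1 h))

lemma isConfig_of_recon (h : c.IsConfig (recon S)) : c.IsConfig G :=
  isConfig_mono h fun _ _ he => adj_of_recon hS (adj_of_mem h.1 he)

lemma isConfig_recon (hc : c ∈ V.pop G) : c.IsConfig (recon S) :=
  isConfig_mono (mem_filt.1 hc).1 fun _ _ he => (recon_adj hS).2 (hS.cycle_subset c hc he)

lemma recon_of_first {u v : Fin n} (h : G.Adj u v) (h1 : s(u, v) ∈ V.first) :
    (recon S).Adj u v :=
  (recon_adj hS).2 (hS.first_subset (Finset.mem_inter.2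
    ⟨(mem_filt (p := fun e => e ∈ G.edgeSet)).2 h, h1⟩))

omit hS in
lemma touched_of_first {u v : Fin n} (h : G.Adj u v) (h1 : s(u, v) ∈ V.first) :
    u ∈ V.touched (edgesOf G) ∧ v ∈ V.touched (edgesOf G) := by
  have := Finset.mem_inter.2 ⟨(mem_filt (p := fun e => e ∈ G.edgeSet)).2 h, h1⟩
  exact ⟨mem_filt.2 ⟨_, this, by simp⟩, mem_filt.2 ⟨_, this, by simp⟩⟩

lemma recon_of_touched (hc : c ∈ V.pop G) {a b : Fin n} (ha : IsNodeOf c.cycle a)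
    (hb : b ∈ V.touched (edgesOf G)) (h : G.Adj a b) : (recon S).Adj a b :=
  (recon_adj hS).2 (hS.link c hc a b ha hb h)

include hP

/-- A probe z next to a gives an edge az kept in the first pass; this touches z, so the third pass
keeps the link from the node b to z. -/
lemma probes_recon_of_node (hc : c ∈ V.pop G) {a b : Fin n} {l : Label}
    (ha : IsNodeOf c.cycle a) (hb : IsNodeOf c.cycle b)
    (hl : V.P.base (c.scale : ℕ) (c.label a) * V.P.base (c.scale : ℕ) l * √V.P.T ≤ 1) :
    V.probes (recon S) c.scale l a b = V.probes G c.scale l a b := by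
  ext z
  simp only [probes, mem_filt]
  refine and_congr_right fun hY => ⟨fun h => ⟨adj_of_recon hS h.1, adj_of_recon hS h.2⟩,
    fun h => ?_⟩
  have h1 := V.mk_mem_first (V.near_of_probe hP (mem_filt.1 hc).2 ha hY hl)
  exact ⟨recon_of_first hS h.1 h1, recon_of_touched hS hc hb (touched_of_first h.1 h1).2 h.2⟩

lemma estWedgesLight_recon (hc : c ∈ V.pop G) :
    V.EstWedgesLight (recon S) c ↔ V.EstWedgesLight G c := by
  refine forall_congr' fun a => forall_congr' fun w => forall_congr' fun b =>
    imp_congr_right fun hin => ?_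
  have e : V.probes (recon S) c.scale (c.label a).probe a b =
      V.probes G c.scale (c.label a).probe a b := by
    obtain ⟨z, hz, ez, hl⟩ := c.exists_form_wedge (mem_filt.1 hc).1 hin
    have ha : IsNodeOf c.cycle a := (isNodeOf_of_mem hin.2.1).1
    have hb : IsNodeOf c.cycle b := (isNodeOf_of_mem hin.2.2).2
    rcases hl.base_probe_le hP (c.scale : ℕ) with h | h
    · exact probes_recon_of_node hS hP hc ha hb h
    · rw [probes_comm, probes_recon_of_node hS hP hc hb ha h, probes_comm]
  unfold estWedge
  rw [e]

-- A sampled pair that completes the edge to a cycle is itself a first-pass edge; its ends are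
-- touched, and the links to u and v supply the rest of the cycle.
omit hP in
lemma estEdge_recon (hc : c ∈ V.pop G) {u v : Fin n} (h : s(u, v) ∈ c.cycle) :
    V.estEdge (recon S) u v = V.estEdge G u v := by
  unfold estEdge
  congr 3
  ext p
  simp only [mem_filt]
  refine (and_congr_right fun hF => ⟨fun h => ⟨adj_of_recon hS h.ab, adj_of_recon hS h.bc,
    adj_of_recon hS h.cd, adj_of_recon hS h.da, h.ac, h.bd⟩, fun hp => ?_⟩)
  have hn := isNodeOf_of_mem h
  have h1 : s(p.1, p.2) ∈ V.first := mem_filt.2 ⟨_, _, rfl, Or.inr hF⟩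
  have ht := touched_of_first hp.cd h1
  exact ⟨adj_of_mem (isConfig_recon hS hc).1 h, recon_of_touched hS hc hn.2 ht.1 hp.bc,
    recon_of_first hS hp.cd h1, (recon_of_touched hS hc hn.1 ht.2 hp.da.symm).symm, hp.ac, hp.bd⟩

/-- Here b need not be a node of c, so the edges bz come only from a capped group. A missing one was
rejected because the group was full, and every stored edge of the group is seen as a probe from
memory. -/
lemma probes_dichotomy (hc : c ∈ V.pop G) {a b : Fin n} {l : Label}
    (ha : IsNodeOf c.cycle a) (hb : b ∈ V.touched (edgesOf G))
    (hl : V.P.base (c.scale : ℕ) (c.label a) * V.P.base (c.scale : ℕ) l * √V.P.T ≤ 1) :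
    (V.probes (recon S) c.scale l a b = V.probes G c.scale l a b ∧
      ∀ z ∈ V.probes G c.scale l a b, s(b, z) ∈ S) ∨
    (V.cap ≤ (V.probes (recon S) c.scale l a b).card ∧
      V.cap ≤ (V.probes G c.scale l a b).card) := by
  have hnear : ∀ z, V.Y (c.scale, l, z) = true → G.Adj a z →
      s(a, z) ∈ edgesOf G ∩ V.first := fun z hY hz => Finset.mem_inter.2
    ⟨(mem_filt (p := fun e => e ∈ G.edgeSet)).2 hz,
      V.mk_mem_first (V.near_of_probe hP (mem_filt.1 hc).2 ha hY hl)⟩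
  have hsub : V.probes (recon S) c.scale l a b ⊆ V.probes G c.scale l a b := by
    intro z hz
    simp only [probes, mem_filt] at hz ⊢
    exact ⟨hz.1, adj_of_recon hS hz.2.1, adj_of_recon hS hz.2.2⟩
  by_cases hall : ∀ z ∈ V.probes G c.scale l a b, s(b, z) ∈ S
  · refine Or.inl ⟨hsub.antisymm fun z hz => ?_, hall⟩
    have h1 := hall z hz
    simp only [probes, mem_filt] at hz ⊢
    exact ⟨hz.1, (recon_adj hS).2 (hS.first_subset (hnear z hz.1 hz.2.1)), (recon_adj hS).2 h1⟩
  · push Not at hall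
    obtain ⟨z, hz, hn⟩ := hall
    simp only [probes, mem_filt] at hz
    have h1 := hS.grp c hc a l b ha hb s(b, z)
      (mem_filt.2 ⟨z, rfl, hz.1, hnear z hz.1 hz.2.1⟩)
      ((mem_filt (p := fun e => e ∈ G.edgeSet)).2 hz.2.2) hn
    have h2 : S ∩ V.group (edgesOf G) (c, a, l, b) ⊆
        (V.probes (recon S) c.scale l a b).image fun z => s(b, z) := by
      intro e he
      obtain ⟨he, heg⟩ := Finset.mem_inter.1 he
      obtain ⟨z', rfl, hY, hz'⟩ := mem_filt.1 heg
      refine Finset.mem_image_of_mem _ (mem_filt.2 ⟨hY, ?_, (recon_adj hS).2 he⟩)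
      exact (recon_adj hS).2 (hS.first_subset hz')
    have h3 := h1.trans ((Finset.card_le_card h2).trans Finset.card_image_le)
    exact Or.inr ⟨h3, h3.trans (Finset.card_le_card hsub)⟩

end Recon

/-- If the probe has the rate of the fourth node, the wedge threshold times the sampling probability
is at most MY/δ. So a wedge estimated as light has fewer probes than the cap, and a full group shows
that the wedge is estimated as heavy. -/
lemma probes_lt_cap (hP : V.P.Good) (hs : 0 ≤ V.s 0) (hpos : 0 < V.MY)
    (hcap : V.s 0 * V.MY / V.P.δ + 1 < V.cap)
    (hc : c.IsConfig G) {a w b : Fin n} (hin : (Substructure.wedge a w b).In c.cycle)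
    (hpr : V.P.T * (V.P.base (c.scale : ℕ) (c.label a) * V.P.base (c.scale : ℕ) (c.label w) *
      V.P.base (c.scale : ℕ) (c.label b) * V.P.base (c.scale : ℕ) (c.label a).probe) = 1)
    (hl : V.EstWedgesLight H c) :
    (V.probes H c.scale (c.label a).probe a b).card < V.cap := by
  have h1 := hl _ _ _ hin
  rw [threshold_wedge_config hP hc hin] at h1
  have hb := hP.base_pos (c.scale : ℕ) (c.label a).probe
  have hr := coe_rate hP hpos.le (c.scale : ℕ) (c.label a).probe
  have hr0 : 0 < (rate V.P V.MY (c.scale : ℕ) (c.label a).probe : ℝ) := by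
    rw [hr]; exact lt_min one_pos (by positivity)
  have hr1 : (rate V.P V.MY (c.scale : ℕ) (c.label a).probe : ℝ) ≤ 1 := by
    rw [hr]; exact min_le_left _ _
  have hr2 : (rate V.P V.MY (c.scale : ℕ) (c.label a).probe : ℝ) ≤
      V.MY * V.P.base (c.scale : ℕ) (c.label a).probe := by
    rw [hr]; exact min_le_right _ _
  unfold estWedge at h1
  rw [sub_le_iff_le_add, div_le_iff₀ hr0] at h1
  set ρ := (rate V.P V.MY (c.scale : ℕ) (c.label a).probe : ℝ)
  have hδ := hP.δ_pos
  have hT := hP.T_pos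
  have b1 := hP.base_pos (c.scale : ℕ) (c.label a)
  have b2 := hP.base_pos (c.scale : ℕ) (c.label w)
  have b3 := hP.base_pos (c.scale : ℕ) (c.label b)
  have h2 : V.s 0 * (V.P.T * V.P.base (c.scale : ℕ) (c.label a) *
      V.P.base (c.scale : ℕ) (c.label w) * V.P.base (c.scale : ℕ) (c.label b) / V.P.δ) * ρ ≤
      V.s 0 * V.MY / V.P.δ := by
    refine (mul_le_mul_of_nonneg_left hr2 (by positivity)).trans (le_of_eq ?_)
    have : V.s 0 * V.MY / V.P.δ = V.s 0 * V.MY / V.P.δ * 1 := by ring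
    rw [this, ← hpr]
    ring
  have h3 : ((V.probes H c.scale (c.label a).probe a b).card : ℝ) < V.cap := by
    refine lt_of_le_of_lt (h1.trans ?_) hcap
    rw [add_mul, one_mul]
    exact add_le_add h2 hr1
  exact_mod_cast h3

end Env

end

/-! ### Recovering the refined estimates from the memory. -/

section

variable {n N : ℕ} {P : Params} {G : SimpleGraph (Fin n)} {c : Config n N}

/-- In the S pattern the types alternate along edges, so two adjacent nodes of type 2 occur only in
the R pattern, as the edge opposite to xy. -/
lemma Config.exists_form_edge (hc : c.IsConfig G) {u v : Fin n} (h : s(u, v) ∈ c.cycle)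
    (h0 : numOnes (.edge u v) c.label = 0) :
    ∃ p q, (p = u ∧ q = v ∨ p = v ∧ q = u) ∧ IsCyc G c.x c.y p q ∧ c.cycle = cyc c.x c.y p q ∧
      c.label c.x = .R1a ∧ c.label c.y = .R1b ∧ c.label p = .R2a ∧ c.label q = .R2b := by
  have hu : ¬ (c.label u).isOne = true ∧ ¬ (c.label v).isOne = true := by
    simp only [numOnes, Substructure.nodes, List.countP_cons, List.countP_nil] at h0
    constructor <;> intro hh <;> simp [hh] at h0
  obtain ⟨v₀, v₁, v₂, v₃, hcyc, e, hl, h1, h2, h3⟩ := c.exists_form hc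
  subst h1
  have hn := isNodeOf_of_mem h
  rw [e, isNodeOf_cyc, isNodeOf_cyc] at hn
  have i1 := fun v => mk_mem_cyc_iff (v := v) hcyc.rot
  have i3 := fun v => mk_mem_cyc_iff (v := v) hcyc.rot.rot.rot
  rw [cyc_rot] at i1
  rw [cyc_rot, cyc_rot, cyc_rot] at i3
  rw [e] at h
  rcases hl with ⟨l0, l1, l2, l3⟩ | ⟨l0, l1, l2, l3⟩
  · exfalso
    obtain ⟨rfl | rfl | rfl | rfl, hn2⟩ := hn
    · exact hu.1 (by rw [l0]; rfl)
    · rw [i1] at h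
      rcases h with rfl | rfl
      · exact hu.2 (by rw [l2]; rfl)
      · exact hu.2 (by rw [l0]; rfl)
    · exact hu.1 (by rw [l2]; rfl)
    · rw [i3] at h
      rcases h with rfl | rfl
      · exact hu.2 (by rw [l0]; rfl)
      · exact hu.2 (by rw [l2]; rfl)
  · have hy := h3 l0
    subst hy
    refine ⟨v₂, v₃, ?_, hcyc, e, l0, l1, l2, l3⟩
    have hx : ∀ w, ¬ (c.label w).isOne = true → w ≠ c.x ∧ w ≠ c.y := by
      intro w hw; rw [Config.isOne_label] at hw; tauto
    have hxu := hx u hu.1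
    have hxv := hx v hu.2
    have hne := (adj_of_mem hc.1 (e ▸ h)).ne
    grind

namespace Env

variable {V : Env n N} {S : Finset (Sym2 (Fin n))} (hS : V.MemSpec G S) (hP : V.P.Good)
include hS hP

/-- The configuration c' need not be tracked, but it shares the edge pq with c. Its x and y are
probes, so qx and py are kept in the first pass and touch x and y. Each of the opposite pairs {p, x}
and {q, y} contains a node of c, so `probes_dichotomy` applies. Either all probes are known, in
particular y as a probe for {p, x}, which supplies the edge xy; or a cap is reached and c' is
estimated to have a heavy wedge in both graphs. -/
lemma edgeFamily_recon_aux (hs : 0 ≤ V.s 0) (hM : 0 < V.MY)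
    (hcap : V.s 0 * V.MY / V.P.δ + 1 < V.cap) (hc : c ∈ V.pop G) {c' : Config n N}
    (hc' : c'.IsConfig G) (hk : c'.scale = c.scale) {p q : Fin n}
    (hcyc : IsCyc G c'.x c'.y p q) (e : c'.cycle = cyc c'.x c'.y p q)
    (hx : c'.label c'.x = .R1a) (hy : c'.label c'.y = .R1b) (hp : c'.label p = .R2a)
    (hq : c'.label q = .R2b) (hp' : c.label p = .R2a) (hq' : c.label q = .R2b)
    (hpq : s(p, q) ∈ c.cycle)
    (hYx : V.Y (c.scale, .R1a, c'.x) = true) (hYy : V.Y (c.scale, .R1b, c'.y) = true) :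
    (c'.IsConfig (recon S) ∧ V.EstWedgesLight (recon S) c') ↔ V.EstWedgesLight G c' := by
  have hn := isNodeOf_of_mem hpq
  have hsm := (mem_filt.1 hc).2
  have r1 : V.P.base (c.scale : ℕ) (c.label p) * V.P.base (c.scale : ℕ) .R1b * √V.P.T ≤ 1 :=
    (base_mul_base_of_ne hP _ (by rw [hp']; decide)).le
  have r2 : V.P.base (c.scale : ℕ) (c.label q) * V.P.base (c.scale : ℕ) .R1a * √V.P.T ≤ 1 :=
    (base_mul_base_of_ne hP _ (by rw [hq']; decide)).le
  have f1 : s(q, c'.x) ∈ V.first := V.mk_mem_first (V.near_of_probe hP hsm hn.2 hYx r2)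
  have f2 : s(p, c'.y) ∈ V.first := V.mk_mem_first (V.near_of_probe hP hsm hn.1 hYy r1)
  have t1 := (touched_of_first hcyc.da f1).2
  have t2 := (touched_of_first hcyc.bc.symm f2).2
  have d1 := probes_dichotomy hS hP hc hn.1 t1 r1
  have d2 := probes_dichotomy hS hP hc hn.2 t2 r2
  have w1 : (Substructure.wedge p q c'.x).In c'.cycle := by
    rw [e, ← cyc_rot, ← cyc_rot]; exact wedge_in_cyc hcyc.rot.rot
  have w2 : (Substructure.wedge q p c'.y).In c'.cycle := by
    rw [e, ← cyc_rev, ← cyc_rot]; exact wedge_in_cyc hcyc.rev.rot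
  have hpat : LabelPattern (c'.label c'.x) (c'.label c'.y) (c'.label p) (c'.label q) :=
    Or.inr ⟨hx, hy, hp, hq⟩
  have hpr := hpat.base_mul hP (c'.scale : ℕ)
  have m1 : ∀ H, V.EstWedgesLight H c' → (V.probes H c.scale .R1b p c'.x).card < V.cap := by
    intro H hl
    have := V.probes_lt_cap H hP hs hM hcap hc' w1 (by
      rw [← hpr, hp, hq, hx, hy]; simp only [Label.probe]; ring) hl
    rw [hp, hk] at this
    exact this
  have m2 : ∀ H, V.EstWedgesLight H c' → (V.probes H c.scale .R1a q c'.y).card < V.cap := by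
    intro H hl
    have := V.probes_lt_cap H hP hs hM hcap hc' w2 (by
      rw [← hpr, hp, hq, hx, hy]; simp only [Label.probe]; ring) hl
    rw [hq, hk] at this
    exact this
  have heq : V.probes (recon S) c.scale .R1b p c'.x = V.probes G c.scale .R1b p c'.x →
      V.probes (recon S) c.scale .R1a q c'.y = V.probes G c.scale .R1a q c'.y →
      (V.EstWedgesLight (recon S) c' ↔ V.EstWedgesLight G c') := by
    intro e1 e2
    refine forall_congr' fun a => forall_congr' fun w => forall_congr' fun b =>
      imp_congr_right fun hin => ?_
    have key : V.probes (recon S) c'.scale (c'.label a).probe a b =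
        V.probes G c'.scale (c'.label a).probe a b := by
      rw [hk]
      obtain ⟨z, hz, ez, -⟩ := c'.exists_form_wedge hc' hin
      have hab : s(a, b) ∉ c'.cycle := by
        rw [ez, mk_mem_cyc_iff hz]; have := hz.bc.ne; have := hz.cd.ne; tauto
      have hb := (isNodeOf_of_mem hin.2.2).2
      have ha := (isNodeOf_of_mem hin.2.1).1
      have hne := hin.1
      rw [e, isNodeOf_cyc] at ha hb
      have i0 := fun v => mk_mem_cyc_iff (v := v) hcyc
      have i1 := fun v => mk_mem_cyc_iff (v := v) hcyc.rot
      have i2 := fun v => mk_mem_cyc_iff (v := v) hcyc.rot.rot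
      have i3 := fun v => mk_mem_cyc_iff (v := v) hcyc.rot.rot.rot
      rw [cyc_rot] at i1
      rw [cyc_rot, cyc_rot] at i2
      rw [cyc_rot, cyc_rot, cyc_rot] at i3
      rw [e] at hab
      rcases ha with ha | ha | ha | ha
      · have hb' : b = p := by
          rw [ha, i0] at hab; rw [ha] at hne; tauto
        rw [ha, hb', hx, probes_comm, V.probes_comm G]; exact e1
      · have hb' : b = q := by
          rw [ha, i1] at hab; rw [ha] at hne; tauto
        rw [ha, hb', hy, probes_comm, V.probes_comm G]; exact e2
      · have hb' : b = c'.x := by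
          rw [ha, i2] at hab; rw [ha] at hne; tauto
        rw [ha, hb', hp]; exact e1
      · have hb' : b = c'.y := by
          rw [ha, i3] at hab; rw [ha] at hne; tauto
        rw [ha, hb', hq]; exact e2
    unfold estWedge
    rw [key]
  constructor
  · rintro ⟨-, hl⟩
    rcases d1 with ⟨e1, -⟩ | ⟨h1, -⟩
    · rcases d2 with ⟨e2, -⟩ | ⟨h2, -⟩
      · exact (heq e1 e2).1 hl
      · exact absurd (m2 _ hl) (not_lt.2 h2)
    · exact absurd (m1 _ hl) (not_lt.2 h1)
  · intro hl
    rcases d1 with ⟨e1, s1⟩ | ⟨-, h1⟩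
    · rcases d2 with ⟨e2, -⟩ | ⟨-, h2⟩
      · refine ⟨?_, (heq e1 e2).2 hl⟩
        have hxy : s(c'.x, c'.y) ∈ S := by
          refine s1 c'.y (mem_filt.2 ⟨hYy, hcyc.bc.symm, hcyc.ab⟩)
        refine ⟨?_, hc'.2⟩
        rw [e]
        refine cyc_mem ⟨(recon_adj hS).2 hxy, (recon_of_first hS hcyc.bc.symm f2).symm,
          adj_of_mem (isConfig_recon hS hc).1 hpq, recon_of_first hS hcyc.da f1, hcyc.ac, hcyc.bd⟩
      · exact absurd (m2 _ hl) (not_lt.2 h2)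
    · exact absurd (m1 _ hl) (not_lt.2 h1)

lemma edgeFamily_recon (hs : 0 ≤ V.s 0) (hM : 0 < V.MY)
    (hcap : V.s 0 * V.MY / V.P.δ + 1 < V.cap) (hc : c ∈ V.pop G) {u v : Fin n}
    (huv : s(u, v) ∈ c.cycle) (h0 : numOnes (.edge u v) c.label = 0) :
    V.edgeFamily (recon S) u v c.scale c.label = V.edgeFamily G u v c.scale c.label := by
  have key : ∀ c' : Config n N, c'.IsConfig G → c'.Has (.edge u v) c.scale c.label →
      V.Y (c.scale, .R1a, c'.x) = true → V.Y (c.scale, .R1b, c'.y) = true →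
      ((c'.IsConfig (recon S) ∧ V.EstWedgesLight (recon S) c') ↔ V.EstWedgesLight G c') := by
    intro c' hc' hh hYx hYy
    obtain ⟨hk, hin, hl⟩ := hh
    have h1 : c.label u = c'.label u := hl u (by simp [Substructure.nodes])
    have h2 : c.label v = c'.label v := hl v (by simp [Substructure.nodes])
    have h0' : numOnes (.edge u v) c'.label = 0 := by
      rw [← h0]; simp only [numOnes, Substructure.nodes, List.countP_cons, List.countP_nil, h1, h2]
    obtain ⟨p, q, hpq, hcyc, e, lx, ly, lp, lq⟩ := c'.exists_form_edge hc' hin h0'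
    have hlp : c.label p = .R2a ∧ c.label q = .R2b ∧ s(p, q) ∈ c.cycle := by
      rcases hpq with ⟨rfl, rfl⟩ | ⟨rfl, rfl⟩
      · exact ⟨h1.trans lp, h2.trans lq, huv⟩
      · exact ⟨h2.trans lp, h1.trans lq, Sym2.eq_swap ▸ huv⟩
    exact edgeFamily_recon_aux hS hP hs hM hcap hc hc' hk hcyc e lx ly lp lq hlp.1 hlp.2.1
      hlp.2.2 hYx hYy
  ext c'
  simp only [edgeFamily, mem_filt]
  constructor
  · rintro ⟨h1, h2, h3, h4, h5⟩
    have h6 := isConfig_of_recon hS h1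
    exact ⟨h6, h2, (key c' h6 h2 h4 h5).1 ⟨h1, h3⟩, h4, h5⟩
  · rintro ⟨h1, h2, h3, h4, h5⟩
    have h6 := (key c' h1 h2 h4 h5).2 h3
    exact ⟨h6.1, h2, h6.2, h4, h5⟩

lemma estEdgesLight_recon (hs : 0 ≤ V.s 0) (hM : 0 < V.MY)
    (hcap : V.s 0 * V.MY / V.P.δ + 1 < V.cap) (hc : c ∈ V.pop G) :
    V.EstEdgesLight (recon S) c ↔ V.EstEdgesLight G c := by
  refine forall_congr' fun u => forall_congr' fun v => imp_congr_right fun hin => ?_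
  have : V.estRefinedEdge (recon S) u v c.scale c.label =
      V.estRefinedEdge G u v c.scale c.label := by
    unfold estRefinedEdge
    split_ifs with h0
    · rw [edgeFamily_recon hS hP hs hM hcap hc hin h0]
    · exact estEdge_recon hS hc hin
  rw [this]

omit hP in
lemma estValid_recon (hc : c ∈ V.pop G) : V.EstValid (recon S) c ↔ V.EstValid G c := by
  unfold EstValid
  refine not_congr (and_congr_right fun h => ?_)
  rw [estEdge_recon hS hc h]

/-- Vertex `v` of `c` is sampled by the counting algorithm at a rate that is comparable to that of
its label in `c`. -/
def _root_.FourCycleStream.Env.Anchored (V : Env n N) (c : Config n N) (v : Fin n) : Prop :=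
  ∃ (k : Fin N) (l : Label), V.r (k, l, v) = true ∧
    V.P.base (k : ℕ) l ≤ 1 / V.P.δ ^ 4 * V.P.base (c.scale : ℕ) (c.label v)

-- The purpose of the second kind of sampled configuration: those counted in the estimate for a node
-- v that r already contains are tracked themselves.
omit hS hP in
lemma mem_pop_of_anchored {v : Fin n} (h : V.Anchored c v) {c' : Config n N}
    (hc' : c'.IsConfig G) (hh : c'.Has (.node v) c.scale c.label)
    (hZ : ∀ u, IsNodeOf c'.cycle u → u ≠ v → V.Z (c.scale, c'.label u, u) = true) :
    c' ∈ V.pop G := by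
  obtain ⟨k, l, h1, h2⟩ := h
  obtain ⟨hk, hin, hl⟩ := hh
  have h3 : c.label v = c'.label v := hl v (by simp [Substructure.nodes])
  refine mem_filt.2 ⟨hc', Or.inr ⟨v, k, l, hin, h1, ?_, ?_⟩⟩
  · rw [hk, ← h3]; exact h2
  · rw [hk]; exact hZ

/-- Unlike edge families, node families consist of tracked configurations once the Z condition
holds, so all decisions about their members can be recovered. -/
lemma nodeFamily_recon (hs : 0 ≤ V.s 0) (hM : 0 < V.MY)
    (hcap : V.s 0 * V.MY / V.P.δ + 1 < V.cap) {v : Fin n} (hv : V.Anchored c v) :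
    V.nodeFamily (recon S) v c.scale c.label = V.nodeFamily G v c.scale c.label := by
  ext c'
  simp only [nodeFamily, mem_filt]
  refine and_congr_left fun hZ => ⟨?_, ?_⟩
  · rintro ⟨h1, h2, h3, h4, h5⟩
    have hG := isConfig_of_recon hS h1
    have hp := mem_pop_of_anchored hv hG h3 hZ
    exact ⟨hG, (estValid_recon hS hp).1 h2, h3, (estWedgesLight_recon hS hP hp).1 h4,
      (estEdgesLight_recon hS hP hs hM hcap hp).1 h5⟩
  · rintro ⟨h1, h2, h3, h4, h5⟩
    have hp := mem_pop_of_anchored hv h1 h3 hZ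
    exact ⟨isConfig_recon hS hp, (estValid_recon hS hp).2 h2, h3,
      (estWedgesLight_recon hS hP hp).2 h4, (estEdgesLight_recon hS hP hs hM hcap hp).2 h5⟩

lemma estHeavy_recon (hs : 0 ≤ V.s 0) (hM : 0 < V.MY)
    (hcap : V.s 0 * V.MY / V.P.δ + 1 < V.cap) (hc : c ∈ V.pop G)
    (ha : ∀ v, IsNodeOf c.cycle v → V.Anchored c v) :
    V.EstHeavy (recon S) c ↔ V.EstHeavy G c := by
  unfold EstHeavy
  refine or_congr (not_congr (estWedgesLight_recon hS hP hc)) (or_congr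
    (not_congr (estEdgesLight_recon hS hP hs hM hcap hc)) (exists_congr fun v =>
      and_congr_right fun hv => ?_))
  unfold estNode
  rw [nodeFamily_recon hS hP hs hM hcap (ha v hv)]

omit hS in
lemma mem_pop_of_relevant {q : Config n N} (hq : q.IsConfig G) (hin : AllIn V.r q)
    {c' : Config n N} (h : Relevant V.P q c') :
    c' ∈ V.pop G ∧ ∀ v, IsNodeOf c'.cycle v → V.Anchored c' v := by
  refine ⟨mem_filt.2 ⟨h.isConfig hq, Or.inl ⟨q, isConfig_top hq, hin, h⟩⟩, fun v hv => ?_⟩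
  have hv' : IsNodeOf q.cycle v := h.cycle_eq ▸ hv
  exact ⟨_, _, hin v hv', h.base_le hP hv'⟩

/-- The remembered edges suffice to compute the answers for `G`. -/
lemma estLLM_recon (hs : 0 ≤ V.s 0) (hM : 0 < V.MY)
    (hcap : V.s 0 * V.MY / V.P.δ + 1 < V.cap) {q : Config n N} (hq : q.IsConfig G)
    (hin : AllIn V.r q) : V.EstLLM (recon S) q ↔ V.EstLLM G q := by
  have key : ∀ c', Relevant V.P q c' → (V.EstHeavy (recon S) c' ↔ V.EstHeavy G c') := by
    intro c' h
    have h1 := mem_pop_of_relevant hP hq hin h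
    exact estHeavy_recon hS hP hs hM hcap h1.1 h1.2
  have hself := Relevant.refl hP q
  exact and_congr (not_congr (key q hself)) (and_congr (locMin_congr hP key)
    (estValid_recon hS (mem_pop_of_relevant hP hq hin hself).1))

end Env

end

section

variable {n N : ℕ} {P : Params} {G : SimpleGraph (Fin n)} {c : Config n N}

/-! ### Threshold decisions based on estimates -/

section Decision

variable {b s θ t t' γ : ℝ} (hθ : 0 ≤ θ) (ht : 0 ≤ t) (hs1 : 1 ≤ s) (hs2 : s ≤ 2) (hb1 : 1 < b)
  (hb2 : b ≤ 2) (hγ0 : 0 ≤ γ) (hγ : γ ≤ (b - 1) / 8) (h : |t' - t| ≤ γ * (t + θ))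

-- The margin needed is γ(s + b) ≤ s(b − 1); since s ≥ 1 and b ≤ 2, it follows from γ ≤ (b − 1)/8.
include hθ hs1 hb1 hb2 hγ0 hγ h in
lemma est_le_of_le (hlow : t * b ≤ θ * s) : t' ≤ s * θ := by
  have h1 := (abs_le.1 h).2
  have h2 : γ * (s + b) ≤ s * (b - 1) := by nlinarith
  have h3 : t' ≤ (1 + γ) * t + γ * θ := by linarith
  have h4 : ((1 + γ) * t + γ * θ) * b ≤ (s * θ) * b := by
    have h5 : (1 + γ) * (t * b) ≤ (1 + γ) * (θ * s) :=
      mul_le_mul_of_nonneg_left hlow (by linarith)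
    have h6 := mul_le_mul_of_nonneg_left h2 hθ
    nlinarith
  exact h3.trans (le_of_mul_le_mul_right h4 (by linarith))

include hθ hs1 hs2 hb1 hb2 hγ0 hγ h in
lemma lt_est_of_lt (hhigh : θ * s * b < t) : s * θ < t' := by
  have h1 := (abs_le.1 h).1
  have h3 : (1 - γ) * t - γ * θ ≤ t' := by linarith
  have h2 : γ * (s * b + 1) ≤ s * (b - 1) := by
    have : s * b + 1 ≤ 5 := by nlinarith
    nlinarith
  have h4 := mul_le_mul_of_nonneg_left h2 hθ
  have h5 : (1 - γ) * (θ * s * b) < (1 - γ) * t := mul_lt_mul_of_pos_left hhigh (by linarith)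
  nlinarith

/-- The shift `s` puts the threshold within a factor of `b` of `t`. -/
def Close (b s θ t : ℝ) : Prop := θ * s < t * b ∧ t ≤ θ * s * b

-- Outside a window of ratio b on either side of the threshold, the error is too small to carry the
-- estimate across it.
include hθ ht hs1 hs2 hb1 hb2 hγ0 hγ h in
lemma est_le_iff (hclose : ¬ Close b s θ t) : t' ≤ s * θ ↔ t ≤ s * θ := by
  have hsθ : 0 ≤ s * θ := by positivity
  by_cases h1 : t * b ≤ θ * s
  · refine iff_of_true (est_le_of_le hθ hs1 hb1 hb2 hγ0 hγ h h1) ?_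
    nlinarith
  · by_cases h2 : t ≤ θ * s * b
    · exact absurd ⟨not_le.1 h1, h2⟩ hclose
    · have h3 := lt_est_of_lt hθ hs1 hs2 hb1 hb2 hγ0 hγ h (not_le.1 h2)
      refine iff_of_false (not_le.2 h3) (not_le.2 ?_)
      nlinarith

end Decision

/-! ### Concentration for sampled families of configurations -/

/-- Capping a probability at 1 does no harm in the second moment: 1/p − 1 vanishes at the cap and is
otherwise below the inverse of the uncapped rate. -/
lemma one_div_min_sub_one {x : ℝ} (hx : 0 < x) :
    0 ≤ 1 / min 1 x - 1 ∧ 1 / min 1 x - 1 ≤ 1 / x := by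
  rcases le_total 1 x with h | h
  · rw [min_eq_left h]; simp; exact hx.le
  · rw [min_eq_right h]
    have : 1 ≤ 1 / x := by rw [one_le_div hx]; exact h
    exact ⟨by linarith, by linarith⟩

/-- Vertices are sampled at rate `M`. -/
def rateDist (P : Params) (M : ℝ) (n N : ℕ) : FinProb (SetCoins n N) :=
  FinProb.bern fun i : Fin N × Label × Fin n => rate P M (i.1 : ℕ) i.2.1

lemma rate_pos (hP : P.Good) {M : ℝ} (hM : 0 < M) (k : ℤ) (l : Label) :
    0 < (rate P M k l : ℝ) := by
  rw [coe_rate hP hM.le]; exact lt_min one_pos (mul_pos hM (hP.base_pos k l))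

/-- The nodes in V₀ are fixed, the others are sampled. In the bound for configurations through V₀ ∪
U the rates of U cancel against the sampling rates, and for nonempty U at least one factor 1/M
remains. The constant is 4096 = 2⁴·256. -/
lemma chebyshev_config (hP : P.Good) {M : ℝ} (hM : 1 ≤ M) (C : Finset (Config n N)) (k : Fin N)
    (ℓ : Fin n → Label) (V₀ : Finset (Fin n)) (q : ℝ)
    (hC : ∀ c ∈ C, c.scale = k ∧ c.IsConfig G ∧ ∀ v ∈ V₀, IsNodeOf c.cycle v ∧ c.label v = ℓ v)
    (hq : ∀ c ∈ C, ∏ u ∈ nodeSet c.cycle \ V₀, (rate P M (k : ℕ) (c.label u) : ℝ) = q)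
    (hshare : ∀ c ∈ C, ∀ W, V₀ ⊂ W → W ⊆ nodeSet c.cycle →
      ((C.filter fun c' => c' ∈ sharing G c W).card : ℝ) ≤
        256 / P.δ ^ 2 * (P.T * ∏ v ∈ W, P.base (k : ℕ) (c.label v)))
    {γ θ : ℝ} (hγ : 0 < γ) (hθ : 0 < θ) (hle : P.T * ∏ v ∈ V₀, P.base (k : ℕ) (ℓ v) ≤ θ) :
    (rateDist P M n N).Pr (fun ω => γ * (C.card + θ) <
      |((C.filter fun c => ∀ u ∈ nodeSet c.cycle \ V₀, ω (k, c.label u, u) = true).card : ℝ) / q -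
        C.card|) ≤ 4096 / (P.δ ^ 2 * M * γ ^ 2) := by
  have hM0 : 0 < M := by linarith
  have hδ := hP.δ_pos
  have hT := hP.T_pos
  have hinj : ∀ c : Config n N, Function.Injective fun u : Fin n => (k, c.label u, u) := by
    intro c u u' h; simp only [Prod.mk.injEq] at h; exact h.2.2
  set J : Config n N → Finset (Fin N × Label × Fin n) := fun c =>
    (nodeSet c.cycle \ V₀).image fun u => (k, c.label u, u) with hJ
  set B := 256 / P.δ ^ 2 * θ / M with hB
  have hbase : ∀ (c : Config n N) (W : Finset (Fin n)),
      0 < ∏ v ∈ W, P.base (k : ℕ) (c.label v) := fun c W =>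
    Finset.prod_pos fun v _ => hP.base_pos _ _
  have hmain := FinProb.chebyshev_family (fun i : Fin N × Label × Fin n =>
    rate P M (i.1 : ℕ) i.2.1) C J q B γ θ 4
    (fun c _ i _ => rate_pos hP hM0 _ _)
    (fun c hc => by
      rw [← hq c hc, hJ, Finset.prod_image fun u _ u' _ h => hinj c h])
    (fun c hc => by
      refine Finset.card_image_le.trans ((Finset.card_le_card Finset.sdiff_subset).trans ?_)
      exact (card_nodeSet (hC c hc).2.1.1).le)
    (fun c hc W hW hne => by
      obtain ⟨U, hU, rfl⟩ := Finset.subset_image_iff.1 hW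
      obtain ⟨hk, hcG, hV⟩ := hC c hc
      have hUne : U.Nonempty := by simpa using hne
      have hdisj : Disjoint V₀ U := by
        rw [Finset.disjoint_left]
        intro x hx hxU
        exact (Finset.mem_sdiff.1 (hU hxU)).2 hx
      rw [Finset.prod_image fun u _ u' _ h => hinj c h]
      have h1 : ∏ u ∈ U, (1 / (rate P M (k : ℕ) (c.label u) : ℝ) - 1) ≤
          ∏ u ∈ U, 1 / (M * P.base (k : ℕ) (c.label u)) := by
        refine Finset.prod_le_prod (fun u _ => ?_) fun u _ => ?_ <;>
          rw [coe_rate hP hM0.le]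
        exacts [(one_div_min_sub_one (mul_pos hM0 (hP.base_pos _ _))).1,
          (one_div_min_sub_one (mul_pos hM0 (hP.base_pos _ _))).2]
      have h2 : ((C.filter fun c' => U.image (fun u => (k, c.label u, u)) ⊆ J c').card : ℝ) ≤
          256 / P.δ ^ 2 * (P.T * ∏ v ∈ V₀ ∪ U, P.base (k : ℕ) (c.label v)) := by
        refine le_trans ?_ (hshare c hc (V₀ ∪ U) ?_ ?_)
        · norm_cast
          refine Finset.card_le_card fun c' hc' => ?_
          rw [Finset.mem_filter] at hc' ⊢
          obtain ⟨h3, h4, h5⟩ := hC c' hc'.1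
          refine ⟨hc'.1, mem_filt.2 ⟨h3.trans hk.symm, h4, fun v hv => ?_⟩⟩
          rcases Finset.mem_union.1 hv with hv | hv
          · exact ⟨(h5 v hv).1, (h5 v hv).2.trans (hV v hv).2.symm⟩
          · have h6 := hc'.2 (Finset.mem_image_of_mem _ hv)
            obtain ⟨u', hu', h7⟩ := Finset.mem_image.1 h6
            simp only [Prod.mk.injEq] at h7
            obtain ⟨-, h8, rfl⟩ := h7
            exact ⟨by simpa using (Finset.mem_sdiff.1 hu').1, h8⟩
        · rw [Finset.ssubset_iff_subset_ne]
          refine ⟨Finset.subset_union_left, fun heq => ?_⟩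
          obtain ⟨x, hx⟩ := hUne
          exact Finset.disjoint_left.1 hdisj (heq ▸ Finset.mem_union_right _ hx) hx
        · refine Finset.union_subset (fun v hv => ?_) (hU.trans Finset.sdiff_subset)
          simpa using (hV v hv).1
      refine (mul_le_mul h1 h2 (by positivity) (Finset.prod_nonneg fun u _ =>
        (one_div_pos.2 (mul_pos hM0 (hP.base_pos _ _))).le)).trans ?_
      have e1 : ∏ v ∈ V₀, P.base (k : ℕ) (c.label v) = ∏ v ∈ V₀, P.base (k : ℕ) (ℓ v) :=
        Finset.prod_congr rfl fun v hv => by rw [(hV v hv).2]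
      rw [Finset.prod_union hdisj, e1, Finset.prod_div_distrib, Finset.prod_mul_distrib,
        Finset.prod_const_one,
        Finset.prod_const]
      have h3 : M ≤ M ^ U.card := by
        calc M = M ^ 1 := (pow_one M).symm
          _ ≤ M ^ U.card := pow_le_pow_right₀ hM (Finset.card_pos.2 hUne)
      have h4 := hbase c U
      have h5 : 1 / (M ^ U.card * ∏ u ∈ U, P.base (k : ℕ) (c.label u)) *
          (256 / P.δ ^ 2 * (P.T * ((∏ v ∈ V₀, P.base (k : ℕ) (ℓ v)) *
            ∏ v ∈ U, P.base (k : ℕ) (c.label v)))) =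
          256 / P.δ ^ 2 * (P.T * ∏ v ∈ V₀, P.base (k : ℕ) (ℓ v)) / M ^ U.card := by
        field_simp
      rw [h5, hB]
      have h6 : 256 / P.δ ^ 2 * (P.T * ∏ v ∈ V₀, P.base (k : ℕ) (ℓ v)) ≤
          256 / P.δ ^ 2 * θ := mul_le_mul_of_nonneg_left hle (by positivity)
      exact div_le_div₀ (by positivity) h6 hM0 h3)
    (by positivity) hγ hθ
  have heq : ∀ ω : SetCoins n N, (C.filter fun c => ∀ i ∈ J c, ω i = true) =
      C.filter fun c => ∀ u ∈ nodeSet c.cycle \ V₀, ω (k, c.label u, u) = true := by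
    intro ω
    refine Finset.filter_congr fun c _ => ?_
    simp only [hJ, Finset.forall_mem_image]
  simp only [heq] at hmain
  refine hmain.trans (le_of_eq ?_)
  rw [hB]
  field_simp
  norm_num

end

section

variable {n N : ℕ} {P : Params} {G : SimpleGraph (Fin n)} {c : Config n N}

/-! ### Families of configurations with light parts, and their samples -/

/-- The configurations with wedges light at level `σ` that contain a labeled edge. -/
def edgeLight (P : Params) (G : SimpleGraph (Fin n)) (σ : ℝ) (u v : Fin n) (k : Fin N)
    (ℓ : Fin n → Label) : Finset (Config n N) :=
  filt fun c => c.IsConfig G ∧ c.Has (.edge u v) k ℓ ∧ WedgesLight P σ G c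

lemma refinedEdge_eq {s : ℝ} {u v : Fin n} {k : Fin N} {ℓ : Fin n → Label}
    (h : numOnes (.edge u v) ℓ = 0) :
    refinedEdge P s G u v k ℓ = (edgeLight P G s u v k ℓ).card := by
  rw [refinedEdge, if_pos h, ncard_eq_card_filt]; rfl

/-- The configurations that are counted in the refined heaviness of a node. -/
def nodeLight (P : Params) (G : SimpleGraph (Fin n)) (s₁ s₂ : ℝ) (v : Fin n) (k : Fin N)
    (ℓ : Fin n → Label) : Finset (Config n N) :=
  filt fun c => c.IsConfig G ∧ IsValid P s₂ G c ∧ c.Has (.node v) k ℓ ∧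
    WedgesLight P s₁ G c ∧ EdgesLight P s₁ s₂ G c

lemma refinedNode_eq {s₁ s₂ : ℝ} {v : Fin n} {k : Fin N} {ℓ : Fin n → Label} :
    refinedNode P s₁ s₂ G v k ℓ = (nodeLight P G s₁ s₂ v k ℓ).card := by
  rw [refinedNode, ncard_eq_card_filt]; rfl

/-- The sampled part of `edgeLight` misrepresents its size. -/
def EdgeDeviates (P : Params) (M : ℝ) (G : SimpleGraph (Fin n)) (γ σ : ℝ) (u v : Fin n)
    (k : Fin N) (ℓ : Fin n → Label) (Y : SetCoins n N) : Prop :=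
  γ * ((edgeLight P G σ u v k ℓ).card + threshold P (.edge u v) k ℓ) <
    |(((edgeLight P G σ u v k ℓ).filter fun c => Y (k, .R1a, c.x) = true ∧
      Y (k, .R1b, c.y) = true).card : ℝ) / (rate P M (k : ℕ) .R1a * rate P M (k : ℕ) .R1b) -
        (edgeLight P G σ u v k ℓ).card|

/-- The sampled part of `nodeLight` misrepresents its size. -/
def NodeDeviates (P : Params) (M : ℝ) (G : SimpleGraph (Fin n)) (γ s₁ s₂ : ℝ) (v : Fin n)
    (k : Fin N) (ℓ : Fin n → Label) (Z : SetCoins n N) : Prop :=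
  γ * ((nodeLight P G s₁ s₂ v k ℓ).card + threshold P (.node v) k ℓ) <
    |(((nodeLight P G s₁ s₂ v k ℓ).filter fun c => ∀ u, IsNodeOf c.cycle u → u ≠ v →
      Z (k, c.label u, u) = true).card : ℝ) / nodeRate P M (k : ℕ) (ℓ v) -
        (nodeLight P G s₁ s₂ v k ℓ).card|

lemma threshold_pos (hP : P.Good) (k : Fin N) (ℓ : Fin n → Label) (s : Substructure n) :
    0 < threshold P s k ℓ := by
  have h1 := hP.sqrt_pos
  have h2 := hP.κ_pos (k : ℕ)
  have h4 := hP.δ_pos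
  have h5 := hP.T_pos
  cases s <;> simp only [threshold] <;> split_ifs <;> positivity

lemma numOnes_edge_congr {ℓ ℓ' : Fin n → Label} {u v : Fin n} (h1 : ℓ u = ℓ' u)
    (h2 : ℓ v = ℓ' v) : numOnes (.edge u v) ℓ = numOnes (.edge u v) ℓ' := by
  simp only [numOnes, Substructure.nodes, List.countP_cons, List.countP_nil, h1, h2]

/-- The fixed edge provides two common nodes, so every further overlap has at least three; lightness
of wedges is enough to control these. -/
lemma Pr_edgeDeviates_le (hP : P.Good) {M : ℝ} (hM : 1 ≤ M) {γ σ : ℝ} (hγ : 0 < γ)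
    (hσ : 0 ≤ σ) (hσ4 : σ ≤ 4) {u v : Fin n} (huv : u ≠ v) (k : Fin N) {ℓ : Fin n → Label}
    (h0 : numOnes (.edge u v) ℓ = 0) :
    (rateDist P M n N).Pr (EdgeDeviates P M G γ σ u v k ℓ) ≤ 4096 / (P.δ ^ 2 * M * γ ^ 2) := by
  have form : ∀ c ∈ edgeLight P G σ u v k ℓ, c.scale = k ∧ c.IsConfig G ∧
      WedgesLight P σ G c ∧ s(u, v) ∈ c.cycle ∧ ℓ u = c.label u ∧ ℓ v = c.label v ∧
      c.label c.x = .R1a ∧ c.label c.y = .R1b ∧ c.x ≠ c.y ∧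
      nodeSet c.cycle \ {u, v} = {c.x, c.y} := by
    intro c hc
    obtain ⟨hG, ⟨hk, hin, hl⟩, hw⟩ := mem_filt.1 hc
    have h1 : ℓ u = c.label u := hl u (by simp [Substructure.nodes])
    have h2 : ℓ v = c.label v := hl v (by simp [Substructure.nodes])
    obtain ⟨p, q, hpq, hcyc, e, lx, ly, -, -⟩ := c.exists_form_edge hG hin
      ((numOnes_edge_congr h1 h2).symm.trans h0)
    refine ⟨hk, hG, hw, hin, h1, h2, lx, ly, hcyc.ab.ne, ?_⟩
    rw [e, nodeSet_cyc]
    have := hcyc.bc.ne; have := hcyc.da.ne; have := hcyc.ac; have := hcyc.bd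
    ext z
    simp only [Finset.mem_sdiff, Finset.mem_insert, Finset.mem_singleton]
    rcases hpq with ⟨rfl, rfl⟩ | ⟨rfl, rfl⟩ <;> grind
  have hmain := chebyshev_config (G := G) hP hM (edgeLight P G σ u v k ℓ) k ℓ {u, v}
    (rate P M (k : ℕ) .R1a * rate P M (k : ℕ) .R1b)
    (fun c hc => by
      obtain ⟨hk, hG, -, hin, h1, h2, -⟩ := form c hc
      have hn := isNodeOf_of_mem hin
      refine ⟨hk, hG, fun w hw => ?_⟩
      rcases Finset.mem_insert.1 hw with rfl | hw
      · exact ⟨hn.1, h1.symm⟩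
      · rw [Finset.mem_singleton.1 hw]; exact ⟨hn.2, h2.symm⟩)
    (fun c hc => by
      obtain ⟨hk, hG, -, hin, h1, h2, lx, ly, hne, hs⟩ := form c hc
      rw [hs, Finset.prod_pair hne, lx, ly])
    (fun c hc W hW hWs => by
      obtain ⟨hk, hG, hw, -⟩ := form c hc
      have hcard : 2 < W.card := by
        have := Finset.card_lt_card hW
        rwa [Finset.card_pair huv] at this
      refine le_trans ?_ (hk ▸ card_sharing_le hP hG hσ hσ4 hw hWs hcard.le ?_)
      · norm_cast
        exact Finset.card_le_card fun c' hc' => (Finset.mem_filter.1 hc').2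
      · rintro a b rfl hab
        rw [Finset.card_pair hab] at hcard
        omega)
    hγ (threshold_pos hP k ℓ (.edge u v))
    (by
      rw [threshold_edge hP, Finset.prod_pair huv, ← mul_assoc, le_div_iff₀ (by
        have := hP.δ_pos; positivity)]
      have h1 := hP.base_pos (k : ℕ) (ℓ u)
      have h2 := hP.base_pos (k : ℕ) (ℓ v)
      have h3 := hP.T_pos
      exact mul_le_of_le_one_right (by positivity) (pow_le_one₀ hP.δ_pos.le hP.δ_le))
  refine le_trans (FinProb.Pr_mono _ fun Y hY => ?_) hmain
  unfold EdgeDeviates at hY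
  convert hY using 6
  refine Finset.filter_congr fun c hc => ?_
  obtain ⟨hk, hG, -, hin, h1, h2, lx, ly, hne, hs⟩ := form c hc
  rw [hs]
  simp [lx, ly]

/-- Among the other three nodes one has the type of v and two have the other type, so the product
depends on the label of v only. -/
lemma prod_rate_nodeSet (hc : c.IsConfig G) {v : Fin n} (hv : IsNodeOf c.cycle v) (M : ℝ)
    (k : ℤ) : ∏ u ∈ nodeSet c.cycle \ {v}, (rate P M k (c.label u) : ℝ) =
      nodeRate P M k (c.label v) := by
  obtain ⟨b, d, e, h, hA⟩ := exists_cyc_of_node hc.1 hv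
  obtain ⟨z, hz, hzA, hpat⟩ := c.exists_form_wedge hc (hA ▸ wedge_in_cyc h)
  have hset : nodeSet c.cycle \ {v} = {b, d, z} := by
    rw [hzA, nodeSet_cyc]
    have := hz.ab.ne; have := hz.ac; have := hz.da.ne
    ext w
    simp only [Finset.mem_sdiff, Finset.mem_insert, Finset.mem_singleton]
    grind
  rw [hset, Finset.prod_insert (by have := hz.bc.ne; have := hz.bd; simp; tauto),
    Finset.prod_pair hz.cd.ne]
  have e1 : rate P M k .R1a = rate P M k .S1 := rfl
  have e2 : rate P M k .R1b = rate P M k .S1 := rfl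
  have e3 : rate P M k .R2a = rate P M k .S2 := rfl
  have e4 : rate P M k .R2b = rate P M k .S2 := rfl
  rcases hpat.cases with h | h | h | h | h | h | h | h | h | h <;> obtain ⟨h1, h2, h3, h4⟩ := h <;>
    rw [h1, h2, h3, h4] <;> simp only [nodeRate, Label.isOne, if_true, Bool.false_eq_true,
      if_false, e1, e2, e3, e4] <;> ring

/-- With one fixed node, overlaps in two adjacent nodes occur as well; this is where lightness of
the edges is needed. -/
lemma Pr_nodeDeviates_le (hP : P.Good) {M : ℝ} (hM : 1 ≤ M) {γ s₁ s₂ : ℝ} (hγ : 0 < γ)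
    (hs1 : 0 ≤ s₁) (hs14 : s₁ ≤ 4) (hs24 : s₂ ≤ 4) (v : Fin n) (k : Fin N)
    (ℓ : Fin n → Label) :
    (rateDist P M n N).Pr (NodeDeviates P M G γ s₁ s₂ v k ℓ) ≤ 4096 / (P.δ ^ 2 * M * γ ^ 2) := by
  have form : ∀ c ∈ nodeLight P G s₁ s₂ v k ℓ, c.scale = k ∧ c.IsConfig G ∧
      WedgesLight P s₁ G c ∧ EdgesLight P s₁ s₂ G c ∧ IsNodeOf c.cycle v ∧ ℓ v = c.label v := by
    intro c hc
    obtain ⟨hG, -, ⟨hk, hin, hl⟩, hw, he⟩ := mem_filt.1 hc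
    exact ⟨hk, hG, hw, he, hin, hl v (by simp [Substructure.nodes])⟩
  have hmain := chebyshev_config (G := G) hP hM (nodeLight P G s₁ s₂ v k ℓ) k ℓ {v}
    (nodeRate P M (k : ℕ) (ℓ v))
    (fun c hc => by
      obtain ⟨hk, hG, -, -, hin, h1⟩ := form c hc
      refine ⟨hk, hG, fun w hw => ?_⟩
      rw [Finset.mem_singleton.1 hw]; exact ⟨hin, h1.symm⟩)
    (fun c hc => by
      obtain ⟨hk, hG, -, -, hin, h1⟩ := form c hc
      rw [h1]; exact prod_rate_nodeSet hG hin M _)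
    (fun c hc W hW hWs => by
      obtain ⟨hk, hG, hw, he, -⟩ := form c hc
      have hcard : 1 < W.card := by
        have := Finset.card_lt_card hW
        rwa [Finset.card_singleton] at this
      refine le_trans ?_ (hk ▸ card_sharing_inter_le hP hG hs1 hs14 hs24 hw he hWs hcard)
      norm_cast
      refine Finset.card_le_card fun c' hc' => ?_
      rw [Finset.mem_filter] at hc' ⊢
      exact ⟨hc'.2, (form c' hc'.1).2.2.1⟩)
    hγ (threshold_pos hP k ℓ (.node v))
    (by
      rw [threshold_node hP, Finset.prod_singleton, le_div_iff₀
        (Real.rpow_pos_of_pos hP.δ_pos _)]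
      have h1 := hP.base_pos (k : ℕ) (ℓ v)
      have h3 := hP.T_pos
      exact mul_le_of_le_one_right (by positivity)
        (Real.rpow_le_one hP.δ_pos.le hP.δ_le (by norm_num)))
  refine le_trans (FinProb.Pr_mono _ fun Z hZ => ?_) hmain
  unfold NodeDeviates at hZ
  convert hZ using 6
  refine Finset.filter_congr fun c hc => ?_
  simp

end

section

variable {n N : ℕ} {P : Params} {G : SimpleGraph (Fin n)} {c : Config n N}

/-! ### Correctness of the estimates outside of the bad events -/

/-- The number of configurations with light wedges jumps at level `s`. -/
def Jumps (P : Params) (G : SimpleGraph (Fin n)) (b η s : ℝ) (u v : Fin n) (k : Fin N)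
    (ℓ : Fin n → Label) : Prop :=
  (1 + η) * ((edgeLight P G (s / b) u v k ℓ).card + threshold P (.edge u v) k ℓ) <
    (edgeLight P G (s * b) u v k ℓ).card + threshold P (.edge u v) k ℓ

/-- The bad event for the decisions on wedges, edges and validity of a configuration. -/
def BadConfig (P : Params) (M : ℝ) (G : SimpleGraph (Fin n)) (b s : Fin 3 → ℝ) (η γ : ℝ)
    (c : Config n N) (Y : SetCoins n N) : Prop :=
  (∃ a w d, (Substructure.wedge a w d).In c.cycle ∧
    Close (b 0) (s 0) (threshold P (.wedge a w d) c.scale c.label) (heaviness G (.wedge a w d))) ∨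
  (∃ u v, s(u, v) ∈ c.cycle ∧
    (Close (b 1) (s 1) (threshold P (.edge u v) c.scale c.label)
      (refinedEdge P (s 0) G u v c.scale c.label) ∨
    (numOnes (.edge u v) c.label = 0 ∧ (Jumps P G (b 0) η (s 0) u v c.scale c.label ∨
      EdgeDeviates P M G γ (s 0 / b 0) u v c.scale c.label Y ∨
      EdgeDeviates P M G γ (s 0 * b 0) u v c.scale c.label Y)))) ∨
  Close (b 1) (s 1) (√P.T / P.δ ^ 2) (heaviness G (.edge c.x c.y))

/-- The bad event for the decision on a node of a configuration. -/
def BadNode (P : Params) (M : ℝ) (G : SimpleGraph (Fin n)) (b s : Fin 3 → ℝ) (γ : ℝ)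
    (c : Config n N) (v : Fin n) (Z : SetCoins n N) : Prop :=
  NodeDeviates P M G γ (s 0) (s 1) v c.scale c.label Z ∨
    Close (b 2) (s 2) (threshold P (.node v) c.scale c.label)
      (refinedNode P (s 0) (s 1) G v c.scale c.label)

lemma WedgesLight.mono {σ σ' : ℝ} (hP : P.Good) (h : σ ≤ σ') (hl : WedgesLight P σ G c) :
    WedgesLight P σ' G c := fun a w b hin =>
  (hl a w b hin).trans (mul_le_mul_of_nonneg_right h (threshold_nonneg hP _ _ _))

lemma edgeLight_mono {σ σ' : ℝ} (hP : P.Good) (h : σ ≤ σ') (u v : Fin n) (k : Fin N)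
    (ℓ : Fin n → Label) : edgeLight P G σ u v k ℓ ⊆ edgeLight P G σ' u v k ℓ := by
  intro c hc
  obtain ⟨h1, h2, h3⟩ := mem_filt.1 hc
  exact mem_filt.2 ⟨h1, h2, h3.mono hP h⟩

lemma refinedEdge_nonneg {s : ℝ} {u v : Fin n} {k : Fin N} {ℓ : Fin n → Label} :
    0 ≤ refinedEdge P s G u v k ℓ := by
  unfold refinedEdge
  split_ifs
  · positivity
  · exact heaviness_nonneg _

namespace Env

variable (V : Env n N)

/-- All estimates for numbers of common neighbours are accurate. -/
def GoodWedges (G : SimpleGraph (Fin n)) (γ : ℝ) : Prop :=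
  ∀ (k : Fin N) l a b, |((V.probes G k l a b).card : ℝ) / rate V.P V.MY (k : ℕ) l -
    (commonNbrs G a b).card| ≤ γ * ((commonNbrs G a b).card + 1 / V.P.base (k : ℕ) l)

/-- All estimates for the heaviness of an edge are accurate. -/
def GoodEdges (G : SimpleGraph (Fin n)) (γ : ℝ) : Prop :=
  ∀ u v, |V.estEdge G u v - heaviness G (.edge u v)| ≤
    γ * (heaviness G (.edge u v) + √V.P.T)

variable {V} (hP : V.P.Good) {b : Fin 3 → ℝ} {η γ₀ γ₁ γ : ℝ}

/-- The relations between the parameters that the analysis needs. -/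
structure Accurate (V : Env n N) (G : SimpleGraph (Fin n)) (b : Fin 3 → ℝ) (η γ₀ γ₁ γ γ₂ : ℝ) :
    Prop where
  scales : N = V.P.numScales
  s_ge : ∀ i, 1 ≤ V.s i
  s_le : ∀ i, V.s i ≤ 2
  b_gt : ∀ i, 1 < b i
  b_le : ∀ i, b i ≤ 2
  γ₀_nonneg : 0 ≤ γ₀
  γ₀_le : 3 * γ₀ ≤ (b 0 - 1) / 8
  γ₁_nonneg : 0 ≤ γ₁
  γ₁_le : γ₁ ≤ (b 1 - 1) / 8
  γ_nonneg : 0 ≤ γ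
  η_nonneg : 0 ≤ η
  η_le : η ≤ 1
  γ_le : η + 2 * γ ≤ (b 1 - 1) / 8
  γ₂_nonneg : 0 ≤ γ₂
  γ₂_le : γ₂ ≤ (b 2 - 1) / 8
  wedges : V.GoodWedges G γ₀
  edges : V.GoodEdges G γ₁

variable {γ₂ : ℝ} (hA : V.Accurate G b η γ₀ γ₁ γ γ₂)
include hP hA

/-- The error for common neighbours is γ₀(t + 1 + 1/β). The centre costs 1 ≤ 2/β because β ≤ 2, and
1/β is at most the threshold; hence the factor 3. -/
lemma estWedge_accurate (hc : c.IsConfig G) {a w d : Fin n}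
    (hin : (Substructure.wedge a w d).In c.cycle) :
    |V.estWedge G c.scale (c.label a).probe a d - heaviness G (.wedge a w d)| ≤
      3 * γ₀ * (heaviness G (.wedge a w d) +
        threshold V.P (.wedge a w d) c.scale c.label) := by
  obtain ⟨z, hz, ez, hl⟩ := c.exists_form_wedge hc hin
  have h1 := hA.wedges c.scale (c.label a).probe a d
  have h2 := heaviness_wedge hz.ac hz.ab hz.bc
  have h3 := threshold_wedge_config hP hc hin
  have h4 := hl.one_le_base_mul_probe hP (c.scale : ℕ)
  have h5 := hP.base_le_two (c.scale : ℕ) (hA.scales ▸ c.scale.2) (c.label a).probe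
  have h6 := hP.base_pos (c.scale : ℕ) (c.label a).probe
  set β := V.P.base (c.scale : ℕ) (c.label a).probe
  set θ := threshold V.P (.wedge a w d) c.scale c.label
  set t := heaviness G (.wedge a w d)
  have ht : 0 ≤ t := heaviness_nonneg _
  have hδ := hP.δ_pos
  have hθ : 1 / β ≤ θ := by
    rw [h3, div_le_div_iff₀ h6 hδ]
    have : V.P.T * V.P.base (c.scale : ℕ) (c.label a) * V.P.base (c.scale : ℕ) (c.label w) *
      V.P.base (c.scale : ℕ) (c.label d) * β = V.P.T * (V.P.base (c.scale : ℕ) (c.label a) *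
        V.P.base (c.scale : ℕ) (c.label w) * V.P.base (c.scale : ℕ) (c.label d) * β) := by ring
    rw [this]
    linarith [hP.δ_le]
  have h7 : 1 / 2 ≤ 1 / β := one_div_le_one_div_of_le h6 h5
  rw [← h2] at h1
  have e : V.estWedge G c.scale (c.label a).probe a d - t =
      ((V.probes G c.scale (c.label a).probe a d).card : ℝ) /
        rate V.P V.MY (c.scale : ℕ) (c.label a).probe - (t + 1) := by
    unfold estWedge; ring
  rw [e]
  refine h1.trans ?_
  have : t + 1 + 1 / β ≤ 3 * (t + θ) := by linarith
  have := mul_le_mul_of_nonneg_left this hA.γ₀_nonneg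
  linarith

/-- With the next lemma this puts estimated lightness between lightness at levels s₁/b and s₁b, for
every configuration and every shift. No assumption on closeness is made. -/
lemma estWedgesLight_of_wedgesLight (hc : c.IsConfig G)
    (h : WedgesLight V.P (V.s 0 / b 0) G c) : V.EstWedgesLight G c := by
  intro a w d hin
  have hb := hA.b_gt 0
  refine est_le_of_le (threshold_nonneg hP _ _ _) (hA.s_ge 0) (hA.b_gt 0) (hA.b_le 0)
    (by linarith [hA.γ₀_nonneg]) hA.γ₀_le (estWedge_accurate hP hA hc hin) ?_
  have h1 := h a w d hin
  rw [div_mul_eq_mul_div, le_div_iff₀ (by linarith)] at h1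
  linarith

lemma wedgesLight_of_estWedgesLight (hc : c.IsConfig G) (h : V.EstWedgesLight G c) :
    WedgesLight V.P (V.s 0 * b 0) G c := by
  intro a w d hin
  by_contra hcon
  rw [not_le] at hcon
  refine absurd (h a w d hin) (not_le.2 (lt_est_of_lt (threshold_nonneg hP _ _ _) (hA.s_ge 0)
    (hA.s_le 0) (hA.b_gt 0) (hA.b_le 0) (by linarith [hA.γ₀_nonneg]) hA.γ₀_le
    (estWedge_accurate hP hA hc hin) ?_))
  linarith

-- It absorbs the additive error √T of `GoodEdges` into the threshold.
omit hA in
lemma sqrt_le_threshold_edge {u v : Fin n} (k : Fin N) (ℓ : Fin n → Label)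
    (h : numOnes (.edge u v) ℓ ≠ 0) : √V.P.T ≤ threshold V.P (.edge u v) k ℓ := by
  have hδ := hP.δ_pos
  have hs := hP.sqrt_pos
  have hd : ∀ x : ℝ, √V.P.T ≤ x → √V.P.T ≤ x / V.P.δ ^ 2 := by
    intro x hx
    rw [le_div_iff₀ (by positivity)]
    have : V.P.δ ^ 2 ≤ 1 := pow_le_one₀ hδ.le hP.δ_le
    nlinarith
  have h2 : numOnes (.edge u v) ℓ ≤ 2 := List.countP_le_length
  simp only [threshold]
  split_ifs with h3 h4
  · refine hd _ ?_
    rw [sq]; exact hP.sqrt_le_κ_sq _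
  · exact hd _ le_rfl
  · omega

/-- Both the sampling and the wedge decisions in the edge family use Y, so its size cannot be
treated by a second moment directly. It lies between the samples from the families at levels s₁/b
and s₁b, which do not depend on Y. These concentrate, and without a jump their sizes, with the
threshold added, agree up to a factor 1 + η. -/
lemma estRefinedEdge_accurate {u v : Fin n} (k : Fin N) (ℓ : Fin n → Label)
    (h : numOnes (.edge u v) ℓ = 0 → ¬ (Jumps V.P G (b 0) η (V.s 0) u v k ℓ ∨
      EdgeDeviates V.P V.MY G γ (V.s 0 / b 0) u v k ℓ V.Y ∨
      EdgeDeviates V.P V.MY G γ (V.s 0 * b 0) u v k ℓ V.Y)) (hM : 0 < V.MY) :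
    |V.estRefinedEdge G u v k ℓ - refinedEdge V.P (V.s 0) G u v k ℓ| ≤
      ((b 1 - 1) / 8) * (refinedEdge V.P (V.s 0) G u v k ℓ +
        threshold V.P (.edge u v) k ℓ) := by
  have hθ : 0 ≤ threshold V.P (.edge u v) k ℓ := threshold_nonneg hP _ _ _
  by_cases h0 : numOnes (.edge u v) ℓ = 0
  · have h1 := h h0
    push Not at h1
    obtain ⟨hj, hlo, hhi⟩ := h1
    rw [refinedEdge_eq h0, estRefinedEdge, if_pos h0]
    unfold Jumps at hj
    unfold EdgeDeviates at hlo hhi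
    rw [not_lt] at hj hlo hhi
    have hb := hA.b_gt 0
    have hs0 := hA.s_ge 0
    have hr := mul_pos (rate_pos hP hM (k : ℕ) .R1a) (rate_pos hP hM (k : ℕ) .R1b)
    set ρ := (rate V.P V.MY (k : ℕ) .R1a * rate V.P V.MY (k : ℕ) .R1b : ℝ)
    set θ := threshold V.P (.edge u v) k ℓ
    set A := edgeLight V.P G (V.s 0 / b 0) u v k ℓ
    set B := edgeLight V.P G (V.s 0 * b 0) u v k ℓ
    set C := edgeLight V.P G (V.s 0) u v k ℓ
    set F := V.edgeFamily G u v k ℓ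
    have hAC : (A.card : ℝ) ≤ C.card := by
      exact_mod_cast Finset.card_le_card (edgeLight_mono hP (by
        rw [div_le_iff₀ (by linarith)]; nlinarith) _ _ _ _)
    have hCB : (C.card : ℝ) ≤ B.card := by
      exact_mod_cast Finset.card_le_card (edgeLight_mono hP (by nlinarith) _ _ _ _)
    have hAF : ((A.filter fun c => V.Y (k, .R1a, c.x) = true ∧
        V.Y (k, .R1b, c.y) = true).card : ℝ) / ρ ≤ F.card / ρ := by
      refine div_le_div_of_nonneg_right ?_ hr.le
      norm_cast
      refine Finset.card_le_card fun c hc => ?_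
      obtain ⟨h1, h2⟩ := Finset.mem_filter.1 hc
      obtain ⟨h3, h4, h5⟩ := mem_filt.1 h1
      exact mem_filt.2 ⟨h3, h4, estWedgesLight_of_wedgesLight hP hA h3 h5, h2⟩
    have hFB : (F.card : ℝ) / ρ ≤ ((B.filter fun c => V.Y (k, .R1a, c.x) = true ∧
        V.Y (k, .R1b, c.y) = true).card : ℝ) / ρ := by
      refine div_le_div_of_nonneg_right ?_ hr.le
      norm_cast
      refine Finset.card_le_card fun c hc => ?_
      obtain ⟨h1, h2, h3, h4⟩ := mem_filt.1 hc
      exact Finset.mem_filter.2 ⟨mem_filt.2 ⟨h1, h2, wedgesLight_of_estWedgesLight hP hA h1 h3⟩, h4⟩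
    have l1 := (abs_le.1 hlo).1
    have l2 := (abs_le.1 hhi).2
    have hη := hA.η_nonneg
    have hη1 := hA.η_le
    have hγ := hA.γ_nonneg
    have hγ' := hA.γ_le
    have hC0 : (0 : ℝ) ≤ C.card + θ := by positivity
    have m1 : (1 + η) * (A.card + θ) ≤ (1 + η) * (C.card + θ) :=
      mul_le_mul_of_nonneg_left (by linarith) (by linarith)
    have m2 : (B.card : ℝ) + θ ≤ (1 + η) * (C.card + θ) := hj.trans m1
    have m3 : (1 - η) * (C.card + θ) ≤ A.card + θ := by
      have h7 : (1 - η) * (C.card + θ) ≤ (1 - η) * ((1 + η) * (A.card + θ)) :=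
        mul_le_mul_of_nonneg_left (by linarith) (by linarith)
      have h8 : (0 : ℝ) ≤ A.card + θ := by positivity
      nlinarith [mul_nonneg (mul_nonneg hη hη) h8]
    have m4 : γ * (B.card + θ) ≤ γ * (2 * (C.card + θ)) :=
      mul_le_mul_of_nonneg_left (m2.trans (mul_le_mul_of_nonneg_right (by linarith) hC0)) hγ
    have m5 : γ * (A.card + θ) ≤ γ * (C.card + θ) :=
      mul_le_mul_of_nonneg_left (by linarith) hγ
    have m6 := mul_le_mul_of_nonneg_right hγ' hC0
    have m7 := mul_nonneg hγ hC0
    rw [abs_le]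
    constructor <;> nlinarith
  · rw [estRefinedEdge, refinedEdge, if_neg h0, if_neg h0]
    refine (hA.edges u v).trans ?_
    have h1 := sqrt_le_threshold_edge hP k ℓ h0
    have h2 := heaviness_nonneg (G := G) (.edge u v)
    refine mul_le_mul hA.γ₁_le (by linarith) (by have := Real.sqrt_nonneg V.P.T; linarith) ?_
    linarith [hA.γ₁_nonneg, hA.γ₁_le]

/-- The decisions on wedges, edges and validity are correct. -/
lemma exact_of_not_bad (hM : 0 < V.MY) (hc : c.IsConfig G)
    (hbad : ¬ BadConfig V.P V.MY G b V.s η γ c V.Y) :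
    (V.EstWedgesLight G c ↔ WedgesLight V.P (V.s 0) G c) ∧
    (V.EstEdgesLight G c ↔ EdgesLight V.P (V.s 0) (V.s 1) G c) ∧
    (V.EstValid G c ↔ IsValid V.P (V.s 1) G c) := by
  unfold BadConfig at hbad
  push Not at hbad
  obtain ⟨h1, h2, h3⟩ := hbad
  have hδ := hP.δ_pos
  have hb1 := hA.b_gt 1
  refine ⟨?_, ?_, ?_⟩
  · refine forall_congr' fun a => forall_congr' fun w => forall_congr' fun d =>
      imp_congr_right fun hin => ?_
    exact est_le_iff (threshold_nonneg hP _ _ _) (heaviness_nonneg _) (hA.s_ge 0) (hA.s_le 0)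
      (hA.b_gt 0) (hA.b_le 0) (by linarith [hA.γ₀_nonneg]) hA.γ₀_le
      (estWedge_accurate hP hA hc hin) (h1 a w d hin)
  · refine forall_congr' fun u => forall_congr' fun v => imp_congr_right fun hin => ?_
    obtain ⟨h4, h5⟩ := h2 u v hin
    refine est_le_iff (threshold_nonneg hP _ _ _) refinedEdge_nonneg (hA.s_ge 1)
      (hA.s_le 1) (hA.b_gt 1) (hA.b_le 1) (by linarith) le_rfl
      (estRefinedEdge_accurate hP hA _ _ (fun h0 => ?_) hM) h4
    have := h5 h0
    tauto
  · refine not_congr (and_congr_right fun _ => ?_)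
    refine est_le_iff (by positivity) (heaviness_nonneg _) (hA.s_ge 1)
      (hA.s_le 1) (hA.b_gt 1) (hA.b_le 1) (by linarith) le_rfl ?_ h3
    refine (hA.edges _ _).trans ?_
    have h1 : √V.P.T ≤ √V.P.T / V.P.δ ^ 2 := by
      rw [le_div_iff₀ (by positivity)]
      exact mul_le_of_le_one_right (Real.sqrt_nonneg _) (pow_le_one₀ hδ.le hP.δ_le)
    have h2 := heaviness_nonneg (G := G) (.edge c.x c.y)
    refine mul_le_mul hA.γ₁_le (by linarith) (by have := Real.sqrt_nonneg V.P.T; linarith) ?_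
    linarith

/-- The members of a node family are tracked, so the decisions about them are exact. The estimated
family is then the true one restricted by Z, and the accuracy of its size depends on Z alone. -/
lemma estHeavy_iff (hM : 0 < V.MY)
    (hpop : ∀ c ∈ V.pop G, ¬ BadConfig V.P V.MY G b V.s η γ c V.Y)
    (hc : c ∈ V.pop G) (ha : ∀ v, IsNodeOf c.cycle v → V.Anchored c v)
    (hn : ∀ v, IsNodeOf c.cycle v → ¬ BadNode V.P V.MZ G b V.s γ₂ c v V.Z) :
    V.EstHeavy G c ↔ IsHeavy V.P V.s G c := by
  have hcG := (mem_filt.1 hc).1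
  obtain ⟨e1, e2, -⟩ := exact_of_not_bad hP hA hM hcG (hpop c hc)
  rw [isHeavy_iff hP hcG]
  refine or_congr (not_congr e1) (or_congr (not_congr e2) (exists_congr fun v =>
    and_congr_right fun hv => ?_))
  have h1 := hn v hv
  unfold BadNode at h1
  push Not at h1
  have hfam : V.nodeFamily G v c.scale c.label =
      (nodeLight V.P G (V.s 0) (V.s 1) v c.scale c.label).filter fun c' =>
        ∀ u, IsNodeOf c'.cycle u → u ≠ v → V.Z (c.scale, c'.label u, u) = true := by
    ext c'
    simp only [nodeFamily, nodeLight, mem_filt, Finset.mem_filter]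
    refine and_congr_left fun hZ => and_congr_right fun hG => ?_
    by_cases hh : c'.Has (.node v) c.scale c.label
    · obtain ⟨i1, i2, i3⟩ := exact_of_not_bad hP hA hM hG
        (hpop c' (mem_pop_of_anchored (ha v hv) hG hh hZ))
      rw [i1, i2, i3]
    · tauto
  rw [← not_le, ← not_le]
  refine not_congr ?_
  have hb2 := hA.b_gt 2
  refine est_le_iff (threshold_nonneg hP _ _ _) (by rw [refinedNode_eq]; positivity)
    (hA.s_ge 2) (hA.s_le 2) (hA.b_gt 2) (hA.b_le 2) hA.γ₂_nonneg hA.γ₂_le ?_ h1.2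
  have h2 := h1.1
  unfold NodeDeviates at h2
  rw [not_lt] at h2
  unfold estNode
  rw [hfam, refinedNode_eq]
  exact h2

lemma estLLM_iff (hM : 0 < V.MY)
    (hpop : ∀ c ∈ V.pop G, ¬ BadConfig V.P V.MY G b V.s η γ c V.Y) {q : Config n N}
    (hq : q.IsConfig G) (hin : AllIn V.r q)
    (hn : ∀ c, Relevant V.P q c → ∀ v, IsNodeOf c.cycle v →
      ¬ BadNode V.P V.MZ G b V.s γ₂ c v V.Z) :
    V.EstLLM G q ↔ IsLLM V.P V.s G q := by
  have key : ∀ c', Relevant V.P q c' → (V.EstHeavy G c' ↔ IsHeavy V.P V.s G c') := by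
    intro c' h
    have h1 := mem_pop_of_relevant hP hq hin h
    exact estHeavy_iff hP hA hM hpop h1.1 h1.2 (hn c' h)
  have hself := Relevant.refl hP q
  have h1 := (mem_pop_of_relevant hP hq hin hself).1
  have h2 := (exact_of_not_bad hP hA hM hq (hpop q h1)).2.2
  have h3 : LocMin V.P (V.EstHeavy G) q ↔ IsLocallyMinimal V.P V.s G q := locMin_congr hP key
  unfold EstLLM IsLLM
  rw [key q hself, h3, h2]
  tauto

end Env

end

section

/-! ### Products of finite probability spaces -/

namespace FinProb

variable {Ω Ω' : Type*} [Fintype Ω] [Fintype Ω'] (D : FinProb Ω) (D' : FinProb Ω')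

lemma Pr_prod_le_of_snd {A : Ω × Ω' → Prop} {p : ℝ} (h : ∀ x, D'.Pr (fun y => A (x, y)) ≤ p) :
    (D.prod D').Pr A ≤ p := by
  rw [Pr, E_prod, ← D.E_const p]
  exact D.E_mono h

lemma Pr_prod_le_of_fst {A : Ω × Ω' → Prop} {p : ℝ} (h : ∀ y, D.Pr (fun x => A (x, y)) ≤ p) :
    (D.prod D').Pr A ≤ p := by
  rw [Pr, E_prod, E_comm, ← D'.E_const p]
  exact D'.E_mono h

lemma Pr_prod_fst (A : Ω → Prop) : (D.prod D').Pr (fun x => A x.1) = D.Pr A := by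
  rw [Pr, E_prod]
  change (D.E fun x => D'.E fun _ => if A x then 1 else 0) = _
  simp only [E_const]; rfl

lemma Pr_prod_snd (A : Ω' → Prop) : (D.prod D').Pr (fun x => A x.2) = D'.Pr A := by
  rw [Pr, E_prod]
  change (D.E fun _ => D'.Pr A) = _
  exact D.E_const _

lemma Pr_prod_and (A : Ω → Prop) (B : Ω' → Prop) :
    (D.prod D').Pr (fun x => A x.1 ∧ B x.2) = D.Pr A * D'.Pr B := by
  rw [Pr, E_prod, Pr, Pr, ← E_E_mul]
  congr 1; ext x; congr 1; ext y
  by_cases hA : A x <;> by_cases hB : B y <;> simp [hA, hB]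

lemma Pr_exists_mem_le {κ : Type*} (s : Finset κ) (A : κ → Ω → Prop) {p : ℝ}
    (h : ∀ i ∈ s, D.Pr (A i) ≤ p) : D.Pr (fun x => ∃ i ∈ s, A i x) ≤ s.card * p := by
  refine (D.Pr_exists_le s A).trans ((Finset.sum_le_sum h).trans ?_)
  rw [Finset.sum_const, nsmul_eq_mul]

lemma Pr_false : D.Pr (fun _ => False) = 0 := by simp [Pr]

end FinProb

/-! ### Random shifts -/

lemma card_le_two_of_consecutive {m : ℕ} (S : Finset (Fin m))
    (h : ∀ x ∈ S, ∀ y ∈ S, (y : ℕ) ≤ x + 1) : S.card ≤ 2 := by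
  rcases S.eq_empty_or_nonempty with rfl | hne
  · simp
  · have hmin := S.min'_mem hne
    set x := S.min' hne
    refine (Finset.card_le_card_of_injOn (s := S) (t := {(x : ℕ), (x : ℕ) + 1})
      (fun y => (y : ℕ)) ?_ ?_).trans
      Finset.card_le_two
    · intro y hy
      have h1 := h x hmin y hy
      have h2 : x ≤ y := S.min'_le y hy
      have h3 : (x : ℕ) ≤ y := h2
      have : (y : ℕ) = x ∨ (y : ℕ) = x + 1 := by omega
      simpa using this
    · intro y _ y' _ h; exact Fin.ext h

/-- The factor between consecutive values of a shift. -/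
def shiftBase (L : ℝ) : ℝ := 1 + 1 / (200 * L)

lemma one_lt_shiftBase {L : ℝ} (hL : 1 ≤ L) : 1 < shiftBase L := by
  have : 0 < 1 / (200 * L) := by positivity
  unfold shiftBase; linarith

lemma shiftBase_le {L : ℝ} (hL : 1 ≤ L) : shiftBase L ≤ 2 := by
  have : 1 / (200 * L) ≤ 1 := by rw [div_le_one (by positivity)]; linarith
  unfold shiftBase; linarith

lemma Pr_unif_le {L : ℝ} (hL : 1 ≤ L) (A : Fin (numShifts L) → Prop) {x : ℝ}
    (h : ((Finset.univ.filter A).card : ℝ) ≤ x) :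
    (FinProb.unif _ (numShifts_pos hL)).Pr A ≤ x / (100 * L) := by
  rw [FinProb.Pr_unif]
  exact div_le_div₀ ((Nat.cast_nonneg _).trans h) h (by positivity) (le_numShifts hL)

/-- The window around t has ratio b², so exponents in it differ by at most one. Two bad exponents
out of at least 100L remain. -/
lemma Pr_close_le {L : ℝ} (hL : 1 ≤ L) {θ : ℝ} (hθ : 0 ≤ θ) (t : ℝ) :
    (FinProb.unif _ (numShifts_pos hL)).Pr
      (fun e => Close (shiftBase L) (shiftBase L ^ (e : ℕ)) θ t) ≤ 1 / (50 * L) := by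
  have hb := one_lt_shiftBase hL
  refine (Pr_unif_le hL _ (x := 2) ?_).trans (le_of_eq (by field_simp; norm_num))
  have : (Finset.univ.filter fun e : Fin (numShifts L) =>
      Close (shiftBase L) (shiftBase L ^ (e : ℕ)) θ t).card ≤ 2 := by
    refine card_le_two_of_consecutive _ fun x hx y hy => ?_
    have h1 := (Finset.mem_filter.1 hx).2.2
    have h2 := (Finset.mem_filter.1 hy).2.1
    by_contra hcon
    push Not at hcon
    have h3 : shiftBase L ^ ((x : ℕ) + 2) ≤ shiftBase L ^ (y : ℕ) :=
      pow_le_pow_right₀ hb.le hcon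
    have h4 := mul_le_mul_of_nonneg_left h3 hθ
    have h5 := mul_le_mul_of_nonneg_right h1 (by linarith : 0 ≤ shiftBase L)
    have h6 : θ * shiftBase L ^ (x : ℕ) * shiftBase L * shiftBase L =
      θ * shiftBase L ^ ((x : ℕ) + 2) := by ring
    linarith
  exact_mod_cast this

/-- A bounded monotone function can grow by a constant factor only a bounded number of times. -/
lemma card_jumps_le (m : ℕ) (h : ℕ → ℝ) (hmono : Monotone h) {θ H η : ℝ} (hθ : 0 < θ)
    (hlow : ∀ i, θ ≤ h i) (hhigh : ∀ i, h i ≤ H) (hη : 0 < η) (hη1 : η ≤ 1) :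
    ((Finset.univ.filter fun e : Fin m => (1 + η) * h e < h (e + 2)).card : ℝ) ≤
      4 / η * Real.log (H / θ) := by
  have hpos : ∀ i, 0 < h i := fun i => hθ.trans_le (hlow i)
  have hH : 0 < H := (hpos 0).trans_le (hhigh 0)
  have hlogη : η / 2 ≤ Real.log (1 + η) := by
    have h1 := Real.one_sub_inv_le_log_of_pos (by linarith : 0 < 1 + η)
    have h2 : η / 2 ≤ 1 - (1 + η)⁻¹ := by
      rw [le_sub_iff_add_le, ← le_sub_iff_add_le', inv_le_iff_one_le_mul₀ (by linarith)]
      nlinarith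
    linarith
  set a : ℕ → ℝ := fun i => Real.log (h i) with ha
  have hamono : Monotone a := fun i j hij => Real.log_le_log (hpos i) (hmono hij)
  -- Increments over two steps telescope to four terms and sum to at most 2 log(H/θ), while every
  -- jump contributes at least log(1 + η) ≥ η/2.
  have htel : ∀ k, ∑ e ∈ Finset.range k, (a (e + 2) - a e) = a (k + 1) + a k - a 1 - a 0 := by
    intro k
    induction k with
    | zero => simp
    | succ k ih => rw [Finset.sum_range_succ, ih]; ring
  have hdiff : ∀ i j, a i - a j ≤ Real.log (H / θ) := by
    intro i j
    rw [Real.log_div hH.ne' hθ.ne']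
    exact sub_le_sub (Real.log_le_log (hpos i) (hhigh i)) (Real.log_le_log hθ (hlow j))
  set S := Finset.univ.filter fun e : Fin m => (1 + η) * h e < h (e + 2)
  have h1 : S.card * (η / 2) ≤ ∑ e ∈ S, (a (e + 2) - a e) := by
    rw [← nsmul_eq_mul, ← Finset.sum_const]
    refine Finset.sum_le_sum fun e he => ?_
    have h2 := (Finset.mem_filter.1 he).2
    have h3 := Real.log_le_log (mul_pos (by linarith) (hpos _)) h2.le
    rw [Real.log_mul (by linarith) (hpos _).ne'] at h3
    simp only [ha]
    linarith
  have h2 : ∑ e ∈ S, (a (e + 2) - a e) ≤ ∑ e ∈ Finset.range m, (a (e + 2) - a e) := by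
    rw [Finset.sum_range]
    exact Finset.sum_le_sum_of_subset_of_nonneg (Finset.subset_univ _) fun e _ _ => by
      have := hamono (show (e : ℕ) ≤ e + 2 by omega)
      linarith
  rw [htel] at h2
  have h3 := hdiff (m + 1) 1
  have h4 := hdiff m 0
  have h5 : (S.card : ℝ) * (η / 2) ≤ 2 * Real.log (H / θ) := by linarith
  rw [div_mul_eq_mul_div, le_div_iff₀ hη]
  linarith

variable {n N : ℕ} {P : Params} {G : SimpleGraph (Fin n)} {c : Config n N}

lemma card_edgeLight_le (σ : ℝ) (u v : Fin n) (k : Fin N) (ℓ : Fin n → Label) :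
    (edgeLight P G σ u v k ℓ).card ≤ 16 * (fourCycles G).ncard := by
  have h := card_config_le (G := G) (filt fun A => A ∈ fourCycles G) k (N := N)
  have e : (filt fun A => A ∈ fourCycles G).card = (fourCycles G).ncard := by
    rw [← ncard_eq_card_filt]; rfl
  rw [e] at h
  refine (Finset.card_le_card fun c hc => ?_).trans h
  obtain ⟨h1, h2, -⟩ := mem_filt.1 hc
  exact mem_filt.2 ⟨h2.1, h1, mem_filt.2 h1.1⟩

/-- From κ ≤ 2√T. It keeps the ratio H/θ in the count of jumps polynomial in T. -/
lemma one_div_four_le_threshold (hP : P.Good) (hN : N = P.numScales) (k : Fin N)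
    (ℓ : Fin n → Label) {u v : Fin n} (h0 : numOnes (.edge u v) ℓ = 0) :
    1 / 4 ≤ threshold P (.edge u v) k ℓ := by
  have hδ := hP.δ_pos
  have hκ := hP.κ_pos (k : ℕ)
  have h1 := hP.κ_le (k : ℕ) (hN ▸ k.2)
  have hT := hP.T_pos
  have hs := hP.sq_sqrt
  simp only [threshold, h0]
  norm_num
  rw [div_le_div_iff₀ (by norm_num) (by positivity)]
  have h2 : P.κ (k : ℕ) ^ 2 ≤ 4 * P.T := by nlinarith
  have h3 : P.δ ^ 2 ≤ 1 := pow_le_one₀ hδ.le hP.δ_le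
  have h4 : 0 ≤ P.δ ^ 2 := by positivity
  have h5 : P.κ (k : ℕ) ^ 2 * P.δ ^ 2 ≤ 4 * P.T * 1 :=
    mul_le_mul h2 h3 h4 (by positivity)
  simpa using by linarith

/-- The family at exponent i has level bⁱ⁻¹, so the levels s/b and sb are two indices apart. The 64
is 16 divided by the lower bound 1/4 for the threshold. -/
lemma Pr_jumps_le (hP : P.Good) (hN : N = P.numScales) {L α : ℝ} (hL : 1 ≤ L)
    (hG : ((fourCycles G).ncard : ℝ) ≤ α * P.T) {η : ℝ} (hη : 0 < η) (hη1 : η ≤ 1) (k : Fin N)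
    (ℓ : Fin n → Label) {u v : Fin n} (h0 : numOnes (.edge u v) ℓ = 0) :
    (FinProb.unif _ (numShifts_pos hL)).Pr
      (fun e => Jumps P G (shiftBase L) η (shiftBase L ^ (e : ℕ)) u v k ℓ) ≤
      4 / η * Real.log (64 * (α * P.T) + 1) / (100 * L) := by
  have hb := one_lt_shiftBase hL
  have hb0 : 0 < shiftBase L := by linarith
  have hθ : 0 < threshold P (.edge u v) k ℓ := threshold_pos hP _ _ _
  have hθ4 := one_div_four_le_threshold hP hN k ℓ h0
  refine Pr_unif_le hL _ ?_
  have h := card_jumps_le (numShifts L)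
    (fun i => (edgeLight P G (shiftBase L ^ i / shiftBase L) u v k ℓ).card +
      threshold P (.edge u v) k ℓ)
    (fun i j hij => by
      refine add_le_add_left ?_ _
      norm_cast
      refine Finset.card_le_card (edgeLight_mono hP ?_ _ _ _ _)
      exact div_le_div_of_nonneg_right (pow_le_pow_right₀ hb.le hij) hb0.le)
    (θ := threshold P (.edge u v) k ℓ)
    (H := 16 * (α * P.T) + threshold P (.edge u v) k ℓ) hθ
    (fun i => by simp)
    (fun i => by
      refine add_le_add_left ?_ _
      have : ((edgeLight P G (shiftBase L ^ i / shiftBase L) u v k ℓ).card : ℝ) ≤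
        16 * (fourCycles G).ncard := by exact_mod_cast card_edgeLight_le _ _ _ _ _
      linarith) hη hη1
  have hcnt : (Finset.univ.filter fun e : Fin (numShifts L) =>
      Jumps P G (shiftBase L) η (shiftBase L ^ (e : ℕ)) u v k ℓ).card ≤
      (Finset.univ.filter fun e : Fin (numShifts L) => (1 + η) *
        (((edgeLight P G (shiftBase L ^ (e : ℕ) / shiftBase L) u v k ℓ).card : ℝ) +
          threshold P (.edge u v) k ℓ) <
        ((edgeLight P G (shiftBase L ^ ((e : ℕ) + 2) / shiftBase L) u v k ℓ).card : ℝ) +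
          threshold P (.edge u v) k ℓ).card := by
    refine Finset.card_le_card fun e he => ?_
    have h1 := (Finset.mem_filter.1 he).2
    unfold Jumps at h1
    refine Finset.mem_filter.2 ⟨Finset.mem_univ _, ?_⟩
    have e1 : shiftBase L ^ ((e : ℕ) + 2) / shiftBase L = shiftBase L ^ (e : ℕ) * shiftBase L := by
      field_simp; ring
    rw [e1]
    exact h1
  refine (Nat.cast_le.2 hcnt).trans (h.trans ?_)
  refine mul_le_mul_of_nonneg_left (Real.log_le_log ?_ ?_) (by positivity)
  · have : 0 ≤ α * P.T := le_trans (Nat.cast_nonneg _) hG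
    positivity
  · rw [div_le_iff₀ hθ]
    have : 0 ≤ α * P.T := le_trans (Nat.cast_nonneg _) hG
    nlinarith

end

section

variable {n N : ℕ} {P : Params} {G : SimpleGraph (Fin n)} {c : Config n N}

/-! ### Probabilities of the bad events -/

/-- The shifts with given exponents. -/
def shiftVec (L : Fin 3 → ℝ) (e : ShiftExp L) (i : Fin 3) : ℝ :=
  shiftBase (L i) ^ (![(e.1 : ℕ), (e.2.1 : ℕ), (e.2.2 : ℕ)] i)

/-! ### Events that concern one shift, the earlier ones being fixed. -/

section Shifts

variable {L : Fin 3 → ℝ} (hL : ∀ i, 1 ≤ L i) {Ω : Type*} [Fintype Ω] (D : FinProb Ω)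

include hL in
lemma one_le_shiftVec (e : ShiftExp L) (i : Fin 3) : 1 ≤ shiftVec L e i :=
  one_le_pow₀ (one_lt_shiftBase (hL i)).le

include hL in
lemma shiftVec_le (e : ShiftExp L) (i : Fin 3) : shiftVec L e i ≤ 2 := by
  unfold shiftVec shiftBase
  refine ((shift_lt_two_iff (hL i) _).2 ?_).le
  fin_cases i
  exacts [e.1.2, e.2.1.2, e.2.2.2]

lemma Pr_shift_zero (A : Fin (numShifts (L 0)) → Prop) :
    (D.prod (shiftDist L hL)).Pr (fun x => A x.2.1) =
      (FinProb.unif _ (numShifts_pos (hL 0))).Pr A :=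
  (FinProb.Pr_prod_snd D (shiftDist L hL) fun e => A e.1).trans (FinProb.Pr_prod_fst _ _ A)

lemma Pr_shift_one_le {p : ℝ}
    (A : Fin (numShifts (L 0)) → Fin (numShifts (L 1)) → Prop)
    (h : ∀ e, (FinProb.unif _ (numShifts_pos (hL 1))).Pr (A e) ≤ p) :
    (D.prod (shiftDist L hL)).Pr (fun x => A x.2.1 x.2.2.1) ≤ p := by
  rw [FinProb.Pr_prod_snd D (shiftDist L hL) fun e => A e.1 e.2.1]
  refine FinProb.Pr_prod_le_of_snd _ _ fun e₀ => ?_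
  rw [FinProb.Pr_prod_fst _ _ (A e₀)]
  exact h e₀

lemma Pr_shift_two_le {p : ℝ}
    (A : Fin (numShifts (L 0)) → Fin (numShifts (L 1)) → Fin (numShifts (L 2)) → Prop)
    (h : ∀ e e', (FinProb.unif _ (numShifts_pos (hL 2))).Pr (A e e') ≤ p) :
    (D.prod (shiftDist L hL)).Pr (fun x => A x.2.1 x.2.2.1 x.2.2.2) ≤ p := by
  rw [FinProb.Pr_prod_snd D (shiftDist L hL) fun e => A e.1 e.2.1 e.2.2]
  refine FinProb.Pr_prod_le_of_snd _ _ fun e₀ => ?_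
  refine FinProb.Pr_prod_le_of_snd _ _ fun e₁ => h e₀ e₁

end Shifts

lemma FinProb.Pr_le_of_imp {Ω : Type*} [Fintype Ω] (D : FinProb Ω) {q : Prop} {A B : Ω → Prop}
    {p : ℝ} (hp : 0 ≤ p) (hAB : ∀ x, A x → q ∧ B x) (h : q → D.Pr B ≤ p) : D.Pr A ≤ p := by
  by_cases hq : q
  · exact (D.Pr_mono fun x hx => (hAB x hx).2).trans (h hq)
  · refine le_trans (D.Pr_mono (B := fun _ => False) fun x hx => hq (hAB x hx).1) ?_
    rw [D.Pr_false]; exact hp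

/-- Union bound over 64 triples and 16 pairs of nodes. Refined edge heaviness depends on s₁ but not
on s₂, so closeness at an edge is bounded over s₂ with s₁ fixed; jumps are bounded over s₁, and
deviations over Y with all shifts fixed. -/
lemma Pr_badConfig_le (hP : P.Good) (hN : N = P.numScales) {L : Fin 3 → ℝ} (hL : ∀ i, 1 ≤ L i)
    {M α η γ : ℝ} (hM : 1 ≤ M) (hG : ((fourCycles G).ncard : ℝ) ≤ α * P.T) (hη : 0 < η)
    (hη1 : η ≤ 1) (hγ : 0 < γ) (hc : c.IsConfig G) :
    ((rateDist P M n N).prod (shiftDist L hL)).Pr (fun x =>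
      BadConfig P M G (fun i => shiftBase (L i)) (shiftVec L x.2) η γ c x.1) ≤
      64 * (1 / (50 * L 0)) + (16 * (1 / (50 * L 1) +
        (4 / η * Real.log (64 * (α * P.T) + 1) / (100 * L 0) +
          (4096 / (P.δ ^ 2 * M * γ ^ 2) + 4096 / (P.δ ^ 2 * M * γ ^ 2)))) + 1 / (50 * L 1)) := by
  have hδ := hP.δ_pos
  have hL0 := hL 0
  have hL1 := hL 1
  have h4 := card_nodeSet hc.1
  have hlog : 0 ≤ Real.log (64 * (α * P.T) + 1) := by
    refine Real.log_nonneg ?_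
    have : 0 ≤ α * P.T := le_trans (Nat.cast_nonneg _) hG
    linarith
  set D := (rateDist P M n N).prod (shiftDist L hL)
  have c3 : (nodeSet c.cycle ×ˢ nodeSet c.cycle ×ˢ nodeSet c.cycle).card = 64 := by
    rw [Finset.card_product, Finset.card_product, h4]
  have c2 : (nodeSet c.cycle ×ˢ nodeSet c.cycle).card = 16 := by
    rw [Finset.card_product, h4]
  refine (FinProb.Pr_or _ _ _).trans (add_le_add ?_ ((FinProb.Pr_or _ _ _).trans
    (add_le_add ?_ ?_)))
  · refine le_trans (D.Pr_mono (B := fun x => ∃ p ∈ nodeSet c.cycle ×ˢ nodeSet c.cycle ×ˢ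
      nodeSet c.cycle, Close (shiftBase (L 0)) (shiftBase (L 0) ^ (x.2.1 : ℕ))
        (threshold P (.wedge p.1 p.2.1 p.2.2) c.scale c.label)
        (heaviness G (.wedge p.1 p.2.1 p.2.2))) ?_) ?_
    · rintro x ⟨a, w, d, hin, hcl⟩
      refine ⟨(a, w, d), ?_, hcl⟩
      simp [(isNodeOf_of_mem hin.2.1).1, (isNodeOf_of_mem hin.2.1).2, (isNodeOf_of_mem hin.2.2).2]
    · refine (D.Pr_exists_mem_le _ _ (p := 1 / (50 * L 0)) fun p _ => ?_).trans (by
        rw [c3]; norm_num)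
      rw [Pr_shift_zero hL (rateDist P M n N) fun e => Close (shiftBase (L 0))
        (shiftBase (L 0) ^ (e : ℕ)) (threshold P (.wedge p.1 p.2.1 p.2.2) c.scale c.label)
        (heaviness G (.wedge p.1 p.2.1 p.2.2))]
      exact Pr_close_le hL0 (threshold_nonneg hP _ _ _) _
  · refine le_trans (D.Pr_mono (B := fun x => ∃ p ∈ nodeSet c.cycle ×ˢ nodeSet c.cycle,
      s(p.1, p.2) ∈ c.cycle ∧
      (Close (shiftBase (L 1)) (shiftBase (L 1) ^ (x.2.2.1 : ℕ))
        (threshold P (.edge p.1 p.2) c.scale c.label)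
        (refinedEdge P (shiftBase (L 0) ^ (x.2.1 : ℕ)) G p.1 p.2 c.scale c.label) ∨
      (numOnes (.edge p.1 p.2) c.label = 0 ∧
        (Jumps P G (shiftBase (L 0)) η (shiftBase (L 0) ^ (x.2.1 : ℕ)) p.1 p.2 c.scale c.label ∨
      EdgeDeviates P M G γ (shiftVec L x.2 0 / shiftBase (L 0)) p.1 p.2 c.scale c.label x.1 ∨
      EdgeDeviates P M G γ (shiftVec L x.2 0 * shiftBase (L 0)) p.1 p.2 c.scale c.label
        x.1)))) ?_) ?_
    · rintro x ⟨u, v, hin, hcl⟩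
      refine ⟨(u, v), ?_, hin, hcl⟩
      simp [(isNodeOf_of_mem hin).1, (isNodeOf_of_mem hin).2]
    · refine (D.Pr_exists_mem_le _ _ (p := 1 / (50 * L 1) +
        (4 / η * Real.log (64 * (α * P.T) + 1) / (100 * L 0) +
          (4096 / (P.δ ^ 2 * M * γ ^ 2) + 4096 / (P.δ ^ 2 * M * γ ^ 2)))) fun p _ => ?_).trans (by
        rw [c2]; norm_num)
      refine D.Pr_le_of_imp (by positivity) (fun x hx => hx) fun hin => ?_
      have hne := (adj_of_mem hc.1 hin).ne
      refine (FinProb.Pr_or _ _ _).trans (add_le_add ?_ ?_)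
      · refine Pr_shift_one_le hL _ (fun e e' => Close (shiftBase (L 1))
          (shiftBase (L 1) ^ (e' : ℕ)) (threshold P (.edge p.1 p.2) c.scale c.label)
          (refinedEdge P (shiftBase (L 0) ^ (e : ℕ)) G p.1 p.2 c.scale c.label)) fun e => ?_
        exact Pr_close_le hL1 (threshold_nonneg hP _ _ _) _
      · refine D.Pr_le_of_imp (by positivity) (fun x hx => hx) fun h0 => ?_
        refine (FinProb.Pr_or _ _ _).trans (add_le_add ?_ ((FinProb.Pr_or _ _ _).trans
          (add_le_add ?_ ?_)))
        · rw [Pr_shift_zero hL (rateDist P M n N) fun e => Jumps P G (shiftBase (L 0)) η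
            (shiftBase (L 0) ^ (e : ℕ)) p.1 p.2 c.scale c.label]
          exact Pr_jumps_le hP hN hL0 hG hη hη1 _ _ h0
        · refine FinProb.Pr_prod_le_of_fst _ _ fun e => ?_
          have h1 := one_le_shiftVec hL e 0
          have h2 := shiftVec_le hL e 0
          have h3 := one_lt_shiftBase hL0
          refine Pr_edgeDeviates_le (σ := shiftVec L e 0 / shiftBase (L 0)) hP hM hγ
            (by positivity) ?_ hne _ h0
          rw [div_le_iff₀ (by linarith)]; linarith
        · refine FinProb.Pr_prod_le_of_fst _ _ fun e => ?_
          have h1 := one_le_shiftVec hL e 0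
          have h2 := shiftVec_le hL e 0
          have h3 := one_lt_shiftBase hL0
          have h5 := shiftBase_le hL0
          exact Pr_edgeDeviates_le (σ := shiftVec L e 0 * shiftBase (L 0)) hP hM hγ
            (by positivity) (by nlinarith) hne _ h0
  · refine Pr_shift_one_le hL _ (fun _ e' => Close (shiftBase (L 1))
      (shiftBase (L 1) ^ (e' : ℕ)) (√P.T / P.δ ^ 2) (heaviness G (.edge c.x c.y))) fun e => ?_
    exact Pr_close_le hL1 (by positivity) _

lemma Pr_badNode_le (hP : P.Good) {L : Fin 3 → ℝ} (hL : ∀ i, 1 ≤ L i)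
    {M γ : ℝ} (hM : 1 ≤ M) (hγ : 0 < γ) (c : Config n N) (v : Fin n) :
    ((rateDist P M n N).prod (shiftDist L hL)).Pr (fun x =>
      BadNode P M G (fun i => shiftBase (L i)) (shiftVec L x.2) γ c v x.1) ≤
      4096 / (P.δ ^ 2 * M * γ ^ 2) + 1 / (50 * L 2) := by
  refine (FinProb.Pr_or _ _ _).trans (add_le_add ?_ ?_)
  · refine FinProb.Pr_prod_le_of_fst _ _ fun e => ?_
    have h1 := fun i => one_le_shiftVec hL e i
    have h2 := fun i => shiftVec_le hL e i
    exact Pr_nodeDeviates_le (s₁ := shiftVec L e 0) (s₂ := shiftVec L e 1) hP hM hγ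
      (by linarith [h1 0]) (by linarith [h2 0]) (by linarith [h2 1]) _ _ _
  · refine Pr_shift_two_le hL _ (fun e e' e'' => Close (shiftBase (L 2))
      (shiftBase (L 2) ^ (e'' : ℕ)) (threshold P (.node v) c.scale c.label)
      (refinedNode P (shiftBase (L 0) ^ (e : ℕ)) (shiftBase (L 1) ^ (e' : ℕ)) G v c.scale c.label))
      fun e e' => ?_
    exact Pr_close_le (hL 2) (threshold_nonneg hP _ _ _) _

/-! ### First moments -/

lemma coe_rate_le (hP : P.Good) {M : ℝ} (hM : 0 ≤ M) (k : ℤ) (l : Label) :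
    (rate P M k l : ℝ) ≤ M * P.base k l := by
  rw [coe_rate hP hM]; exact min_le_right _ _

lemma Pr_forall_mem_le (hP : P.Good) {M : ℝ} (hM : 0 ≤ M)
    (J : Finset (Fin N × Label × Fin n)) :
    (rateDist P M n N).Pr (fun ω => ∀ i ∈ J, ω i = true) ≤
      ∏ i ∈ J, M * P.base (i.1 : ℕ) i.2.1 := by
  rw [rateDist, FinProb.Pr_allOn]
  exact Finset.prod_le_prod (fun i _ => (rate P M _ _).2.1) fun i _ => coe_rate_le hP hM _ _

lemma Pr_nodes_le (hP : P.Good) {M : ℝ} (hM : 0 ≤ M) (c : Config n N) (U : Finset (Fin n)) :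
    (rateDist P M n N).Pr (fun ω => ∀ u ∈ U, ω (c.scale, c.label u, u) = true) ≤
      M ^ U.card * ∏ u ∈ U, P.base (c.scale : ℕ) (c.label u) := by
  have h := Pr_forall_mem_le hP hM (U.image fun u => (c.scale, c.label u, u))
  rw [Finset.prod_image fun u _ u' _ h => by simp only [Prod.mk.injEq] at h; exact h.2.2,
    Finset.prod_mul_distrib, Finset.prod_const] at h
  refine le_trans (FinProb.Pr_mono _ fun ω hω => ?_) h
  simpa using hω

lemma Pr_allIn_le (hP : P.Good) {M : ℝ} (hM : 0 ≤ M) (hc : c.IsConfig G) :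
    (rateDist P M n N).Pr (fun r => AllIn r c) ≤ M ^ 4 / P.T := by
  have h := Pr_nodes_le hP hM c (nodeSet c.cycle)
  rw [card_nodeSet hc.1] at h
  have h1 := c.prod_base hP hc (c.scale : ℕ)
  have hT := hP.T_pos
  have e : M ^ 4 / P.T = M ^ 4 * ∏ u ∈ nodeSet c.cycle, P.base (c.scale : ℕ) (c.label u) := by
    rw [div_eq_iff hT.ne']
    linear_combination (-M ^ 4) * h1
  rw [e]
  refine le_trans (FinProb.Pr_mono _ fun ω hω => ?_) h
  intro u hu
  exact hω u (by simpa using hu)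

/-- The configurations for which `c` is relevant. -/
def relevantTo (P : Params) (c : Config n N) : Finset (Config n N) :=
  filt fun q => q.IsConfig ⊤ ∧ Relevant P q c

lemma card_relevantTo_le (c : Config n N) : (relevantTo P c).card ≤ N * 16 := by
  have h : relevantTo P c ⊆ (Finset.univ : Finset (Fin N)).biUnion fun k =>
      filt fun q : Config n N => q.scale = k ∧ q.IsConfig (⊤ : SimpleGraph (Fin n)) ∧
        q.cycle ∈ ({c.cycle} : Finset _) := by
    intro q hq
    obtain ⟨h1, h2⟩ := mem_filt.1 hq
    rw [Finset.mem_biUnion]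
    exact ⟨q.scale, Finset.mem_univ _, mem_filt.2 ⟨rfl, h1, by simp [h2.cycle_eq]⟩⟩
  refine (Finset.card_le_card h).trans ((Finset.card_biUnion_le_card_mul _ _ 16
    fun k _ => ?_).trans (by simp))
  exact (card_config_le _ k).trans (by simp)

lemma card_configs_le : (filt fun c : Config n N => c.IsConfig G).card ≤
    N * (16 * (fourCycles G).ncard) := by
  have h : (filt fun c : Config n N => c.IsConfig G) ⊆ (Finset.univ : Finset (Fin N)).biUnion
      fun k => filt fun q : Config n N => q.scale = k ∧ q.IsConfig G ∧
        q.cycle ∈ filt fun A => A ∈ fourCycles G := by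
    intro q hq
    have h1 := mem_filt.1 hq
    rw [Finset.mem_biUnion]
    exact ⟨q.scale, Finset.mem_univ _, mem_filt.2 ⟨rfl, h1, mem_filt.2 h1.1⟩⟩
  have e : (filt fun A => A ∈ fourCycles G).card = (fourCycles G).ncard := by
    rw [← ncard_eq_card_filt]; rfl
  refine (Finset.card_le_card h).trans ((Finset.card_biUnion_le_card_mul _ _
    (16 * (fourCycles G).ncard) fun k _ => ?_).trans (by simp))
  exact (card_config_le _ k).trans (by rw [e])

/-- Replacing the rate of v by that of its set in r costs a factor δ⁻⁴, and r and Z are independent.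
-/
lemma Pr_sampledAt_le (hP : P.Good) {ρ M : ℝ} (hρ : 0 ≤ ρ) (hM : 0 ≤ M) (hc : c.IsConfig G)
    (v : Fin n) (k : Fin N) (l : Label) :
    ((rateDist P ρ n N).prod (rateDist P M n N)).Pr (fun x => SampledAt P x.1 x.2 c v k l) ≤
      ρ * M ^ 3 / (P.δ ^ 4 * P.T) := by
  have hδ := hP.δ_pos
  have hT := hP.T_pos
  refine FinProb.Pr_le_of_imp _ (q := IsNodeOf c.cycle v ∧
      P.base (k : ℕ) l ≤ 1 / P.δ ^ 4 * P.base (c.scale : ℕ) (c.label v))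
    (B := fun x => (∀ i ∈ ({(k, l, v)} : Finset (Fin N × Label × Fin n)), x.1 i = true) ∧
      ∀ u ∈ (nodeSet c.cycle).erase v, x.2 (c.scale, c.label u, u) = true)
    (by positivity) (fun x hx => ?_) fun hq => ?_
  · obtain ⟨h1, h2, h3, h4⟩ := hx
    refine ⟨⟨h1, h3⟩, by simpa using h2, fun u hu => ?_⟩
    obtain ⟨h5, h6⟩ := Finset.mem_erase.1 hu
    exact h4 u (by simpa using h6) h5
  · obtain ⟨hv, hb⟩ := hq
    have hvm : v ∈ nodeSet c.cycle := by simpa using hv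
    rw [FinProb.Pr_prod_and _ _ (fun r : SetCoins n N => ∀ i ∈ ({(k, l, v)} :
      Finset (Fin N × Label × Fin n)), r i = true) fun Z : SetCoins n N =>
        ∀ u ∈ (nodeSet c.cycle).erase v, Z (c.scale, c.label u, u) = true]
    have h1 := Pr_forall_mem_le hP hρ ({(k, l, v)} : Finset (Fin N × Label × Fin n))
    rw [Finset.prod_singleton] at h1
    have h2 := Pr_nodes_le hP hM c ((nodeSet c.cycle).erase v)
    rw [Finset.card_erase_of_mem hvm, card_nodeSet hc.1] at h2
    have h3 := c.prod_base hP hc (c.scale : ℕ)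
    rw [← Finset.mul_prod_erase _ _ hvm] at h3
    set w := ∏ u ∈ (nodeSet c.cycle).erase v, P.base (c.scale : ℕ) (c.label u)
    have hw : 0 < w := Finset.prod_pos fun u _ => hP.base_pos _ _
    have hb0 := hP.base_pos (k : ℕ) l
    refine (mul_le_mul h1 h2 (FinProb.Pr_nonneg _ _) (by positivity)).trans ?_
    have h4 : ρ * P.base (k : ℕ) l * (M ^ (4 - 1) * w) ≤
        ρ * (1 / P.δ ^ 4 * P.base (c.scale : ℕ) (c.label v)) * (M ^ (4 - 1) * w) := by
      gcongr
    refine h4.trans (le_of_eq ?_)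
    rw [eq_div_iff (by positivity)]
    norm_num
    field_simp
    linear_combination (ρ * M ^ 3) * h3

/-- A configuration is relevant to at most 16N queries, and an anchor has 4 nodes, N scales and 6
labels to choose from. As there are at most αT cycles, the tracked configurations are
polylogarithmically many in expectation. -/
lemma Pr_sampled_le (hP : P.Good) {ρ M : ℝ} (hρ : 0 ≤ ρ) (hM : 0 ≤ M) (hc : c.IsConfig G) :
    ((rateDist P ρ n N).prod (rateDist P M n N)).Pr (fun x => Sampled P x.1 x.2 c) ≤
      (N * 16) * (ρ ^ 4 / P.T) + (4 * (N * 6)) * (ρ * M ^ 3 / (P.δ ^ 4 * P.T)) := by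
  have hT := hP.T_pos
  have hδ := hP.δ_pos
  set D := (rateDist P ρ n N).prod (rateDist P M n N)
  refine (FinProb.Pr_or _ _ _).trans (add_le_add ?_ ?_)
  · refine le_trans (D.Pr_mono (B := fun x => ∃ q ∈ relevantTo P c, AllIn x.1 q) ?_) ?_
    · rintro x ⟨q, h1, h2, h3⟩
      exact ⟨q, mem_filt.2 ⟨h1, h3⟩, h2⟩
    · refine (D.Pr_exists_mem_le _ _ (p := ρ ^ 4 / P.T) fun q hq => ?_).trans ?_
      · rw [FinProb.Pr_prod_fst _ _ fun r : SetCoins n N => AllIn r q]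
        exact Pr_allIn_le hP hρ (mem_filt.1 hq).1
      · refine mul_le_mul_of_nonneg_right ?_ (by positivity)
        exact_mod_cast card_relevantTo_le c
  · refine le_trans (D.Pr_mono (B := fun x => ∃ p ∈ nodeSet c.cycle ×ˢ
      ((Finset.univ : Finset (Fin N)) ×ˢ (Finset.univ : Finset Label)),
        SampledAt P x.1 x.2 c p.1 p.2.1 p.2.2) ?_) ?_
    · rintro x ⟨v, k, l, h⟩
      exact ⟨(v, k, l), by simp [h.1], h⟩
    · refine (D.Pr_exists_mem_le _ _ (p := ρ * M ^ 3 / (P.δ ^ 4 * P.T)) fun p _ =>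
        Pr_sampledAt_le hP hρ hM hc _ _ _).trans ?_
      refine mul_le_mul_of_nonneg_right (le_of_eq ?_) (by positivity)
      have h6 : (Finset.univ : Finset Label).card = 6 := rfl
      rw [Finset.card_product, Finset.card_product, card_nodeSet hc.1, h6, Finset.card_univ,
        Fintype.card_fin]
      push_cast; ring

end

section

variable {n N : ℕ} {P : Params} {G : SimpleGraph (Fin n)}

/-! ### The space of all random choices -/

lemma FinProb.E_card_filter {Ω κ : Type*} [Fintype Ω] (D : FinProb Ω) (S : Finset κ)
    (A : κ → Ω → Prop) :
    D.E (fun x => ((S.filter fun i => A i x).card : ℝ)) = ∑ i ∈ S, D.Pr (A i) := by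
  unfold Pr
  rw [← E_sum]
  congr 1; ext x
  rw [Finset.sum_boole]

/-- The coins of the oracle. -/
abbrev Coins (n N : ℕ) : Type := SetCoins n N × SetCoins n N × (Fin n × Fin n → Bool)

/-- The distribution of the coins for pairs of vertices. -/
def pairDist (P : Params) (M : ℝ) (n : ℕ) : FinProb (Fin n × Fin n → Bool) :=
  FinProb.bern fun _ : Fin n × Fin n => pairRate P M

/-- The distribution of the coins of the oracle. -/
def coinDist (P : Params) (MZ MY MF : ℝ) (n N : ℕ) : FinProb (Coins n N) :=
  (rateDist P MZ n N).prod ((rateDist P MY n N).prod (pairDist P MF n))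

/-- All random choices of the counting algorithm and the oracle. -/
abbrev Outcome (n N : ℕ) (L : Fin 3 → ℝ) : Type := SetCoins n N × Coins n N × ShiftExp L

/-- The distribution of all random choices. -/
def outcomeDist (P : Params) (ρ MZ MY MF : ℝ) (n N : ℕ) {L : Fin 3 → ℝ} (hL : ∀ i, 1 ≤ L i) :
    FinProb (Outcome n N L) :=
  (rateDist P ρ n N).prod ((coinDist P MZ MY MF n N).prod (shiftDist L hL))

/-- The parameters and choices of the oracle for a given outcome. -/
def toEnv (P : Params) (MZ MY MF : ℝ) (cap : ℕ) {L : Fin 3 → ℝ} (x : Outcome n N L) : Env n N :=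
  ⟨P, MZ, MY, MF, cap, shiftVec L x.2.2, x.1, x.2.1.1, x.2.1.2.1, x.2.1.2.2⟩

section Independence

variable {ρ MZ MY MF : ℝ} {L : Fin 3 → ℝ} (hL : ∀ i, 1 ≤ L i)

/-- The indicator of a proposition. -/
def ind (p : Prop) : ℝ := if p then 1 else 0

lemma ind_and (p q : Prop) : ind (p ∧ q) = ind p * ind q := by
  unfold ind
  by_cases hp : p <;> by_cases hq : q <;> simp [hp, hq]

lemma FinProb.Pr_eq_E_ind {Ω : Type*} [Fintype Ω] (D : FinProb Ω) (A : Ω → Prop) :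
    D.Pr A = D.E fun x => ind (A x) := rfl

lemma E_outcome (f : Outcome n N L → ℝ) : (outcomeDist P ρ MZ MY MF n N hL).E f =
    (rateDist P ρ n N).E fun r => (rateDist P MZ n N).E fun Z => (rateDist P MY n N).E fun Y =>
      (pairDist P MF n).E fun F => (shiftDist L hL).E fun e => f (r, (Z, Y, F), e) := by
  simp only [outcomeDist, coinDist, FinProb.E_prod]

lemma Pr_sets_and_coins (A : SetCoins n N → SetCoins n N → Prop)
    (B : SetCoins n N → ShiftExp L → Prop) :
    (outcomeDist P ρ MZ MY MF n N hL).Pr (fun x => A x.1 x.2.1.1 ∧ B x.2.1.2.1 x.2.2) =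
      ((rateDist P ρ n N).prod (rateDist P MZ n N)).Pr (fun x => A x.1 x.2) *
        ((rateDist P MY n N).prod (shiftDist L hL)).Pr fun x => B x.1 x.2 := by
  simp only [FinProb.Pr_eq_E_ind, E_outcome, FinProb.E_prod]
  simp only [ind_and, FinProb.E_mul_left, FinProb.E_mul_right, FinProb.E_const]

lemma Pr_sets_and_nodes (A : SetCoins n N → Prop) (B : SetCoins n N → ShiftExp L → Prop) :
    (outcomeDist P ρ MZ MY MF n N hL).Pr (fun x => A x.1 ∧ B x.2.1.1 x.2.2) =
      (rateDist P ρ n N).Pr A * ((rateDist P MZ n N).prod (shiftDist L hL)).Pr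
        fun x => B x.1 x.2 := by
  simp only [FinProb.Pr_eq_E_ind, E_outcome, FinProb.E_prod]
  simp only [ind_and, FinProb.E_mul_left, FinProb.E_mul_right, FinProb.E_const]

lemma Pr_three (A B C : SetCoins n N → Prop) :
    (outcomeDist P ρ MZ MY MF n N hL).Pr (fun x => A x.1 ∧ B x.2.1.1 ∧ C x.2.1.2.1) =
      (rateDist P ρ n N).Pr A * ((rateDist P MZ n N).Pr B * (rateDist P MY n N).Pr C) := by
  simp only [FinProb.Pr_eq_E_ind, E_outcome]
  simp only [ind_and, FinProb.E_mul_left, FinProb.E_mul_right, FinProb.E_const]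

lemma Pr_sampled_outcome (A : SetCoins n N → SetCoins n N → Prop) :
    (outcomeDist P ρ MZ MY MF n N hL).Pr (fun x => A x.1 x.2.1.1) =
      ((rateDist P ρ n N).prod (rateDist P MZ n N)).Pr (fun x => A x.1 x.2) := by
  simp only [FinProb.Pr_eq_E_ind, E_outcome, FinProb.E_prod]
  simp only [FinProb.E_const]

lemma Pr_pairs_outcome (A : (Fin n × Fin n → Bool) → Prop) :
    (outcomeDist P ρ MZ MY MF n N hL).Pr (fun x => A x.2.1.2.2) = (pairDist P MF n).Pr A := by
  simp only [FinProb.Pr_eq_E_ind, E_outcome]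
  simp only [FinProb.E_const]

end Independence

/-! ### Accuracy of the estimates that are used for all vertices -/

/-- The floor m of `chernoff_rate` is taken to be M, so that m/ρ is the inverse base rate. The map A
leaves all choices except Y unspecified. -/
lemma Pr_not_goodWedges_le (hP : P.Good) {M : ℝ} (hM : 0 < M) {γ : ℝ} (hγ : 0 < γ) (hγ1 : γ ≤ 1)
    (A : SetCoins n N → Env n N) (hA : ∀ Y, (A Y).P = P ∧ (A Y).MY = M ∧ (A Y).Y = Y) :
    (rateDist P M n N).Pr (fun Y => ¬ (A Y).GoodWedges G γ) ≤
      (N * (6 * (n * n)) : ℝ) * (2 * Real.exp (-(γ ^ 2 * M / 2))) := by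
  set S := (Finset.univ : Finset (Fin N)) ×ˢ ((Finset.univ : Finset Label) ×ˢ
    ((Finset.univ : Finset (Fin n)) ×ˢ (Finset.univ : Finset (Fin n))))
  have hS : (S.card : ℝ) = N * (6 * (n * n)) := by
    have h6 : (Finset.univ : Finset Label).card = 6 := rfl
    simp only [S, Finset.card_product, h6, Finset.card_univ, Fintype.card_fin]
    push_cast; ring
  rw [← hS]
  refine le_trans (FinProb.Pr_mono _ (B := fun Y => ∃ p ∈ S,
    γ * (((commonNbrs G p.2.2.1 p.2.2.2).image fun z => (p.1, p.2.1, z)).card +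
      M / (M * P.base (p.1 : ℕ) p.2.1)) <
    |FinProb.countOn ((commonNbrs G p.2.2.1 p.2.2.2).image fun z => (p.1, p.2.1, z)) Y /
      rate P M (p.1 : ℕ) p.2.1 -
        ((commonNbrs G p.2.2.1 p.2.2.2).image fun z => (p.1, p.2.1, z)).card|) ?_)
    (FinProb.Pr_exists_mem_le _ _ _ fun p _ => ?_)
  · intro Y hY
    unfold Env.GoodWedges at hY
    push Not at hY
    obtain ⟨k, l, a, b, h⟩ := hY
    refine ⟨(k, l, a, b), by simp [S], ?_⟩
    obtain ⟨h1, h2, h3⟩ := hA Y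
    have hinj : Function.Injective fun z : Fin n => (k, l, z) := fun z z' h => by
      simp only [Prod.mk.injEq] at h; exact h.2.2
    rw [h1, h2] at h
    simp only
    rw [Finset.card_image_of_injective _ hinj]
    have e1 : M / (M * P.base (k : ℕ) l) = 1 / P.base (k : ℕ) l := by
      have := hP.base_pos (k : ℕ) l
      field_simp
    have e2 : FinProb.countOn ((commonNbrs G a b).image fun z => (k, l, z)) Y =
        ((A Y).probes G k l a b).card := by
      unfold FinProb.countOn
      rw [Finset.filter_image, Finset.card_image_of_injective _ hinj]
      congr 2
      ext z
      simp only [Finset.mem_filter, mem_commonNbrs, Env.probes, mem_filt, h3]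
      tauto
    rw [e1, e2]
    exact h
  · refine FinProb.chernoff_rate (fun i : Fin N × Label × Fin n => rate P M (i.1 : ℕ) i.2.1) _ _
      (M * P.base (p.1 : ℕ) p.2.1) (fun i hi => ?_) (mul_pos hM (hP.base_pos _ _))
      (coe_rate hP hM.le _ _) hγ hγ1 hM.le
    obtain ⟨z, -, rfl⟩ := Finset.mem_image.1 hi
    rfl

lemma Pr_not_goodEdges_le (hP : P.Good) {M : ℝ} (hM : 0 < M) {γ : ℝ} (hγ : 0 < γ) (hγ1 : γ ≤ 1)
    (A : (Fin n × Fin n → Bool) → Env n N)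
    (hA : ∀ F, (A F).P = P ∧ (A F).MF = M ∧ (A F).F = F) :
    (pairDist P M n).Pr (fun F => ¬ (A F).GoodEdges G γ) ≤
      (n * n : ℝ) * (2 * Real.exp (-(γ ^ 2 * M / 2))) := by
  have hs := hP.sqrt_pos
  set S := (Finset.univ : Finset (Fin n)) ×ˢ (Finset.univ : Finset (Fin n))
  have hS : (S.card : ℝ) = n * n := by
    simp only [S, Finset.card_product, Finset.card_univ, Fintype.card_fin]
    push_cast; ring
  rw [← hS]
  refine le_trans (FinProb.Pr_mono _ (B := fun F => ∃ p ∈ S,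
    γ * ((filt fun z : Fin n × Fin n => IsCyc G p.1 p.2 z.1 z.2).card + M / (M / √P.T)) <
    |FinProb.countOn (filt fun z : Fin n × Fin n => IsCyc G p.1 p.2 z.1 z.2) F /
      pairRate P M - (filt fun z : Fin n × Fin n => IsCyc G p.1 p.2 z.1 z.2).card|) ?_)
    (FinProb.Pr_exists_mem_le _ _ _ fun p _ => ?_)
  · intro F hF
    unfold Env.GoodEdges at hF
    push Not at hF
    obtain ⟨u, v, h⟩ := hF
    refine ⟨(u, v), by simp [S], ?_⟩
    obtain ⟨h1, h2, h3⟩ := hA F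
    rw [heaviness_edge] at h
    unfold Env.estEdge at h
    rw [h1, h2] at h
    have e1 : M / (M / √P.T) = √P.T := by field_simp
    have e2 : FinProb.countOn (filt fun z : Fin n × Fin n => IsCyc G u v z.1 z.2) F =
        (filt fun p : Fin n × Fin n => (A F).F p = true ∧ IsCyc G u v p.1 p.2).card := by
      unfold FinProb.countOn
      congr 2
      ext z
      simp only [Finset.mem_filter, mem_filt, h3]
      tauto
    rw [e1, e2]
    exact h
  · exact FinProb.chernoff_rate (fun _ : Fin n × Fin n => pairRate P M) _ _
      (M / √P.T) (fun i hi => rfl) (by positivity) (coe_projIcc (by positivity)) hγ hγ1 hM.le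

/-! ### The number of remembered edges -/

section First

variable {ρ MZ MY MF : ℝ} {L : Fin 3 → ℝ} (hL : ∀ i, 1 ≤ L i)

lemma Pr_src_le (hP : P.Good) {M : ℝ} (hρ : 0 ≤ ρ) (hZ : 0 ≤ MZ) (hY : 0 ≤ MY) (hρM : ρ ≤ M)
    (hZM : MZ ≤ M) (hYM : MY ≤ M) (cap : ℕ) (i i' : Fin 3) {x x' : Fin N × Label × Fin n}
    (hx : x ≠ x') :
    (outcomeDist P ρ MZ MY MF n N hL).Pr (fun ω =>
      (toEnv P MZ MY MF cap ω).src i x = true ∧ (toEnv P MZ MY MF cap ω).src i' x' = true) ≤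
      M * P.base (x.1 : ℕ) x.2.1 * (M * P.base (x'.1 : ℕ) x'.2.1) := by
  -- The coordinates demanded of source j. If both demands concern one source, the coordinates still
  -- differ, and the probabilities multiply.
  set J : Fin 3 → Finset (Fin N × Label × Fin n) := fun j =>
    (if i = j then {x} else ∅) ∪ (if i' = j then {x'} else ∅) with hJ
  have h0 := Pr_three (P := P) (ρ := ρ) (MZ := MZ) (MY := MY) (MF := MF) hL
    (fun ω : SetCoins n N => ∀ y ∈ J 0, ω y = true)
    (fun ω : SetCoins n N => ∀ y ∈ J 1, ω y = true) (fun ω : SetCoins n N => ∀ y ∈ J 2, ω y = true)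
  have hb : ∀ (m : ℝ), 0 ≤ m → m ≤ M → ∀ j, (rateDist P m n N).Pr
      (fun ω => ∀ y ∈ J j, ω y = true) ≤ ∏ y ∈ J j, M * P.base (y.1 : ℕ) y.2.1 := by
    intro m h1 h2 j
    refine (Pr_forall_mem_le hP h1 (J j)).trans (Finset.prod_le_prod (fun y _ => ?_) fun y _ => ?_)
    · exact mul_nonneg h1 (hP.base_pos _ _).le
    · exact mul_le_mul_of_nonneg_right h2 (hP.base_pos _ _).le
  have hnn : ∀ j, 0 ≤ ∏ y ∈ J j, M * P.base (y.1 : ℕ) y.2.1 := fun j =>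
    Finset.prod_nonneg fun y _ => mul_nonneg (hρ.trans hρM) (hP.base_pos _ _).le
  have h1 : (outcomeDist P ρ MZ MY MF n N hL).Pr (fun ω =>
      (toEnv P MZ MY MF cap ω).src i x = true ∧ (toEnv P MZ MY MF cap ω).src i' x' = true) ≤
      (∏ y ∈ J 0, M * P.base (y.1 : ℕ) y.2.1) * ((∏ y ∈ J 1, M * P.base (y.1 : ℕ) y.2.1) *
        ∏ y ∈ J 2, M * P.base (y.1 : ℕ) y.2.1) := by
    refine le_trans (FinProb.Pr_mono _ fun ω hω => ?_) (h0.le.trans ?_)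
    · have key : ∀ j, ∀ y ∈ J j, (toEnv P MZ MY MF cap ω).src j y = true := by
        intro j y hy
        rw [hJ] at hy
        rcases Finset.mem_union.1 hy with hy | hy
        · split_ifs at hy with h
          · rw [Finset.mem_singleton.1 hy, ← h]; exact hω.1
          · simp at hy
        · split_ifs at hy with h
          · rw [Finset.mem_singleton.1 hy, ← h]; exact hω.2
          · simp at hy
      exact ⟨key 0, key 1, key 2⟩
    · exact mul_le_mul (hb _ hρ hρM 0) (mul_le_mul (hb _ hZ hZM 1) (hb _ hY hYM 2)
        (FinProb.Pr_nonneg _ _) (hnn _)) (mul_nonneg (FinProb.Pr_nonneg _ _)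
          (FinProb.Pr_nonneg _ _)) (hnn _)
  refine h1.trans (le_of_eq ?_)
  fin_cases i <;> fin_cases i' <;> simp [hJ, Finset.prod_insert, hx] <;> ring

/-- The factor 324 = 3²·6² counts pairs of sources and pairs of labels. -/
lemma Pr_near_le (hP : P.Good) {M : ℝ} (hρ : 0 ≤ ρ) (hZ : 0 ≤ MZ) (hY : 0 ≤ MY) (hρM : ρ ≤ M)
    (hZM : MZ ≤ M) (hYM : MY ≤ M) (cap : ℕ) {a b : Fin n} (hab : a ≠ b) :
    (outcomeDist P ρ MZ MY MF n N hL).Pr (fun ω => (toEnv P MZ MY MF cap ω).Near a b) ≤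
      (324 * N ^ 2) * (M ^ 2 / P.δ ^ 8 / √P.T) := by
  have hδ := hP.δ_pos
  have hs := hP.sqrt_pos
  set S := ((Finset.univ : Finset (Fin 3)) ×ˢ (Finset.univ : Finset (Fin 3))) ×ˢ
    ((Finset.univ : Finset (Fin N)) ×ˢ (Finset.univ : Finset (Fin N))) ×ˢ
      ((Finset.univ : Finset Label) ×ˢ (Finset.univ : Finset Label))
  have hS : (S.card : ℝ) = 324 * N ^ 2 := by
    have h6 : (Finset.univ : Finset Label).card = 6 := rfl
    simp only [S, Finset.card_product, h6, Finset.card_univ, Fintype.card_fin]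
    push_cast; ring
  rw [← hS]
  refine le_trans (FinProb.Pr_mono _ (B := fun ω => ∃ p ∈ S,
    P.base (p.2.1.1 : ℕ) p.2.2.1 * P.base (p.2.1.2 : ℕ) p.2.2.2 * √P.T ≤ 1 / P.δ ^ 8 ∧
    ((toEnv P MZ MY MF cap ω).src p.1.1 (p.2.1.1, p.2.2.1, a) = true ∧
      (toEnv P MZ MY MF cap ω).src p.1.2 (p.2.1.2, p.2.2.2, b) = true)) ?_)
    (FinProb.Pr_exists_mem_le _ _ _ fun p _ => ?_)
  · rintro ω ⟨i, i', k, k', l, l', h1, h2, h3⟩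
    exact ⟨((i, i'), (k, k'), (l, l')), by simp [S], h3, h1, h2⟩
  · refine FinProb.Pr_le_of_imp _ (by positivity) (fun x hx => hx) fun hq => ?_
    refine (Pr_src_le hL hP hρ hZ hY hρM hZM hYM cap p.1.1 p.1.2
      (x := (p.2.1.1, p.2.2.1, a)) (x' := (p.2.1.2, p.2.2.2, b)) (fun h => hab ?_)).trans ?_
    · simp only [Prod.mk.injEq] at h; exact h.2.2
    · rw [le_div_iff₀ hs]
      have : M * P.base (p.2.1.1 : ℕ) p.2.2.1 * (M * P.base (p.2.1.2 : ℕ) p.2.2.2) * √P.T =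
        M ^ 2 * (P.base (p.2.1.1 : ℕ) p.2.2.1 * P.base (p.2.1.2 : ℕ) p.2.2.2 * √P.T) := by ring
      simp only [this]
      refine (mul_le_mul_of_nonneg_left hq (by positivity)).trans (le_of_eq (by ring))

lemma E_first_le (hP : P.Good) {M : ℝ} (hρ : 0 ≤ ρ) (hZ : 0 ≤ MZ) (hY : 0 ≤ MY) (hF : 0 ≤ MF)
    (hρM : ρ ≤ M) (hZM : MZ ≤ M) (hYM : MY ≤ M) (cap : ℕ) :
    (outcomeDist P ρ MZ MY MF n N hL).E (fun ω =>
      ((edgesOf G ∩ (toEnv P MZ MY MF cap ω).first).card : ℝ)) ≤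
      (edgesOf G).card * (2 * ((324 * N ^ 2) * (M ^ 2 / P.δ ^ 8 / √P.T) + MF / √P.T)) := by
  have hδ := hP.δ_pos
  have hs := hP.sqrt_pos
  set D := outcomeDist P ρ MZ MY MF n N hL
  have hE : D.E (fun ω => ((edgesOf G ∩ (toEnv P MZ MY MF cap ω).first).card : ℝ)) =
      ∑ e ∈ edgesOf G, D.Pr fun ω => e ∈ (toEnv P MZ MY MF cap ω).first := by
    rw [← FinProb.E_card_filter]
    congr 1; ext ω
    congr 2
    ext e; simp
  rw [hE, ← nsmul_eq_mul, ← Finset.sum_const]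
  refine Finset.sum_le_sum fun e he => ?_
  induction e with
  | _ a b =>
    have hab : a ≠ b := by
      have : G.Adj a b := (mem_filt (p := fun e => e ∈ G.edgeSet)).1 he
      exact this.ne
    have hpair : ∀ u v : Fin n, u ≠ v → D.Pr (fun ω => (toEnv P MZ MY MF cap ω).Near u v ∨
        (toEnv P MZ MY MF cap ω).F (u, v) = true) ≤
        (324 * N ^ 2) * (M ^ 2 / P.δ ^ 8 / √P.T) + MF / √P.T := by
      intro u v huv
      refine (D.Pr_or _ _).trans (add_le_add
        (Pr_near_le hL hP hρ hZ hY hρM hZM hYM cap huv) ?_)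
      refine (Pr_pairs_outcome hL fun F => F (u, v) = true).le.trans ?_
      have h1 := FinProb.Pr_allOn (fun _ : Fin n × Fin n => pairRate P MF) {(u, v)}
      rw [Finset.prod_singleton] at h1
      have h2 : (pairRate P MF : ℝ) ≤ MF / √P.T := by
        unfold pairRate
        rw [coe_projIcc (by positivity)]; exact min_le_right _ _
      refine le_trans (FinProb.Pr_mono _ fun F hF => ?_) (h1.le.trans h2)
      simpa using hF
    refine le_trans (D.Pr_mono (B := fun ω => ((toEnv P MZ MY MF cap ω).Near a b ∨
        (toEnv P MZ MY MF cap ω).F (a, b) = true) ∨ ((toEnv P MZ MY MF cap ω).Near b a ∨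
        (toEnv P MZ MY MF cap ω).F (b, a) = true)) fun ω hω => ?_) ?_
    · obtain ⟨a', b', h1, h2⟩ := mem_filt.1 hω
      rcases Sym2.eq_iff.1 h1 with ⟨rfl, rfl⟩ | ⟨rfl, rfl⟩
      · exact Or.inl h2
      · exact Or.inr h2
    · refine (D.Pr_or _ _).trans ((add_le_add (hpair a b hab) (hpair b a hab.symm)).trans
        (le_of_eq (by ring)))

end First

end

section

variable {n N : ℕ} {P : Params} {G : SimpleGraph (Fin n)}

/-! ### The probability of failure -/

section Failure

variable {ρ MZ MY MF : ℝ} {L : Fin 3 → ℝ} (hL : ∀ i, 1 ≤ L i) {α : ℝ}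

/-- A bound on the expected number of sampled configurations. -/
def popBound (P : Params) (α ρ MZ : ℝ) (N : ℕ) : ℝ :=
  (N * (16 * (α * P.T))) *
    ((N * 16) * (ρ ^ 4 / P.T) + (4 * (N * 6)) * (ρ * MZ ^ 3 / (P.δ ^ 4 * P.T)))

lemma card_configs_le_mul (hG : ((fourCycles G).ncard : ℝ) ≤ α * P.T) :
    ((filt fun c : Config n N => c.IsConfig G).card : ℝ) ≤ N * (16 * (α * P.T)) := by
  have h : ((filt fun c : Config n N => c.IsConfig G).card : ℝ) ≤
      N * (16 * ((fourCycles G).ncard : ℝ)) := by exact_mod_cast card_configs_le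
  refine h.trans ?_
  gcongr

lemma E_card_pop_le (hP : P.Good) (hρ : 0 ≤ ρ) (hZ : 0 ≤ MZ)
    (hG : ((fourCycles G).ncard : ℝ) ≤ α * P.T) (cap : ℕ) :
    (outcomeDist P ρ MZ MY MF n N hL).E (fun ω => (((toEnv P MZ MY MF cap ω).pop G).card : ℝ)) ≤
      popBound P α ρ MZ N := by
  have hδ := hP.δ_pos
  have hT := hP.T_pos
  set D := outcomeDist P ρ MZ MY MF n N hL
  have h : D.E (fun ω => (((toEnv P MZ MY MF cap ω).pop G).card : ℝ)) =
      ∑ c ∈ filt fun c : Config n N => c.IsConfig G, D.Pr fun ω => Sampled P ω.1 ω.2.1.1 c := by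
    rw [← FinProb.E_card_filter]
    congr 1; ext ω
    congr 2
    ext c
    simp only [Env.pop, Finset.mem_filter, mem_filt]
    rfl
  rw [h]
  refine (Finset.sum_le_sum fun c hc => (Pr_sampled_outcome hL fun r Z => Sampled P r Z c).le.trans
    (Pr_sampled_le hP hρ hZ (mem_filt.1 hc))).trans ?_
  rw [Finset.sum_const, nsmul_eq_mul]
  exact mul_le_mul_of_nonneg_right (card_configs_le_mul hG) (by positivity)

/-- Being tracked is determined by r and Z, badness by Y and the shifts. By independence the bound
is the expected number of tracked configurations times p, with no factor T. -/
lemma Pr_exists_badConfig_le (hP : P.Good) (hρ : 0 ≤ ρ) (hZ : 0 ≤ MZ)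
    (hG : ((fourCycles G).ncard : ℝ) ≤ α * P.T) (cap : ℕ) {η γ p : ℝ} (hp : 0 ≤ p)
    (h : ∀ c : Config n N, c.IsConfig G → ((rateDist P MY n N).prod (shiftDist L hL)).Pr (fun x =>
      BadConfig P MY G (fun i => shiftBase (L i)) (shiftVec L x.2) η γ c x.1) ≤ p) :
    (outcomeDist P ρ MZ MY MF n N hL).Pr (fun ω => ∃ c ∈ (toEnv P MZ MY MF cap ω).pop G,
      BadConfig P MY G (fun i => shiftBase (L i)) (shiftVec L ω.2.2) η γ c ω.2.1.2.1) ≤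
      popBound P α ρ MZ N * p := by
  have hδ := hP.δ_pos
  have hT := hP.T_pos
  set D := outcomeDist P ρ MZ MY MF n N hL
  refine le_trans (D.Pr_mono (B := fun ω => ∃ c ∈ filt fun c : Config n N => c.IsConfig G,
    Sampled P ω.1 ω.2.1.1 c ∧ BadConfig P MY G (fun i => shiftBase (L i)) (shiftVec L ω.2.2) η γ c
      ω.2.1.2.1) ?_) ((D.Pr_exists_mem_le _ _ (p := ((N * 16) * (ρ ^ 4 / P.T) +
        (4 * (N * 6)) * (ρ * MZ ^ 3 / (P.δ ^ 4 * P.T))) * p) fun c hc => ?_).trans ?_)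
  · rintro ω ⟨c, hc, hb⟩
    obtain ⟨h1, h2⟩ := mem_filt.1 hc
    exact ⟨c, mem_filt.2 h1, h2, hb⟩
  · rw [Pr_sets_and_coins hL (fun r Z => Sampled P r Z c) fun Y e => BadConfig P MY G
      (fun i => shiftBase (L i)) (shiftVec L e) η γ c Y]
    exact mul_le_mul (Pr_sampled_le hP hρ hZ (mem_filt.1 hc)) (h c (mem_filt.1 hc))
      (FinProb.Pr_nonneg _ _) (by positivity)
  · unfold popBound
    rw [mul_assoc _ _ p]
    exact mul_le_mul_of_nonneg_right (card_configs_le_mul hG) (by positivity)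

/-- Badness of a node depends on Z, and so may being tracked. But nodes matter only in
configurations relevant to a query, and the queries depend on r alone, so independence is available
again. -/
lemma Pr_exists_badNode_le (hP : P.Good) (hρ : 0 ≤ ρ)
    (hG : ((fourCycles G).ncard : ℝ) ≤ α * P.T) {γ p : ℝ} (hp : 0 ≤ p)
    (h : ∀ (c : Config n N) v, ((rateDist P MZ n N).prod (shiftDist L hL)).Pr (fun x =>
      BadNode P MZ G (fun i => shiftBase (L i)) (shiftVec L x.2) γ c v x.1) ≤ p) :
    (outcomeDist P ρ MZ MY MF n N hL).Pr (fun ω => ∃ c ∈ filt fun c : Config n N => c.IsConfig G,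
      ∃ q ∈ relevantTo P c, AllIn ω.1 q ∧ ∃ v ∈ nodeSet c.cycle,
      BadNode P MZ G (fun i => shiftBase (L i)) (shiftVec L ω.2.2) γ c v ω.2.1.1) ≤
      (N * (16 * (α * P.T))) * ((N * 16) * (ρ ^ 4 / P.T * (4 * p))) := by
  have hT := hP.T_pos
  set D := outcomeDist P ρ MZ MY MF n N hL
  refine (D.Pr_exists_mem_le _ _ (p := (N * 16) * (ρ ^ 4 / P.T * (4 * p))) fun c hc => ?_).trans
    (mul_le_mul_of_nonneg_right (card_configs_le_mul hG) (by positivity))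
  refine (D.Pr_exists_mem_le _ _ (p := ρ ^ 4 / P.T * (4 * p)) fun q hq => ?_).trans
    (mul_le_mul_of_nonneg_right (by exact_mod_cast card_relevantTo_le c) (by positivity))
  rw [Pr_sets_and_nodes hL (fun r => AllIn r q) fun Z e => ∃ v ∈ nodeSet c.cycle,
      BadNode P MZ G (fun i => shiftBase (L i)) (shiftVec L e) γ c v Z]
  refine mul_le_mul (Pr_allIn_le hP hρ (mem_filt.1 hq).1) ?_ (FinProb.Pr_nonneg _ _)
    (by positivity)
  refine (FinProb.Pr_exists_mem_le _ _ _ fun v _ => h c v).trans (le_of_eq ?_)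
  rw [card_nodeSet (mem_filt.1 hc).1]; norm_num

/-- All events needed for the correctness of the oracle. -/
structure Env.Success (V : Env n N) (G : SimpleGraph (Fin n)) (b : Fin 3 → ℝ)
    (η γ₀ γ₁ γ γ₂ X₁ X₂ : ℝ) : Prop where
  wedges : V.GoodWedges G γ₀
  edges : V.GoodEdges G γ₁
  configs : ¬ ∃ c ∈ V.pop G, BadConfig V.P V.MY G b V.s η γ c V.Y
  nodes : ¬ ∃ c ∈ filt fun c : Config n N => c.IsConfig G, ∃ q ∈ relevantTo V.P c,
    AllIn V.r q ∧ ∃ v ∈ nodeSet c.cycle, BadNode V.P V.MZ G b V.s γ₂ c v V.Z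
  card_pop : ¬ X₁ < ((V.pop G).card : ℝ)
  card_first : ¬ X₂ < ((edgesOf G ∩ V.first).card : ℝ)

lemma FinProb.Pr_not_and_le {Ω : Type*} [Fintype Ω] (D : FinProb Ω) {A B : Ω → Prop} {p q : ℝ}
    (hA : D.Pr (fun x => ¬ A x) ≤ p) (hB : D.Pr (fun x => ¬ B x) ≤ q) :
    D.Pr (fun x => ¬ (A x ∧ B x)) ≤ p + q :=
  (D.Pr_mono fun _ h => not_and_or.1 h).trans ((D.Pr_or _ _).trans (add_le_add hA hB))

lemma Pr_not_success_le (hP : P.Good) (hN : N = P.numScales) {M : ℝ} (hρ : 0 ≤ ρ) (hZ : 1 ≤ MZ)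
    (hY : 1 ≤ MY) (hF : 0 < MF) (hρM : ρ ≤ M) (hZM : MZ ≤ M) (hYM : MY ≤ M)
    (hG : ((fourCycles G).ncard : ℝ) ≤ α * P.T) (cap : ℕ) {η γ₀ γ₁ γ γ₂ X₁ X₂ : ℝ}
    (hη : 0 < η) (hη1 : η ≤ 1) (hγ₀ : 0 < γ₀) (hγ₀1 : γ₀ ≤ 1) (hγ₁ : 0 < γ₁) (hγ₁1 : γ₁ ≤ 1)
    (hγ : 0 < γ) (hγ₂ : 0 < γ₂) (hX₁ : 0 < X₁) (hX₂ : 0 < X₂) (hα : 0 ≤ α) :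
    (outcomeDist P ρ MZ MY MF n N hL).Pr (fun ω => ¬ (toEnv P MZ MY MF cap ω).Success G
      (fun i => shiftBase (L i)) η γ₀ γ₁ γ γ₂ X₁ X₂) ≤
      (N * (6 * (n * n)) : ℝ) * (2 * Real.exp (-(γ₀ ^ 2 * MY / 2))) +
      ((n * n : ℝ) * (2 * Real.exp (-(γ₁ ^ 2 * MF / 2))) +
      (popBound P α ρ MZ N * (64 * (1 / (50 * L 0)) + (16 * (1 / (50 * L 1) +
        (4 / η * Real.log (64 * (α * P.T) + 1) / (100 * L 0) +
          (4096 / (P.δ ^ 2 * MY * γ ^ 2) + 4096 / (P.δ ^ 2 * MY * γ ^ 2)))) + 1 / (50 * L 1))) +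
      ((N * (16 * (α * P.T))) * ((N * 16) * (ρ ^ 4 / P.T * (4 *
        (4096 / (P.δ ^ 2 * MZ * γ₂ ^ 2) + 1 / (50 * L 2))))) +
      (popBound P α ρ MZ N / X₁ +
      ((edgesOf G).card * (2 * ((324 * N ^ 2) * (M ^ 2 / P.δ ^ 8 / √P.T) +
        MF / √P.T))) / X₂)))) := by
  have hδ := hP.δ_pos
  have hT := hP.T_pos
  have hlog : 0 ≤ Real.log (64 * (α * P.T) + 1) := by
    apply Real.log_nonneg
    have : 0 ≤ 64 * (α * P.T) := by positivity
    linarith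
  have hL0 : ∀ i, 0 < L i := fun i => lt_of_lt_of_le one_pos (hL i)
  have hL00 := hL0 0
  have hL01 := hL0 1
  have hL02 := hL0 2
  have hY0 : 0 < MY := by linarith
  have hZ0 : 0 < MZ := by linarith
  set D := outcomeDist P ρ MZ MY MF n N hL
  refine (D.Pr_mono (B := fun ω => ¬ ((toEnv P MZ MY MF cap ω).GoodWedges G γ₀ ∧
    (toEnv P MZ MY MF cap ω).GoodEdges G γ₁ ∧
    (¬ ∃ c ∈ (toEnv P MZ MY MF cap ω).pop G, BadConfig P MY G (fun i => shiftBase (L i))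
      (shiftVec L ω.2.2) η γ c ω.2.1.2.1) ∧
    (¬ ∃ c ∈ filt fun c : Config n N => c.IsConfig G, ∃ q ∈ relevantTo P c, AllIn ω.1 q ∧
      ∃ v ∈ nodeSet c.cycle, BadNode P MZ G (fun i => shiftBase (L i)) (shiftVec L ω.2.2) γ₂ c v
        ω.2.1.1) ∧
    ¬ X₁ < (((toEnv P MZ MY MF cap ω).pop G).card : ℝ) ∧
    ¬ X₂ < ((edgesOf G ∩ (toEnv P MZ MY MF cap ω).first).card : ℝ))) fun ω h hand =>
    h ⟨hand.1, hand.2.1, hand.2.2.1, hand.2.2.2.1,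
    hand.2.2.2.2.1, hand.2.2.2.2.2⟩).trans ?_
  refine D.Pr_not_and_le ?_ (D.Pr_not_and_le ?_ (D.Pr_not_and_le ?_ (D.Pr_not_and_le ?_
    (D.Pr_not_and_le ?_ ?_))))
  · refine FinProb.Pr_prod_le_of_snd _ _ fun r => FinProb.Pr_prod_le_of_fst _ _ fun e =>
      FinProb.Pr_prod_le_of_snd _ _ fun Z => FinProb.Pr_prod_le_of_fst _ _ fun F => ?_
    exact Pr_not_goodWedges_le hP hY0 hγ₀ hγ₀1 (fun Y => toEnv P MZ MY MF cap (r, (Z, Y, F), e))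
      fun Y => ⟨rfl, rfl, rfl⟩
  · refine FinProb.Pr_prod_le_of_snd _ _ fun r => FinProb.Pr_prod_le_of_fst _ _ fun e =>
      FinProb.Pr_prod_le_of_snd _ _ fun Z => FinProb.Pr_prod_le_of_snd _ _ fun Y => ?_
    exact Pr_not_goodEdges_le hP hF hγ₁ hγ₁1 (fun F => toEnv P MZ MY MF cap (r, (Z, Y, F), e))
      fun F => ⟨rfl, rfl, rfl⟩
  · refine le_trans (D.Pr_mono fun ω h => not_not.1 h) ?_
    exact Pr_exists_badConfig_le hL hP hρ hZ0.le hG cap (by positivity) fun c hc =>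
      Pr_badConfig_le hP hN hL hY hG hη hη1 hγ hc
  · refine le_trans (D.Pr_mono fun ω h => not_not.1 h) ?_
    exact Pr_exists_badNode_le hL hP hρ hG (by positivity) fun c v =>
      Pr_badNode_le hP hL hZ hγ₂ c v
  · refine le_trans (D.Pr_mono fun ω h => not_not.1 h)
      ((D.markov (fun ω => by positivity) hX₁).trans ?_)
    exact div_le_div_of_nonneg_right (E_card_pop_le hL hP hρ hZ0.le hG cap) hX₁.le
  · refine le_trans (D.Pr_mono fun ω h => not_not.1 h)
      ((D.markov (fun ω => by positivity) hX₂).trans ?_)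
    exact div_le_div_of_nonneg_right
      (E_first_le hL hP hρ hZ0.le hY0.le hF.le hρM hZM hYM cap) hX₂.le

end Failure

/-! ### Consequences of success -/

variable {V : Env n N}

lemma Env.Success.estLLM_recon_iff {b : Fin 3 → ℝ} {η γ₀ γ₁ γ γ₂ X₁ X₂ : ℝ} (hP : V.P.Good)
    (h : V.Success G b η γ₀ γ₁ γ γ₂ X₁ X₂) (hA : V.Accurate G b η γ₀ γ₁ γ γ₂) (hM : 0 < V.MY)
    (hcap : V.s 0 * V.MY / V.P.δ + 1 < V.cap) {S : Finset (Sym2 (Fin n))} (hS : V.MemSpec G S)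
    {q : Config n N} (hq : q.IsConfig G) (hin : AllIn V.r q) :
    V.EstLLM (recon S) q ↔ IsLLM V.P V.s G q := by
  rw [Env.estLLM_recon hS hP (zero_le_one.trans (hA.s_ge 0)) hM hcap hq hin]
  refine Env.estLLM_iff hP hA hM (fun c hc hb => h.configs ⟨c, hc, hb⟩) hq hin
    fun c hc v hv hb => h.nodes ⟨c, mem_filt.2 (hc.isConfig hq), q,
      mem_filt.2 ⟨Env.isConfig_top hq, hc⟩, hin, v, ?_, hb⟩
  simpa using hv

/-- A query is relevant to itself and hence tracked. -/
lemma Env.ncard_realized_le (hP : V.P.Good) {e : Fin 3 → ℕ} :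
    {q | IsRealized G (V.r, e) q}.ncard ≤ (V.pop G).card := by
  rw [ncard_eq_card_filt]
  refine Finset.card_le_card fun q hq => ?_
  obtain ⟨h1, h2⟩ := (mem_filt (p := fun q => IsRealized G (V.r, e) q)).1 hq
  exact (Env.mem_pop_of_relevant hP h1 h2 (Relevant.refl hP q)).1

lemma Env.Success.card_memory_le {b : Fin 3 → ℝ} {η γ₀ γ₁ γ γ₂ X₁ X₂ : ℝ}
    (h : V.Success G b η γ₀ γ₁ γ γ₂ X₁ X₂) {S : Finset (Sym2 (Fin n))} (hS : V.MemSpec G S) :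
    (S.card : ℝ) ≤ X₂ + 4 * X₁ + X₁ * (48 * X₂) * (1 + V.cap) := by
  have h1 := not_lt.1 h.card_pop
  have h2 := not_lt.1 h.card_first
  have h3 : (S.card : ℝ) ≤ (edgesOf G ∩ V.first).card + 4 * (V.pop G).card +
    (V.pop G).card * (4 * (6 * (2 * (edgesOf G ∩ V.first).card))) * (1 + V.cap) := by
    exact_mod_cast hS.card_le
  have h4 : (0 : ℝ) ≤ (V.pop G).card := by positivity
  have h5 : (0 : ℝ) ≤ (edgesOf G ∩ V.first).card := by positivity
  have h6 : ((V.pop G).card : ℝ) * (4 * (6 * (2 * (edgesOf G ∩ V.first).card))) * (1 + V.cap) ≤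
      X₁ * (48 * X₂) * (1 + V.cap) := by
    refine mul_le_mul_of_nonneg_right (mul_le_mul h1 ?_ (by positivity) (h4.trans h1))
      (by positivity)
    linarith
  linarith

end

section

variable {n N : ℕ} {P : Params} {G : SimpleGraph (Fin n)}

/-! ### The choice of the parameters -/

section Numeric

variable {U : ℝ} (hU : 10 ^ 6 ≤ U)
include hU

lemma mul_pow_le_pow {a : ℝ} {j k : ℕ} (ha : a ≤ 10 ^ 6) (hj : j < k) : a * U ^ j ≤ U ^ k := by
  have hU1 : 1 ≤ U := le_trans (by norm_num) hU
  calc a * U ^ j ≤ U * U ^ j := by gcongr; exact ha.trans hU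
    _ = U ^ (j + 1) := by ring
    _ ≤ U ^ k := pow_le_pow_right₀ hU1 hj

lemma mul_pow_le_pow_add_two {a : ℝ} {j : ℕ} (ha : a ≤ 10 ^ 12) : a * U ^ j ≤ U ^ (j + 2) := by
  have hU1 : 1 ≤ U := le_trans (by norm_num) hU
  have h2 : (10 ^ 6 : ℝ) ^ 2 ≤ U ^ 2 := by gcongr
  calc a * U ^ j ≤ U ^ 2 * U ^ j := by gcongr; norm_num at h2 ha ⊢; linarith
    _ = U ^ (j + 2) := by ring

/-- In powers of U: the accuracy costs 2k, δ⁻² costs 2, and all constants together are at most 10¹²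
≤ U². -/
lemma deviation_term_le {d : ℝ} (hd0 : 0 < d) (hd : 1 ≤ d * U) {a : ℝ} (ha0 : 0 < a) (ha : a ≤ 32)
    {m k j : ℕ} (h : 2 * k + j + 4 ≤ m) :
    4096 / (d ^ 2 * U ^ m * ((1 / (200 * U ^ k)) / a) ^ 2) ≤ 1 / U ^ j := by
  have hU1 : 1 ≤ U := le_trans (by norm_num) hU
  have hU0 : 0 < U := by linarith
  have e : d ^ 2 * U ^ m * ((1 / (200 * U ^ k)) / a) ^ 2 =
      d ^ 2 * U ^ m / (40000 * a ^ 2 * U ^ (2 * k)) := by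
    rw [pow_mul']; field_simp; norm_num
  rw [e, div_div_eq_mul_div, div_le_div_iff₀ (by positivity) (by positivity), one_mul]
  have h1 : 4096 * (40000 * a ^ 2) ≤ (10 : ℝ) ^ 12 := by nlinarith
  have h2 := mul_pow_le_pow_add_two hU (j := 2 * k + j) h1
  have h3 : 1 ≤ (d * U) ^ 2 := one_le_pow₀ hd
  obtain ⟨i, rfl⟩ := Nat.exists_eq_add_of_le h
  have h4 : U ^ (2 * k + j + 2) ≤ U ^ (2 * k + j + 2 + i) :=
    pow_le_pow_right₀ hU1 (Nat.le_add_right _ _)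
  calc 4096 * (40000 * a ^ 2 * U ^ (2 * k)) * U ^ j
      = 4096 * (40000 * a ^ 2) * U ^ (2 * k + j) := by ring
    _ ≤ U ^ (2 * k + j + 2 + i) := h2.trans h4
    _ ≤ (d * U) ^ 2 * U ^ (2 * k + j + 2 + i) := le_mul_of_one_le_left (by positivity) h3
    _ = d ^ 2 * U ^ (2 * k + j + 4 + i) := by ring

lemma exponent_ge {a : ℝ} (ha0 : 0 < a) (ha : a ≤ 32) {m k : ℕ} (h : 2 * k + 4 ≤ m) :
    U ^ 2 ≤ ((1 / (200 * U ^ k)) / a) ^ 2 * U ^ m / 2 := by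
  have hU1 : 1 ≤ U := le_trans (by norm_num) hU
  have hU0 : 0 < U := by linarith
  have e : ((1 / (200 * U ^ k)) / a) ^ 2 * U ^ m / 2 = U ^ m / (80000 * a ^ 2 * U ^ (2 * k)) := by
    rw [pow_mul']; field_simp; norm_num
  rw [e, le_div_iff₀ (by positivity)]
  have h1 : 80000 * a ^ 2 ≤ (10 : ℝ) ^ 12 := by nlinarith
  calc U ^ 2 * (80000 * a ^ 2 * U ^ (2 * k)) = 80000 * a ^ 2 * U ^ (2 * k + 2) := by ring
    _ ≤ U ^ (2 * k + 2 + 2) := mul_pow_le_pow_add_two hU h1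
    _ ≤ U ^ m := pow_le_pow_right₀ hU1 h

/-- For y = n ≤ e^U the factor in front is at most e^{5U}/U, and U² ≥ 5U. -/
lemma exp_term_le {x y : ℝ} (hx : U ^ 2 ≤ x) (hy0 : 0 ≤ y) (hy : y ≤ Real.exp U) :
    U * (6 * (y * y)) * (2 * Real.exp (-x)) ≤ 1 / U := by
  have hU1 : 1 ≤ U := le_trans (by norm_num) hU
  have hU0 : 0 < U := by linarith
  have h1 : U ≤ Real.exp U := by linarith [Real.add_one_le_exp U]
  have h2 : 12 ≤ Real.exp U := le_trans (by linarith) h1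
  have h3 : Real.exp (-x) ≤ Real.exp (-(5 * U)) := Real.exp_le_exp.2 (by nlinarith)
  have h4 : 12 * (U * U * (y * y)) ≤ Real.exp (5 * U) := by
    have e : Real.exp (5 * U) =
        Real.exp U * (Real.exp U * Real.exp U * (Real.exp U * Real.exp U)) := by
      rw [← Real.exp_add, ← Real.exp_add, ← Real.exp_add]; ring_nf
    rw [e]
    gcongr
  rw [le_div_iff₀ hU0]
  calc U * (6 * (y * y)) * (2 * Real.exp (-x)) * U
      = 12 * (U * U * (y * y)) * Real.exp (-x) := by ring
    _ ≤ Real.exp (5 * U) * Real.exp (-(5 * U)) := by gcongr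
    _ = 1 := by rw [← Real.exp_add]; simp

end Numeric

/-- The parameters of the three shifts. -/
def shiftParam (U : ℝ) : Fin 3 → ℝ := ![U ^ 538, U ^ 268, U ^ 26]

lemma one_le_shiftParam {U : ℝ} (hU : 1 ≤ U) (i : Fin 3) : 1 ≤ shiftParam U i := by
  fin_cases i <;> exact one_le_pow₀ hU

lemma shiftParam_le {U : ℝ} (hU : 1 ≤ U) (i : Fin 3) : shiftParam U i ≤ U ^ 4000 := by
  fin_cases i <;> exact pow_le_pow_right₀ hU (by norm_num)

/-- `U` bounds all polylogarithmic quantities. -/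
structure Params.Bounded (P : Params) (α ρ U : ℝ) (n N : ℕ) : Prop where
  U_ge : 10 ^ 6 ≤ U
  δ_ge : 1 ≤ P.δ * U
  scales : (N : ℝ) ≤ U
  α_ge : 0 ≤ α
  α_le : α ≤ U
  ρ_ge : 0 ≤ ρ
  ρ_le : ρ ≤ U ^ 5
  log_le : Real.log (64 * (α * P.T) + 1) ≤ U
  n_le : (n : ℝ) ≤ Real.exp U

/-! ### The failure terms for the chosen exponents. -/

section Bounded

variable {α ρ U : ℝ} (hP : P.Good) (hB : P.Bounded α ρ U n N)
include hP hB

/-- The dominant term is N²αρ·MZ³·δ⁻⁴, of order 2 + 1 + 5 + 252 + 4 = 264 in U. -/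
lemma popBound_le : popBound P α ρ (U ^ 84) N ≤ U ^ 265 := by
  obtain ⟨hU, hd, hN, hα0, hα, hρ0, hρ, -, -⟩ := hB
  have hδ := hP.δ_pos
  have hT := hP.T_pos
  have hU0 : 0 < U := lt_of_lt_of_le (by norm_num) hU
  have hd' : 1 / P.δ ≤ U := by rw [div_le_iff₀ hδ]; linarith
  have e : popBound P α ρ (U ^ 84) N = 16 * (N * α) *
      (16 * N * ρ ^ 4 + 24 * N * (ρ * (U ^ 84) ^ 3 * (1 / P.δ) ^ 4)) := by
    unfold popBound; field_simp; ring
  rw [e]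
  calc 16 * (N * α) * (16 * N * ρ ^ 4 + 24 * N * (ρ * (U ^ 84) ^ 3 * (1 / P.δ) ^ 4))
      ≤ 16 * (U * U) * (16 * U * (U ^ 5) ^ 4 + 24 * U * (U ^ 5 * (U ^ 84) ^ 3 * U ^ 4)) := by gcongr
    _ = 256 * U ^ 23 + 384 * U ^ 264 := by ring
    _ ≤ U ^ 264 + 384 * U ^ 264 :=
        add_le_add_left (mul_pow_le_pow hU (by norm_num) (by norm_num)) _
    _ = 385 * U ^ 264 := by ring
    _ ≤ U ^ 265 := mul_pow_le_pow hU (by norm_num) (by norm_num)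

lemma config_term_le {B : ℝ} (hB0 : B ≤ U ^ 265) :
    B * (64 * (1 / (50 * U ^ 538)) + (16 * (1 / (50 * U ^ 268) +
        (4 / ((1 / (200 * U ^ 268)) / 16) * Real.log (64 * (α * P.T) + 1) / (100 * U ^ 538) +
          (4096 / (P.δ ^ 2 * U ^ 1100 * ((1 / (200 * U ^ 268)) / 32) ^ 2) +
            4096 / (P.δ ^ 2 * U ^ 1100 * ((1 / (200 * U ^ 268)) / 32) ^ 2)))) +
              1 / (50 * U ^ 268))) ≤ 1 / U := by
  have hδ := hP.δ_pos
  obtain ⟨hU, hd, -, hα0, -, -, -, hlog, -⟩ := hB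
  have hU0 : 0 < U := lt_of_lt_of_le (by norm_num) hU
  have hU1 : 1 ≤ U := le_trans (by norm_num) hU
  have h1 := deviation_term_le hU hδ hd (a := 32) (by norm_num) le_rfl
    (m := 1100) (k := 268) (j := 268) (by norm_num)
  have hl0 : 0 ≤ Real.log (64 * (α * P.T) + 1) := by
    apply Real.log_nonneg
    have := hP.T_pos
    have : 0 ≤ 64 * (α * P.T) := by positivity
    linarith
  have h2 : 4 / ((1 / (200 * U ^ 268)) / 16) * Real.log (64 * (α * P.T) + 1) / (100 * U ^ 538) ≤
      128 * (1 / U ^ 269) := by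
    have e : 4 / ((1 / (200 * U ^ 268)) / 16) = 12800 * U ^ 268 := by field_simp; norm_num
    rw [e, div_le_iff₀ (by positivity)]
    have e2 : 128 * (1 / U ^ 269) * (100 * U ^ 538) = 12800 * U ^ 268 * U := by
      field_simp; ring
    rw [e2]
    gcongr
  have h3 : 128 * (1 / U ^ 269) ≤ 1 / U ^ 268 := by
    rw [mul_one_div, div_le_div_iff₀ (by positivity) (by positivity), one_mul]
    exact mul_pow_le_pow hU (by norm_num) (by norm_num)
  have h4 : 1 / (50 * U ^ 538) ≤ 1 / U ^ 268 := by
    apply one_div_le_one_div_of_le (by positivity)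
    have := pow_le_pow_right₀ hU1 (show 268 ≤ 538 by norm_num)
    have : 0 < U ^ 538 := by positivity
    linarith
  have h5 : 1 / (50 * U ^ 268) ≤ 1 / U ^ 268 := by
    apply one_div_le_one_div_of_le (by positivity)
    have : 0 < U ^ 268 := by positivity
    linarith
  set D := 4096 / (P.δ ^ 2 * U ^ 1100 * ((1 / (200 * U ^ 268)) / 32) ^ 2)
  set J := 4 / ((1 / (200 * U ^ 268)) / 16) * Real.log (64 * (α * P.T) + 1) / (100 * U ^ 538)
  have hD : 0 ≤ D := by positivity
  have hJ : 0 ≤ J := by positivity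
  have h6 : 64 * (1 / (50 * U ^ 538)) + (16 * (1 / (50 * U ^ 268) + (J + (D + D))) +
      1 / (50 * U ^ 268)) ≤ 129 * (1 / U ^ 268) := by linarith
  refine (mul_le_mul hB0 h6 (by positivity) (by positivity)).trans ?_
  rw [le_div_iff₀ hU0]
  have e : U ^ 265 * (129 * (1 / U ^ 268)) * U = 129 * U ^ 266 / U ^ 268 := by field_simp
  rw [e, div_le_one (by positivity)]
  exact mul_pow_le_pow hU (by norm_num) (by norm_num)

lemma node_term_le :
    (N * (16 * (α * P.T))) * ((N * 16) * (ρ ^ 4 / P.T * (4 *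
      (4096 / (P.δ ^ 2 * U ^ 84 * ((1 / (200 * U ^ 26)) / 8) ^ 2) + 1 / (50 * U ^ 26))))) ≤
        1 / U := by
  have hδ := hP.δ_pos
  have hT := hP.T_pos
  obtain ⟨hU, hd, hN, hα0, hα, hρ0, hρ, -, -⟩ := hB
  have hU0 : 0 < U := lt_of_lt_of_le (by norm_num) hU
  have hU1 : 1 ≤ U := le_trans (by norm_num) hU
  have h1 := deviation_term_le hU hδ hd (a := 8) (by norm_num) (by norm_num)
    (m := 84) (k := 26) (j := 26) (by norm_num)
  have h5 : 1 / (50 * U ^ 26) ≤ 1 / U ^ 26 := by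
    apply one_div_le_one_div_of_le (by positivity)
    have : 0 < U ^ 26 := by positivity
    linarith
  set D := 4096 / (P.δ ^ 2 * U ^ 84 * ((1 / (200 * U ^ 26)) / 8) ^ 2)
  have hD : 0 ≤ D := by positivity
  have e : (N * (16 * (α * P.T))) * ((N * 16) * (ρ ^ 4 / P.T * (4 * (D + 1 / (50 * U ^ 26))))) =
      1024 * (N * N * α * ρ ^ 4) * (D + 1 / (50 * U ^ 26)) := by field_simp; ring
  rw [e]
  calc 1024 * (N * N * α * ρ ^ 4) * (D + 1 / (50 * U ^ 26))
      ≤ 1024 * (U * U * U * (U ^ 5) ^ 4) * (1 / U ^ 26 + 1 / U ^ 26) := by gcongr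
    _ = 2048 * U ^ 23 / U ^ 26 := by field_simp; ring
    _ ≤ 1 / U := by
      rw [div_le_div_iff₀ (by positivity) hU0, one_mul]
      calc 2048 * U ^ 23 * U = 2048 * U ^ 24 := by ring
        _ ≤ U ^ 26 := mul_pow_le_pow hU (by norm_num) (by norm_num)

lemma edge_term_le {m : ℝ} (hm : 0 < m) :
    (m * (2 * ((324 * N ^ 2) * ((U ^ 1100) ^ 2 / P.δ ^ 8 / √P.T) + U ^ 540 / √P.T))) /
      (U ^ 2213 * (m / √P.T)) ≤ 1 / U := by
  have hδ := hP.δ_pos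
  have hs := hP.sqrt_pos
  obtain ⟨hU, hd, hN, -, -, -, -, -, -⟩ := hB
  have hU0 : 0 < U := lt_of_lt_of_le (by norm_num) hU
  have hd' : 1 / P.δ ≤ U := by rw [div_le_iff₀ hδ]; linarith
  have e : (m * (2 * ((324 * N ^ 2) * ((U ^ 1100) ^ 2 / P.δ ^ 8 / √P.T) + U ^ 540 / √P.T))) /
      (U ^ 2213 * (m / √P.T)) =
      (648 * N ^ 2 * (U ^ 1100) ^ 2 * (1 / P.δ) ^ 8 + 2 * U ^ 540) / U ^ 2213 := by
    field_simp; ring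
  rw [e, div_le_div_iff₀ (by positivity) hU0, one_mul]
  calc (648 * N ^ 2 * (U ^ 1100) ^ 2 * (1 / P.δ) ^ 8 + 2 * U ^ 540) * U
      ≤ (648 * U ^ 2 * (U ^ 1100) ^ 2 * U ^ 8 + 2 * U ^ 540) * U := by gcongr
    _ = 648 * U ^ 2211 + 2 * U ^ 541 := by ring
    _ ≤ 648 * U ^ 2211 + U ^ 2211 :=
        add_le_add_right (mul_pow_le_pow hU (by norm_num) (by norm_num)) _
    _ = 649 * U ^ 2211 := by ring
    _ ≤ U ^ 2213 := mul_pow_le_pow hU (by norm_num) (by norm_num)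

/-- The exponents are fixed in this order. The third shift takes 26, against U²³ in the union bound
for nodes. Then Z takes 84 ≥ 3·26 + 4, which bounds the expected number of tracked configurations by
U²⁶⁵. The second shift takes 268 to beat that. A jump loses 1/η, about U²⁶⁸, and a logarithm, so the
first shift takes 538. Finally Y takes 1100 ≥ 2·538 + 4 and F takes 540 = 2·268 + 4. There is no
circle because Y and F do not influence what is tracked. -/
lemma Pr_not_success_le_third (hN : N = P.numScales) (hL : ∀ i, 1 ≤ shiftParam U i)
    (hG : ((fourCycles G).ncard : ℝ) ≤ α * P.T) (hm : 0 < (edgesOf G).card) (cap : ℕ) :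
    (outcomeDist P ρ (U ^ 84) (U ^ 1100) (U ^ 540) n N hL).Pr (fun ω =>
      ¬ (toEnv P (U ^ 84) (U ^ 1100) (U ^ 540) cap ω).Success G
        (fun i => shiftBase (shiftParam U i)) ((1 / (200 * U ^ 268)) / 16)
        ((1 / (200 * U ^ 538)) / 24) ((1 / (200 * U ^ 268)) / 8) ((1 / (200 * U ^ 268)) / 32)
        ((1 / (200 * U ^ 26)) / 8) (U ^ 266) (U ^ 2213 * ((edgesOf G).card / √P.T))) ≤ 1 / 3 := by
  have hs := hP.sqrt_pos
  have hU := hB.U_ge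
  have hU0 : 0 < U := lt_of_lt_of_le (by norm_num) hU
  have hU1 : 1 ≤ U := le_trans (by norm_num) hU
  have hm' : (0 : ℝ) < (edgesOf G).card := by exact_mod_cast hm
  have small : ∀ k : ℕ, ∀ a : ℝ, 1 ≤ a → (1 / (200 * U ^ k)) / a ≤ 1 := fun k a ha => by
    rw [div_le_one (by linarith), div_le_iff₀ (by positivity)]
    have : 1 ≤ U ^ k := one_le_pow₀ hU1
    nlinarith
  refine (Pr_not_success_le hL hP hN (M := U ^ 1100) hB.ρ_ge (one_le_pow₀ hU1) (one_le_pow₀ hU1)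
    (by positivity) (hB.ρ_le.trans (pow_le_pow_right₀ hU1 (by norm_num)))
    (pow_le_pow_right₀ hU1 (by norm_num)) le_rfl hG cap (by positivity)
    (small _ _ (by norm_num)) (by positivity) (small _ _ (by norm_num)) (by positivity)
    (small _ _ (by norm_num)) (by positivity) (by positivity) (by positivity) (by positivity)
    hB.α_ge).trans ?_
  have hn0 : (0 : ℝ) ≤ n := by positivity
  have t1 : (N * (6 * (n * n)) : ℝ) *
      (2 * Real.exp (-(((1 / (200 * U ^ 538)) / 24) ^ 2 * U ^ 1100 / 2))) ≤ 1 / U :=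
    le_trans (by gcongr; exact hB.scales) (exp_term_le hU
      (exponent_ge hU (by norm_num) (by norm_num) (by norm_num)) hn0 hB.n_le)
  have t2 : (n * n : ℝ) *
      (2 * Real.exp (-(((1 / (200 * U ^ 268)) / 8) ^ 2 * U ^ 540 / 2))) ≤ 1 / U := by
    refine le_trans ?_ (exp_term_le hU
      (exponent_ge hU (a := 8) (m := 540) (k := 268) (by norm_num) (by norm_num) (by norm_num))
        hn0 hB.n_le)
    refine mul_le_mul_of_nonneg_right ?_ (by positivity)
    have : 0 ≤ (n * n : ℝ) := by positivity
    nlinarith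
  have t3 := config_term_le hP hB (popBound_le hP hB)
  have t4 := node_term_le hP hB
  have t5 : popBound P α ρ (U ^ 84) N / U ^ 266 ≤ 1 / U := by
    rw [div_le_div_iff₀ (by positivity) hU0, one_mul]
    calc _ ≤ U ^ 265 * U := mul_le_mul_of_nonneg_right (popBound_le hP hB) hU0.le
      _ = U ^ 266 := by ring
  have t6 := edge_term_le hP hB hm'
  have hinv : 1 / U ≤ 1 / 10 ^ 6 := one_div_le_one_div_of_le (by norm_num) hU
  refine (add_le_add t1 (add_le_add t2 (add_le_add t3 (add_le_add t4 (add_le_add t5 t6))))).trans ?_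
  linarith

end Bounded

end

section

variable {n N : ℕ} {P : Params} {G : SimpleGraph (Fin n)}

/-! ### The oracle -/

/-- The counting algorithm, too, samples at the base rates times a constant factor, so r is treated
like Z and Y. -/
lemma setDist_eq (hP : P.Good) :
    setDist P n = rateDist P (P.c / P.δ ^ (3.5 : ℝ)) n P.numScales := by
  have hδ := hP.δ_pos
  have hs := hP.sqrt_pos
  have h : ∀ (k : ℤ) l, P.prob k l = rate P (P.c / P.δ ^ (3.5 : ℝ)) k l := by
    intro k l
    have hκ := hP.κ_pos k
    have hd : 0 < P.δ ^ (3.5 : ℝ) := Real.rpow_pos_of_pos hδ _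
    unfold Params.prob rate Params.base
    congr 1
    split_ifs <;> field_simp
  unfold setDist rateDist
  simp only [h]

/-- The bound on the number of edges remembered for each group. -/
def groupCap (U : ℝ) : ℕ := ⌈U ^ 1102⌉₊

/-- The parameters and choices of the oracle, as a function of the coins. -/
def coinEnv (P : Params) (U : ℝ) (r : Sample n N) (w : Coins n N) : Env n N :=
  ⟨P, U ^ 84, U ^ 1100, U ^ 540, groupCap U, shifts (shiftParam U) r, r.1, w.1, w.2.1, w.2.2⟩

/-- The oracle that remembers edges according to `Env.keep`, with the encoding `enc`. -/
def llmOracle (P : Params) (U : ℝ) (n N : ℕ) (enc : Finset (Sym2 (Fin n)) → List Bool) :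
    Oracle n N :=
  edgeOracle (coinDist P (U ^ 84) (U ^ 1100) (U ^ 540) n N).toPMF enc
    (fun i r w => (coinEnv P U r w).keep i) fun r w S q => (coinEnv P U r w).EstLLM (recon S) q

/-- The events required of the oracle and the estimates. -/
def Good (P : Params) (U : ℝ) (G : SimpleGraph (Fin n)) (r : Sample n N) (w : Coins n N) : Prop :=
  (∀ i, 1 ≤ shifts (shiftParam U) r i ∧ shifts (shiftParam U) r i ≤ 2) ∧
  (coinEnv P U r w).Success G (fun i => shiftBase (shiftParam U i)) ((1 / (200 * U ^ 268)) / 16)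
    ((1 / (200 * U ^ 538)) / 24) ((1 / (200 * U ^ 268)) / 8) ((1 / (200 * U ^ 268)) / 32)
    ((1 / (200 * U ^ 26)) / 8) (U ^ 266) (U ^ 2213 * ((edgesOf G).card / √P.T))

lemma card_edgesOf (G : SimpleGraph (Fin n)) : (edgesOf G).card = G.edgeSet.ncard := by
  unfold edgesOf
  rw [← ncard_eq_card_filt]
  rfl

/-! ### Consequences of success for the oracle. -/

section Bounded

variable {α ρ U : ℝ} (hP : P.Good)
include hP

lemma two_thirds_le_probability (hρ : ρ = P.c / P.δ ^ (3.5 : ℝ))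
    (hB : P.Bounded α ρ U n P.numScales) (hG : ((fourCycles G).ncard : ℝ) ≤ α * P.T)
    (hm : 0 < (edgesOf G).card) (enc : Finset (Sym2 (Fin n)) → List Bool)
    (E' : Sample n P.numScales → (llmOracle P U n P.numScales enc).Coins → Prop)
    (hE : ∀ r w, Good P U G r w → E' r w) :
    2 / 3 ≤ (llmOracle P U n P.numScales enc).probability (sampleLaw P (shiftParam U) n) E' := by
  have hL : ∀ i, 1 ≤ shiftParam U i :=
    one_le_shiftParam (le_trans (by norm_num) hB.U_ge)
  refine le_trans ?_ (ofReal_Pr_le_probability P (shiftParam U) hL n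
    (coinDist P (U ^ 84) (U ^ 1100) (U ^ 540) n P.numScales) (llmOracle P U n P.numScales enc) rfl
    HEq.rfl (Good P U G) E' hE)
  have h1 := Pr_not_success_le_third hP hB rfl hL hG hm (groupCap U)
  rw [FinProb.Pr_not] at h1
  have h2 : ((setDist P n).E fun r => (coinDist P (U ^ 84) (U ^ 1100) (U ^ 540) n P.numScales).E
      fun w => (shiftDist (shiftParam U) hL).E fun e =>
        ind (Good P U G (toSample (r, e)) w)) = (outcomeDist P ρ (U ^ 84) (U ^ 1100) (U ^ 540) n
      P.numScales hL).Pr (fun ω => (∀ i, 1 ≤ shiftVec (shiftParam U) ω.2.2 i ∧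
        shiftVec (shiftParam U) ω.2.2 i ≤ 2) ∧
      (toEnv P (U ^ 84) (U ^ 1100) (U ^ 540) (groupCap U) ω).Success G
        (fun i => shiftBase (shiftParam U i)) ((1 / (200 * U ^ 268)) / 16)
        ((1 / (200 * U ^ 538)) / 24) ((1 / (200 * U ^ 268)) / 8) ((1 / (200 * U ^ 268)) / 32)
        ((1 / (200 * U ^ 26)) / 8) (U ^ 266) (U ^ 2213 * ((edgesOf G).card / √P.T))) := by
    rw [FinProb.Pr_eq_E_ind, outcomeDist, FinProb.E_prod, setDist_eq hP, hρ]
    simp only [FinProb.E_prod _ (shiftDist (shiftParam U) hL)]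
    rfl
  change _ ≤ ENNReal.ofReal ((setDist P n).E fun r =>
    (coinDist P (U ^ 84) (U ^ 1100) (U ^ 540) n P.numScales).E
      fun w => (shiftDist (shiftParam U) hL).E fun e => ind (Good P U G (toSample (r, e)) w))
  rw [h2]
  refine le_trans (b := ENNReal.ofReal (2 / 3)) ?_ (ENNReal.ofReal_le_ofReal ?_)
  · rw [ENNReal.ofReal_div_of_pos (by norm_num)]; simp
  · refine le_trans ?_ (FinProb.Pr_mono _ fun ω h => ⟨fun i =>
      ⟨one_le_shiftVec hL ω.2.2 i, shiftVec_le hL ω.2.2 i⟩, h⟩)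
    linarith

omit hP in
lemma Good.accurate (hU : 1 ≤ U) {r : Sample n P.numScales} {w : Coins n P.numScales}
    (h : Good P U G r w) :
    (coinEnv P U r w).Accurate G (fun i => shiftBase (shiftParam U i)) ((1 / (200 * U ^ 268)) / 16)
      ((1 / (200 * U ^ 538)) / 24) ((1 / (200 * U ^ 268)) / 8) ((1 / (200 * U ^ 268)) / 32)
      ((1 / (200 * U ^ 26)) / 8) := by
  have hU0 : 0 < U := by linarith
  have b0 : shiftBase (shiftParam U 0) - 1 = 1 / (200 * U ^ 538) := by
    simp [shiftBase, shiftParam]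
  have b1 : shiftBase (shiftParam U 1) - 1 = 1 / (200 * U ^ 268) := by
    simp [shiftBase, shiftParam]
  have b2 : shiftBase (shiftParam U 2) - 1 = 1 / (200 * U ^ 26) := by
    simp [shiftBase, shiftParam]
  have p1 : 0 < 1 / (200 * U ^ 268) := by positivity
  have hb1 := shiftBase_le (one_le_shiftParam hU 1)
  exact {
    scales := rfl
    s_ge := fun i => (h.1 i).1
    s_le := fun i => (h.1 i).2
    b_gt := fun i => one_lt_shiftBase (one_le_shiftParam hU i)
    b_le := fun i => shiftBase_le (one_le_shiftParam hU i)
    γ₀_nonneg := by positivity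
    γ₀_le := by simp only [b0]; linarith
    γ₁_nonneg := by positivity
    γ₁_le := by simp only [b1]; exact le_rfl
    γ_nonneg := by positivity
    η_nonneg := by positivity
    η_le := by linarith
    γ_le := by simp only [b1]; linarith
    γ₂_nonneg := by positivity
    γ₂_le := by simp only [b2]; exact le_rfl
    wedges := h.2.wedges
    edges := h.2.edges }

lemma Good.output (hU : 10 ^ 6 ≤ U) (hd : 1 ≤ P.δ * U) {r : Sample n P.numScales}
    {w : Coins n P.numScales} (h : Good P U G r w) {enc : Finset (Sym2 (Fin n)) → List Bool}
    (henc : Function.Injective enc) {stream : Fin 3 → List (Sym2 (Fin n))}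
    (hs : ∀ i, IsEdgeStream G (stream i)) {q : Config n P.numScales} (hq : IsRealized G r q) :
    (llmOracle P U n P.numScales enc).output r w stream q = true ↔
      IsLLM P (shifts (shiftParam U) r) G q := by
  have hU1 : 1 ≤ U := le_trans (by norm_num) hU
  have hU0 : 0 < U := by linarith
  have hδ := hP.δ_pos
  unfold llmOracle
  rw [edgeOracle_output _ _ _ _ henc]
  have hcap : (coinEnv P U r w).s 0 * (coinEnv P U r w).MY / (coinEnv P U r w).P.δ + 1 <
      (coinEnv P U r w).cap := by
    change shifts (shiftParam U) r 0 * U ^ 1100 / P.δ + 1 < (groupCap U : ℝ)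
    have h1 : U ^ 1102 ≤ (groupCap U : ℝ) := Nat.le_ceil _
    -- From s₁ ≤ 2 and 1/δ ≤ U; the cap has one more power of U than this bound.
    have h2 : shifts (shiftParam U) r 0 * U ^ 1100 / P.δ ≤ 2 * U ^ 1101 := by
      rw [div_le_iff₀ hδ]
      have h3 : (1 : ℝ) * U ^ 1100 ≤ P.δ * U * U ^ 1100 := by gcongr
      calc shifts (shiftParam U) r 0 * U ^ 1100 ≤ 2 * U ^ 1100 := by
            gcongr; exact (h.1 0).2
        _ ≤ 2 * (P.δ * U * U ^ 1100) := by linarith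
        _ = 2 * U ^ 1101 * P.δ := by ring
    have h4 := mul_pow_le_pow hU (a := 4) (j := 1101) (k := 1102) (by norm_num) (by norm_num)
    have h5 : 1 ≤ U ^ 1101 := one_le_pow₀ hU1
    linarith
  exact h.2.estLLM_recon_iff (V := coinEnv P U r w) hP (h.accurate hU1)
    (show 0 < U ^ 1100 by positivity) hcap ((coinEnv P U r w).memSpec hP G stream hs) hq.1 hq.2

lemma Good.ncard_realized_le {r : Sample n P.numScales}
    {w : Coins n P.numScales} (h : Good P U G r w) :
    ({q | IsRealized G r q}.ncard : ℝ) ≤ U ^ 266 := by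
  refine le_trans ?_ (not_lt.1 h.2.card_pop)
  exact_mod_cast Env.ncard_realized_le (V := coinEnv P U r w) hP (e := r.2)

lemma Good.spaceAtMost (hU : 10 ^ 6 ≤ U) {r : Sample n P.numScales}
    {w : Coins n P.numScales} (h : Good P U G r w) {enc : Finset (Sym2 (Fin n)) → List Bool}
    (henc : Function.Injective enc) {bits : ℕ} (hlen : ∀ S, (enc S).length = bits * S.card)
    (hbits : (bits : ℝ) ≤ U ^ 2) (hm : √P.T ≤ 2 * (edgesOf G).card)
    {stream : Fin 3 → List (Sym2 (Fin n))} (hs : ∀ i, IsEdgeStream G (stream i)) {b : ℝ}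
    (hb : U ^ 4000 ≤ b) :
    (llmOracle P U n P.numScales enc).SpaceAtMost r w stream (b * (G.edgeSet.ncard / √P.T)) := by
  have hU1 : 1 ≤ U := le_trans (by norm_num) hU
  have hU0 : 0 < U := by linarith
  have hsq := hP.sqrt_pos
  refine edgeOracle_spaceAtMost _ _ _ _ henc bits hlen r w stream _ ?_
  rw [← card_edgesOf]
  have h1 := h.2.card_memory_le ((coinEnv P U r w).memSpec hP G stream hs)
  set Q : ℝ := (edgesOf G).card / √P.T with hQ
  -- Because √T ≤ 2m, the edges counted per configuration, without the factor m/√T, can be charged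
  -- to it.
  have hQ1 : 1 ≤ 2 * Q := by
    rw [hQ, ← mul_div_assoc, le_div_iff₀ hsq]; linarith
  have hQ0 : 0 ≤ Q := by linarith
  have h2 : (1 : ℝ) + (coinEnv P U r w).cap ≤ 3 * U ^ 1102 := by
    change (1 : ℝ) + (groupCap U : ℝ) ≤ _
    have h3 := (Nat.ceil_lt_add_one (show 0 ≤ U ^ 1102 by positivity)).le
    have h5 : 1 ≤ U ^ 1102 := one_le_pow₀ hU1
    unfold groupCap
    linarith
  refine (mul_le_mul hbits h1 (by positivity) (by positivity)).trans ?_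
  calc U ^ 2 * (U ^ 2213 * Q + 4 * U ^ 266 +
        U ^ 266 * (48 * (U ^ 2213 * Q)) * (1 + (coinEnv P U r w).cap))
      ≤ U ^ 2 * (U ^ 2213 * Q + 4 * U ^ 266 * (2 * Q) +
        U ^ 266 * (48 * (U ^ 2213 * Q)) * (3 * U ^ 1102)) := by
        refine mul_le_mul_of_nonneg_left (add_le_add (add_le_add le_rfl
          (le_mul_of_one_le_right (by positivity) hQ1)) ?_) (by positivity)
        exact mul_le_mul_of_nonneg_left h2 (by positivity)
    -- The dominant exponent collects bits, tracked configurations, first-pass edges and cap: 2 +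
    -- 266 + 2213 + 1102.
    _ = (U ^ 2215 + 8 * U ^ 268 + 144 * U ^ 3583) * Q := by ring
    _ ≤ (U ^ 3583 + U ^ 3583 + 144 * U ^ 3583) * Q := by
        refine mul_le_mul_of_nonneg_right (add_le_add_left (add_le_add
          (pow_le_pow_right₀ hU1 (by norm_num))
          (mul_pow_le_pow hU (by norm_num) (by norm_num))) _) hQ0
    _ = 146 * U ^ 3583 * Q := by ring
    _ ≤ U ^ 4000 * Q := by
        gcongr
        exact mul_pow_le_pow hU (by norm_num) (by norm_num)
    _ ≤ b * Q := by gcongr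

end Bounded

end

section

variable {n N : ℕ} {P : Params} {G : SimpleGraph (Fin n)}

/-! ### Polylogarithmic bounds -/

/-- The polylogarithmic quantity in terms of which all parameters are chosen. -/
def polyBound (α c : ℝ) (n : ℕ) (ε : ℝ) : ℝ := 10 ^ 6 * α * c * (logb 2 n / ε) ^ 3

lemma one_le_logb_natCast (hn : 2 ≤ n) : 1 ≤ logb 2 n := by
  rw [Real.le_logb_iff_rpow_le (by norm_num) (by positivity)]
  simpa using hn

lemma one_le_logb_div (hn : 2 ≤ n) {ε : ℝ} (hε : 0 < ε) (hε1 : ε ≤ 1) : 1 ≤ logb 2 n / ε := by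
  rw [le_div_iff₀ hε]
  linarith [one_le_logb_natCast hn]

lemma logb_le_div (hn : 2 ≤ n) {ε : ℝ} (hε : 0 < ε) (hε1 : ε ≤ 1) :
    logb 2 n ≤ logb 2 n / ε := by
  rw [le_div_iff₀ hε]
  nlinarith [one_le_logb_natCast hn]

lemma one_le_polylog {K : ℕ} (hK : 1 ≤ K) (hn : 2 ≤ n) {ε : ℝ} (hε : 0 < ε) (hε1 : ε ≤ 1) :
    1 ≤ polylog K n ε :=
  one_le_mul_of_one_le_of_one_le (by exact_mod_cast hK) (one_le_pow₀ (one_le_logb_div hn hε hε1))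

lemma polyBound_pow_le_polylog {α c : ℝ} (hn : 2 ≤ n) {ε : ℝ} (hε : 0 < ε) (hε1 : ε ≤ 1) :
    polyBound α c n ε ^ 4000 ≤ polylog (⌈(10 ^ 6 * α * c) ^ 4000⌉₊ + 12000) n ε := by
  have hX := one_le_logb_div hn hε hε1
  unfold polyBound polylog
  rw [mul_pow, ← pow_mul]
  have h1 : (10 ^ 6 * α * c) ^ 4000 ≤ (⌈(10 ^ 6 * α * c) ^ 4000⌉₊ : ℝ) := Nat.le_ceil _
  refine mul_le_mul ?_ (pow_le_pow_right₀ hX (Nat.le_add_left _ _)) (by positivity) (by positivity)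
  rw [Nat.cast_add]
  exact h1.trans (le_add_of_nonneg_right (Nat.cast_nonneg _))

lemma le_polyBound {α c : ℝ} (hα : 1 ≤ α) (hc : 1 ≤ c) (hn : 2 ≤ n) {ε : ℝ} (hε : 0 < ε)
    (hε1 : ε ≤ 1) : 10 ^ 6 * α * (logb 2 n / ε) ^ 3 ≤ polyBound α c n ε := by
  have hX := one_le_logb_div hn hε hε1
  unfold polyBound
  have : 10 ^ 6 * α * c * (logb 2 n / ε) ^ 3 = c * (10 ^ 6 * α * (logb 2 n / ε) ^ 3) := by ring
  rw [this]
  exact le_mul_of_one_le_left (by positivity) hc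

/-- From T ≤ n⁴ follows log T ≤ 4 log n and 1/δ ≤ 2098·4³(log n/ε)³; this is why `polyBound`
contains a cube and the factor 10⁶. -/
lemma Params.bounded {α c : ℝ} (hα : 1 ≤ α) (hc : 1 ≤ c) (hn : 2 ≤ n) (hP : P.Good)
    (hPc : P.c = c) (hT : P.T ≤ (n : ℝ) ^ 4) :
    P.Bounded α (P.c / P.δ ^ (3.5 : ℝ)) (polyBound α c n P.ε) n P.numScales := by
  have hTpos := hP.T_pos
  have hε := hP.ε_pos
  have hε1 := hP.ε_le
  have hδ := hP.δ_pos
  have hlog := one_le_logb_natCast hn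
  have hX := one_le_logb_div hn hε hε1
  have hlX := logb_le_div hn hε hε1
  have hU := le_polyBound hα hc hn hε hε1
  set X := logb 2 n / P.ε with hXdef
  set U := polyBound α c n P.ε with hUdef
  have hn0 : (0 : ℝ) < n := by positivity
  have hX3 : X ≤ X ^ 3 := le_self_pow₀ hX (by norm_num)
  have hX0 : 0 < X := by linarith
  have hαX : α * X ≤ α * X ^ 3 := by gcongr
  have hαX1 : α ≤ α * X := le_mul_of_one_le_right (by linarith) hX
  have hX1 : X ≤ α * X := le_mul_of_one_le_left (by linarith) hα
  have hU' : 10 ^ 6 * (α * X) ≤ U := le_trans (by linarith) hU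
  have hlT : logb 2 P.T ≤ 4 * logb 2 n := by
    have h := Real.logb_le_logb_of_le (b := 2) (by norm_num) hTpos hT
    rwa [← Real.rpow_natCast, Real.logb_rpow_eq_mul_logb_of_pos hn0] at h
  have hlT1 := hP.one_le_log
  have hd : 1 / P.δ ≤ 134272 * X ^ 3 := by
    unfold Params.δ
    rw [one_div_div, hXdef, div_pow, ← mul_div_assoc]
    have h1 : logb 2 P.T ^ 3 ≤ (4 * logb 2 n) ^ 3 := by gcongr
    have h2 : P.ε ^ 3 ≤ P.ε := pow_le_of_le_one hε.le hε1 (by norm_num)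
    calc 2098 * logb 2 P.T ^ 3 / P.ε ≤ 2098 * (4 * logb 2 n) ^ 3 / P.ε ^ 3 := by gcongr
      _ = 134272 * logb 2 n ^ 3 / P.ε ^ 3 := by ring
  have hd' : 1 / P.δ ≤ U := by
    have : X ^ 3 ≤ α * X ^ 3 := le_mul_of_one_le_left (by positivity) hα
    linarith
  have hU6 : 10 ^ 6 ≤ U := by linarith
  have hcU : c ≤ U := by
    have h1 : U = c * (10 ^ 6 * α * X ^ 3) := by rw [hUdef, polyBound]; ring
    rw [h1]
    exact le_mul_of_one_le_right (by linarith) (by linarith)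
  have hU0 : 0 < U := by linarith
  refine ⟨hU6, ?_, ?_, by linarith, by linarith, ?_, ?_, ?_, ?_⟩
  · rw [div_le_iff₀ hδ] at hd'; linarith
  · unfold Params.numScales
    push_cast
    have h1 : logb 2 (P.T ^ (1 / 4 : ℝ)) = 1 / 4 * logb 2 P.T :=
      Real.logb_rpow_eq_mul_logb_of_pos hTpos
    have h2 := (Nat.ceil_lt_add_one (show 0 ≤ logb 2 (P.T ^ (1 / 4 : ℝ)) by rw [h1]; linarith)).le
    rw [h1] at h2 ⊢
    linarith
  · rw [hPc]
    have := Real.rpow_pos_of_pos hδ (3.5 : ℝ)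
    exact div_nonneg (by linarith) this.le
  · have h1 : P.δ ^ 4 ≤ P.δ ^ (3.5 : ℝ) := by
      rw [← Real.rpow_natCast]
      exact Real.rpow_le_rpow_of_exponent_ge hδ hP.δ_le (by norm_num)
    rw [hPc]
    calc c / P.δ ^ (3.5 : ℝ) ≤ c / P.δ ^ 4 := by gcongr
      _ = c * (1 / P.δ) ^ 4 := by field_simp
      _ ≤ U * U ^ 4 := by gcongr
      _ = U ^ 5 := by ring
  · have h1 : 64 * (α * P.T) + 1 ≤ 65 * α * P.T := by
      have : 1 ≤ α * P.T := one_le_mul_of_one_le_of_one_le hα (by linarith [hP.two_le_T])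
      linarith
    have h2 : Real.log P.T ≤ logb 2 P.T := by
      have h3 : Real.log P.T = logb 2 P.T * Real.log 2 := by
        unfold logb; field_simp
      rw [h3]
      have := Real.log_two_lt_d9
      nlinarith
    have h4 := Real.log_le_sub_one_of_pos (show (0 : ℝ) < 65 by norm_num)
    have h5 := Real.log_le_sub_one_of_pos (show 0 < α by linarith)
    refine (Real.log_le_log (by positivity) h1).trans ?_
    rw [Real.log_mul (by positivity) hTpos.ne', Real.log_mul (by norm_num) (by positivity)]
    linarith
  · have h2 : Real.log n ≤ logb 2 n := by
      have h3 : Real.log n = logb 2 n * Real.log 2 := by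
        unfold logb; field_simp
      rw [h3]
      have := Real.log_two_lt_d9
      nlinarith
    rw [← Real.log_le_iff_le_exp hn0]
    linarith

lemma exists_edgeCode {α c : ℝ} (hα : 1 ≤ α) (hc : 1 ≤ c) (hn : 2 ≤ n) {ε : ℝ} (hε : 0 < ε)
    (hε1 : ε ≤ 1) : ∃ (bits : ℕ) (enc : Finset (Sym2 (Fin n)) → List Bool),
      Function.Injective enc ∧ (∀ S, (enc S).length = bits * S.card) ∧
        (bits : ℝ) ≤ polyBound α c n ε ^ 2 := by
  have hX := one_le_logb_div hn hε hε1
  have hlX := logb_le_div hn hε hε1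
  have hU := le_polyBound hα hc hn hε hε1
  set X := logb 2 n / ε
  have hX3 : X ≤ X ^ 3 := le_self_pow₀ hX (by norm_num)
  have hαX : X ^ 3 ≤ α * X ^ 3 := le_mul_of_one_le_left (by positivity) hα
  have hcard : Fintype.card (Sym2 (Fin n)) ≤ 2 ^ (2 * (Nat.log 2 n + 1)) := by
    have h1 : Fintype.card (Sym2 (Fin n)) ≤ Fintype.card (Fin n × Fin n) :=
      Fintype.card_le_of_surjective (fun p : Fin n × Fin n => s(p.1, p.2)) fun e => by
        induction e with
        | _ a b => exact ⟨(a, b), rfl⟩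
    have h2 : n ≤ 2 ^ (Nat.log 2 n + 1) := (Nat.lt_pow_succ_log_self (by norm_num) n).le
    rw [Fintype.card_prod, Fintype.card_fin] at h1
    calc Fintype.card (Sym2 (Fin n)) ≤ n * n := h1
      _ ≤ 2 ^ (Nat.log 2 n + 1) * 2 ^ (Nat.log 2 n + 1) := Nat.mul_le_mul h2 h2
      _ = 2 ^ (2 * (Nat.log 2 n + 1)) := by ring
  obtain ⟨enc, h1, h2⟩ := exists_bitCode (Sym2 (Fin n)) (2 * (Nat.log 2 n + 1)) (by omega) hcard
  refine ⟨_, enc, h1, h2, ?_⟩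
  have h3 : (Nat.log 2 n : ℝ) ≤ logb 2 n := by exact_mod_cast Real.natLog_le_logb n 2
  push_cast
  nlinarith

lemma sqrt_le_two_mul_card (h : P.T ≤ (fourCycles G).ncard) : √P.T ≤ 2 * (edgesOf G).card := by
  rw [card_edgesOf]
  refine Real.sqrt_le_left (by positivity) |>.2 (h.trans ?_)
  exact_mod_cast card_fourCycles_le_sq G

end

end FourCycleStream

end

/-! ### The proposition. -/

theorem proposition6p6 (α c : ℝ) (hα : 1 ≤ α) (hc : 1 ≤ c) :
    ∃ K : ℕ, ∀ (n : ℕ) (P : FourCycleStream.Params), 2 ≤ n →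
      P.c = c → 2 ≤ P.T → 0 < P.ε → P.ε ≤ 1 →
      ∃ L : Fin 3 → ℝ, (∀ i, 1 ≤ L i ∧ L i ≤ FourCycleStream.polylog K n P.ε) ∧
      ∃ O : FourCycleStream.Oracle n P.numScales,
        ∀ G : SimpleGraph (Fin n),
          P.T ≤ (FourCycleStream.fourCycles G).ncard →
          (FourCycleStream.fourCycles G).ncard ≤ α * P.T →
          ∀ stream : Fin 3 → List (Sym2 (Fin n)),
            (∀ i, FourCycleStream.IsEdgeStream G (stream i)) →
            2 / 3 ≤ O.probability (FourCycleStream.sampleLaw P L n) fun r w =>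
              ({q | FourCycleStream.IsRealized G r q}.ncard : ℝ)
                  ≤ FourCycleStream.polylog K n P.ε ∧
              (∀ q, FourCycleStream.IsRealized G r q →
                (O.output r w stream q = true ↔
                  FourCycleStream.IsLLM P (FourCycleStream.shifts L r) G q)) ∧
              O.SpaceAtMost r w stream
                (FourCycleStream.polylog K n P.ε * (G.edgeSet.ncard / √P.T)) := by
  refine ⟨⌈(10 ^ 6 * α * c) ^ 4000⌉₊ + 12000, fun n P hn hPc hT2 hε hε1 => ?_⟩
  have hP : P.Good := ⟨hT2, hε, hε1⟩
  have hΛ1 := FourCycleStream.one_le_polylog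
    (K := ⌈(10 ^ 6 * α * c) ^ 4000⌉₊ + 12000) (by omega) hn hε hε1
  have hΛ := FourCycleStream.polyBound_pow_le_polylog (α := α) (c := c) hn hε hε1
  set Λ := FourCycleStream.polylog (⌈(10 ^ 6 * α * c) ^ 4000⌉₊ + 12000) n P.ε
  obtain ⟨bits, enc, henc, hlen, hbits⟩ :=
    FourCycleStream.exists_edgeCode (n := n) hα hc hn hε hε1
  set U := FourCycleStream.polyBound α c n P.ε
  -- Only for T ≤ n⁴ does U control log T. For larger T no graph on n vertices has T four-cycles,
  -- and any oracle will do.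
  by_cases hT : P.T ≤ (n : ℝ) ^ 4
  · have hB := FourCycleStream.Params.bounded hα hc hn hP hPc hT
    have hU1 : 1 ≤ U := le_trans (by norm_num) hB.U_ge
    refine ⟨FourCycleStream.shiftParam U, fun i => ⟨FourCycleStream.one_le_shiftParam hU1 i,
      (FourCycleStream.shiftParam_le hU1 i).trans hΛ⟩,
      FourCycleStream.llmOracle P U n P.numScales enc, fun G hG1 hG2 stream hs => ?_⟩
    have hm := FourCycleStream.sqrt_le_two_mul_card hG1
    have hm0 : 0 < (FourCycleStream.edgesOf G).card := by
      have h0 : (0 : ℝ) < (FourCycleStream.edgesOf G).card := by linarith [hP.sqrt_pos]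
      exact_mod_cast h0
    refine FourCycleStream.two_thirds_le_probability hP rfl hB hG2 hm0 enc _ fun r w h =>
      ⟨?_, fun q hq => h.output hP hB.U_ge hB.δ_ge henc hs hq,
        h.spaceAtMost hP hB.U_ge henc hlen hbits hm hs hΛ⟩
    exact (h.ncard_realized_le hP).trans
      ((pow_le_pow_right₀ hU1 (by norm_num)).trans hΛ)
  · refine ⟨fun _ => 1, fun _ => ⟨le_rfl, hΛ1⟩,
      FourCycleStream.llmOracle P U n P.numScales enc, fun G hG1 => ?_⟩
    refine absurd (hG1.trans ?_) hT
    exact_mod_cast FourCycleStream.card_fourCycles_le_pow G
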